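/- Let $m\ge 1$, let $Cl_m$ be the real Clifford algebra over $\mathbb R^m$ with $x^2=-\|x\|^2$ for $x\in\mathbb R^m$, let $\tilde{\ }$ be reversion and $\bar{\ }$ Clifford conjugation on $Cl_m$, and $\|a\|^2=\sum_A a_A^2$ for $a=\sum_A a_Ae_A\in Cl_m$. For an integer $k\ge 0$ let $\mathcal H_k$ be the space of complex-valued harmonic polynomials on $\mathbb R^m$ that are homogeneous of degree $k$. Let $W$ be a finite-dimensional complex vector space with a left action of $Cl_m$ (for example a spinor space, or the complex Clifford algebra), and let $\mathcal M_k$ be the space of $W$-valued polynomials $f$ on $\mathbb R^m$ that are homogeneous of degree $k$ and left monogenic, $\sum_i e_i\,\partial_{u_i}f=0$. The reproducing kernel $Z$ of $V=\mathcal H_k$ (complex-valued) or $V=\mathcal M_k$ ($Cl_m$-valued, acting on $W$ from the left) is the kernel that lies in $V$ as a function of $u$ and satisfies $f(v)=\int_{\mathbb S^{m-1}}\overline{Z(u,v)}f(u)\,dS(u)$ for all $f\in V$. For an integer $j\ge1$ put $$E_{2j}(x,u,v)=\|x\|^{2j-m}Z\Big(\frac{xux}{\|x\|^2},v\Big)\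 (V=\mathcal H_k),\qquad E_{2j-1}(x,u,v)=\frac{x}{\|x\|^{m-2j+2}}Z\Big(\frac{xux}{\|x\|^2},v\Big)\ (V=\mathcal M_k).$$ Let $t=2j$ and $V=\mathcal H_k$, or $t=2j-1$ and $V=\mathcal M_k$. Let $\mathcal D_t=\mathcal D_{t,x,u}$ be a linear differential operator in $x$ on $C^\infty(\mathbb R^m,V)$, with constant coefficients in $\mathrm{End}(V)$, whose fundamental solution is a nonzero multiple of $E_t$: there is a complex number $\kappa\neq0$ with $$\mathcal D_{t,x,u}\big(\kappa E_t(x,u,v)\big)=\delta(x)\,Z(u,v)\quad\text{for all } v,\text{ in the sense of distributions in }x$$ (for $t=2j-1$, after both sides are applied to an arbitrary $w\in W$). Let $\varphi(y)=(ay+b)(cy+d)^{-1}$ be a Möbius transformation, where $a,b,c,d\in Cl_m$ are products of vectors of $\mathbb R^m$, where $a\tilde b,\ c\tilde d,\ \tilde ca,\ \tilde db\in\mathbb R^m$, and where $a\tilde d-b\tilde c=\pm1$. For $y\in\mathbb R^m$ with $cy+d\ne0$ and $u\in\mathbb R^m$ put $$y'=\varphi(y),\qquad u'=\frac{(cy+d)u\widetilde{(cy+d)}}{\|cy+d\|^2},$$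 $$J_{2j}(\varphi,y)=\|cy+d\|^{2j-m},\qquad J_{-2j}(\varphi,y)=\|cy+d\|^{-m-2j},$$ $$J_{2j-1}(\varphi,y)=\frac{\widetilde{cy+d}}{\|cy+d\|^{m-2j+2}},\qquad J_{-(2j-1)}(\varphi,y)=\varepsilon\,\frac{\widetilde{cy+d}}{\|cy+d\|^{m+2j}},\qquad \varepsilon=\frac{(a\tilde d-b\tilde c)\,(cy+d)\widetilde{(cy+d)}}{\|cy+d\|^2}\in\{1,-1\}.$$ Then $\mathcal D_{t,y',u'}=J_{-t}^{-1}(\varphi,y)\,\mathcal D_{t,y,u}\,J_t(\varphi,y)$, that is, for every $f\in C^\infty(\mathbb R^m,V)$, every $y$ with $cy+d\neq0$ and every $u$, $$(\mathcal D_tf)(y',u')=J_{-t}(\varphi,y)^{-1}\;\mathcal D_{t,y,u}\Big[J_t(\varphi,y)\,f\Big(\varphi(y),\frac{(cy+d)u\widetilde{(cy+d)}}{\|cy+d\|^2}\Big)\Big].$$ -/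

import Mathlib

open MeasureTheory
open scoped ContDiff

noncomputable section

namespace HigherSpin

/-! ### The Clifford algebra -/

/-- Euclidean space `ℝ^m`. -/
abbrev Vec (m : ℕ) : Type := EuclideanSpace ℝ (Fin m)

/-- The standard basis vector `e_i` of `ℝ^m`. -/
def stdVec {m : ℕ} (i : Fin m) : Vec m := EuclideanSpace.single i (1 : ℝ)

/-- The quadratic form `x ↦ -‖x‖²`. -/
def negSq (m : ℕ) : QuadraticForm ℝ (Vec m) :=
  -(LinearMap.BilinMap.toQuadraticMap (innerₗ (Vec m)))

/-- The real Clifford algebra `Cl_m`, with the relation `x² = -‖x‖²` for `x ∈ ℝ^m`. -/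
abbrev Cl (m : ℕ) : Type := CliffordAlgebra (negSq m)

/-- The embedding `ℝ^m ⊆ Cl_m`. -/
def vec {m : ℕ} (x : Vec m) : Cl m := CliffordAlgebra.ι (negSq m) x

/-- Reversion `a ↦ ã`, the anti-automorphism fixing all vectors. -/
def rev {m : ℕ} (a : Cl m) : Cl m := CliffordAlgebra.reverse a

/-- Clifford conjugation `a ↦ ā`, the anti-automorphism with `x ↦ -x` on vectors. -/
def conj {m : ℕ} (a : Cl m) : Cl m := CliffordAlgebra.reverse (CliffordAlgebra.involute a)

/-- The scalar part `a_∅` of `a = ∑_A a_A e_A`. -/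
def scalarPart {m : ℕ} (a : Cl m) : ℝ :=
  ExteriorAlgebra.algebraMapInv (CliffordAlgebra.equivExterior (negSq m) a)

/-- The vector part `∑_i a_{i} e_i` of `a = ∑_A a_A e_A`. -/
def vecPart {m : ℕ} (a : Cl m) : Vec m :=
  ExteriorAlgebra.ιInv (CliffordAlgebra.equivExterior (negSq m) a)

/-- The norm on `Cl_m`: `‖a‖² = ∑_A a_A²`, which is the scalar part of `ā a`. -/
def clNorm {m : ℕ} (a : Cl m) : ℝ := Real.sqrt (scalarPart (conj a * a))

/-- `a` is a (finite) product of vectors of `ℝ^m`. -/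
def IsVecProd {m : ℕ} (a : Cl m) : Prop := ∃ l : List (Vec m), a = (l.map vec).prod

/-- `a` lies in `ℝ^m ⊆ Cl_m`. -/
def IsVec {m : ℕ} (a : Cl m) : Prop := ∃ x : Vec m, a = vec x

/-! ### Möbius transformations -/

/-- The Ahlfors--Vahlen conditions on the coefficients of `(a y + b)(c y + d)⁻¹`. -/
structure IsVahlen {m : ℕ} (a b c d : Cl m) : Prop where
  prod_a : IsVecProd a
  prod_b : IsVecProd b
  prod_c : IsVecProd c
  prod_d : IsVecProd d
  vec_ab : IsVec (a * rev b)
  vec_cd : IsVec (c * rev d)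
  vec_ca : IsVec (rev c * a)
  vec_db : IsVec (rev d * b)
  det : a * rev d - b * rev c = 1 ∨ a * rev d - b * rev c = -1

/-- The Möbius transformation `φ(y) = (a y + b)(c y + d)⁻¹`. -/
def mobius {m : ℕ} (a b c d : Cl m) (y : Vec m) : Vec m :=
  vecPart ((a * vec y + b) * Ring.inverse (c * vec y + d))

/-- The vector `s u s̃ / ‖s‖²`. -/
def rot {m : ℕ} (s : Cl m) (u : Vec m) : Vec m :=
  (clNorm s ^ 2)⁻¹ • vecPart (s * vec u * rev s)

/-! ### Conformal weights (`s` stands for `c y + d`) -/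

/-- `J_{2j} = ‖c y + d‖^{2j-m}`. -/
def weightEven {m : ℕ} (j : ℕ) (s : Cl m) : ℝ := clNorm s ^ (2 * (j : ℤ) - (m : ℤ))

/-- `J_{-2j} = ‖c y + d‖^{-m-2j}`. -/
def coweightEven {m : ℕ} (j : ℕ) (s : Cl m) : ℝ := clNorm s ^ (-(m : ℤ) - 2 * (j : ℤ))

/-- `J_{2j-1} = (c y + d)~ / ‖c y + d‖^{m-2j+2}`. -/
def weightOdd {m : ℕ} (j : ℕ) (s : Cl m) : Cl m :=
  (clNorm s ^ ((m : ℤ) - 2 * (j : ℤ) + 2))⁻¹ • rev s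

/-- The sign `(a d̃ - b c̃) (s s̃) / ‖s‖²`; here `a d̃ - b c̃ = ±1` is the pseudo-determinant
and `s s̃ = ±‖s‖²`. -/
def vahlenSign {m : ℕ} (a b c d s : Cl m) : Cl m :=
  (clNorm s ^ 2)⁻¹ • ((a * rev d - b * rev c) * (s * rev s))

/-- `J_{-(2j-1)} = ε (c y + d)~ / ‖c y + d‖^{m+2j}`, with the sign `ε = ±1` above. -/
def coweightOdd {m : ℕ} (j : ℕ) (a b c d s : Cl m) : Cl m :=
  (clNorm s ^ ((m : ℤ) + 2 * (j : ℤ)))⁻¹ • (vahlenSign a b c d s * rev s)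

/-! ### The spaces `𝓗_k` and `𝓜_k` and their reproducing kernels -/

section Spaces

variable {m : ℕ} {W : Type*} [NormedAddCommGroup W] [NormedSpace ℂ W]

/-- `W`-valued polynomials on `ℝ^m`, homogeneous of degree `k`. -/
def homPoly (m k : ℕ) (W : Type*) [NormedAddCommGroup W] [NormedSpace ℂ W] :
    Submodule ℂ (Vec m → W) :=
  Submodule.span ℂ {f | ∃ (α : Fin m → ℕ) (w : W), (∑ i, α i = k) ∧
    f = fun u => ((∏ i, u i ^ α i : ℝ) : ℂ) • w}

/-- `f ∈ 𝓗_k`: complex-valued harmonic polynomials, homogeneous of degree `k`. -/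
def IsHarmonicPoly (k : ℕ) (f : Vec m → ℂ) : Prop :=
  f ∈ homPoly m k ℂ ∧ ∀ u, Laplacian.laplacian f u = 0

/-- The Dirac operator `D_u f = ∑_i e_i ∂_{u_i} f` on functions with values in a
left module over the Clifford algebra. -/
def dirac (ρ : Cl m →ₐ[ℝ] Module.End ℂ W) (f : Vec m → W) (u : Vec m) : W :=
  ∑ i : Fin m, ρ (vec (stdVec i)) (fderiv ℝ f u (stdVec i))

/-- `f ∈ 𝓜_k`: `W`-valued left monogenic polynomials, homogeneous of degree `k`. -/
def IsMonogenicPoly (ρ : Cl m →ₐ[ℝ] Module.End ℂ W) (k : ℕ) (f : Vec m → W) : Prop :=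
  f ∈ homPoly m k W ∧ ∀ u, dirac ρ f u = 0

/-- Surface measure on the unit sphere of `ℝ^m`. -/
def sphereMeasure (m : ℕ) : Measure (Metric.sphere (0 : Vec m) 1) :=
  (volume : Measure (Vec m)).toSphere

/-- `Z(u,v)` is the reproducing kernel of `𝓗_k`:
`f(v) = ∫_{S^{m-1}} conj(Z(u,v)) f(u) dS(u)` for `f ∈ 𝓗_k`. -/
def IsHarmonicKernel (k : ℕ) (Z : Vec m → Vec m → ℂ) : Prop :=
  (∀ v, IsHarmonicPoly k (fun u => Z u v)) ∧
  ∀ f : Vec m → ℂ, IsHarmonicPoly k f → ∀ v,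
    f v = ∫ u : Metric.sphere (0 : Vec m) 1,
      (starRingEnd ℂ) (Z (u : Vec m) v) * f (u : Vec m) ∂(sphereMeasure m)

/-- The Clifford-valued `Z(u,v)`, acting on `W` from the left, is the reproducing kernel of
`𝓜_k`: `f(v) = ∫_{S^{m-1}} conj(Z(u,v)) f(u) dS(u)` for `f ∈ 𝓜_k`. -/
def IsMonogenicKernel (ρ : Cl m →ₐ[ℝ] Module.End ℂ W) (k : ℕ)
    (Z : Vec m → Vec m → Cl m) : Prop :=
  (∀ v w, IsMonogenicPoly ρ k (fun u => ρ (Z u v) w)) ∧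
  ∀ f : Vec m → W, IsMonogenicPoly ρ k f → ∀ v,
    f v = ∫ u : Metric.sphere (0 : Vec m) 1,
      ρ (conj (Z (u : Vec m) v)) (f (u : Vec m)) ∂(sphereMeasure m)

/-! ### Differential operators and fundamental solutions -/

/-- A linear differential operator in `x ∈ ℝ^m` with constant coefficients, acting on functions
`f(x,u)` with values in a space of `W`-valued functions of `u`:
`∑_{n ≤ order} ∑_{i₁,…,iₙ} A_{i₁…iₙ} ∂_{x_{i₁}} ⋯ ∂_{x_{iₙ}}`, where the `A_{i₁…iₙ}` act in the
variable `u`. -/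
structure DiffOp (m : ℕ) (W : Type*) [NormedAddCommGroup W] [NormedSpace ℂ W] where
  order : ℕ
  coeff : (n : ℕ) → (Fin n → Fin m) → ((Vec m → W) →ₗ[ℂ] (Vec m → W))

namespace DiffOp

/-- The coefficients restrict to endomorphisms of the space of all functions of `u` with
property `V`; thus the operator acts on smooth functions of `x` with values in that space
(and only these restrictions matter there). -/
def ActsOn (D : DiffOp m W) (V : (Vec m → W) → Prop) : Prop :=
  ∀ n I g, V g → V (D.coeff n I g)

/-- `(D f)(x,u)`. -/
def app (D : DiffOp m W) (f : Vec m → Vec m → W) (x u : Vec m) : W :=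
  ∑ n ∈ Finset.range (D.order + 1), ∑ I : Fin n → Fin m,
    D.coeff n I
      (fun u' => iteratedFDeriv ℝ n (fun x' => f x' u') x (fun i => stdVec (I i))) u

/-- `D F = δ(x) H(u)` in the sense of distributions in `x`, for a locally integrable `F(x,u)`. -/
def EqDelta (D : DiffOp m W) (F : Vec m → Vec m → W) (H : Vec m → W) : Prop :=
  ∀ ψ : Vec m → ℂ, ContDiff ℝ ∞ ψ → HasCompactSupport ψ → ∀ u : Vec m,
    ∫ x : Vec m, (∑ n ∈ Finset.range (D.order + 1), ∑ I : Fin n → Fin m,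
      ((-1 : ℂ) ^ n * iteratedFDeriv ℝ n ψ x (fun i => stdVec (I i))) •
        D.coeff n I (F x) u) = ψ 0 • H u

end DiffOp

/-- `E_{2j}(x,u,v) = ‖x‖^{2j-m} Z(x u x / ‖x‖², v)`. -/
def kernelEven (j : ℕ) (Z : Vec m → Vec m → ℂ) (x u v : Vec m) : ℂ :=
  ((‖x‖ ^ (2 * (j : ℤ) - (m : ℤ)) : ℝ) : ℂ) * Z (rot (vec x) u) v

/-- `E_{2j-1}(x,u,v) = x ‖x‖^{-(m-2j+2)} Z(x u x / ‖x‖², v)`. -/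
def kernelOdd (j : ℕ) (Z : Vec m → Vec m → Cl m) (x u v : Vec m) : Cl m :=
  (‖x‖ ^ ((m : ℤ) - 2 * (j : ℤ) + 2))⁻¹ • (vec x * Z (rot (vec x) u) v)

/-- `D` is a differential operator on `C^∞(ℝ^m, 𝓗_k)` whose fundamental solution is a nonzero
multiple `κ E_{2j}` of `E_{2j}`, that is, `D (κ E_{2j}(x,u,v)) = δ(x) Z(u,v)`, where `Z` is the
reproducing kernel of `𝓗_k`. -/
def IsBosonicOp (k j : ℕ) (D : DiffOp m ℂ) : Prop :=
  D.ActsOn (IsHarmonicPoly k) ∧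
  ∃ Z : Vec m → Vec m → ℂ, IsHarmonicKernel k Z ∧ ∃ κ : ℂ, κ ≠ 0 ∧
    ∀ v, D.EqDelta (fun x u => κ * kernelEven j Z x u v) (fun u => Z u v)

/-- `D` is a differential operator on `C^∞(ℝ^m, 𝓜_k)` whose fundamental solution is a nonzero
multiple `κ E_{2j-1}` of `E_{2j-1}`, that is, `D (κ E_{2j-1}(x,u,v)) = δ(x) Z(u,v)`, where `Z` is
the reproducing kernel of `𝓜_k`; both sides are applied to arbitrary `w ∈ W`. -/
def IsFermionicOp (ρ : Cl m →ₐ[ℝ] Module.End ℂ W) (k j : ℕ) (D : DiffOp m W) : Prop :=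
  D.ActsOn (IsMonogenicPoly ρ k) ∧
  ∃ Z : Vec m → Vec m → Cl m, IsMonogenicKernel ρ k Z ∧ ∃ κ : ℂ, κ ≠ 0 ∧
    ∀ v w, D.EqDelta (fun x u => κ • ρ (kernelOdd j Z x u v) w) (fun u => ρ (Z u v) w)

/-- `f ∈ C^∞(ℝ^m, V)`, for a finite-dimensional space `V` of polynomials in `u`. -/
def IsSmoothInto (V : (Vec m → W) → Prop) (f : Vec m → Vec m → W) : Prop :=
  ContDiff ℝ ∞ (fun p : Vec m × Vec m => f p.1 p.2) ∧ ∀ x, V (f x)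

end Spaces

end HigherSpin

end

/-! The operator inherits its covariance from its fundamental solution. Write s_x = cx + d, and let
A(s) be the action of a product of vectors s on V: substitution of `rot s u` for u, followed in the
odd case by multiplication by s̃. Then A(st) = A(t)A(s), and both kernels have the form E(x) =
κ‖x‖^w A(x). The Clifford identity (φ(x) − φ(z)) s_x = ±‖s_z‖⁻² s_z (x − z)
(`IsVahlen.vec_mobius_sub_mul`) and |det φ'(z)| = ‖s_z‖^(−2m) yield |det φ'(z)| G(x) E(φ(x) − φ(z))
= E(x − z) H(z), where G and H are the weights J_t and J_{−t} combined with the substitution in u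
(`IsVahlen.isIntertwiner`). A change of variables gives G · (E * ψ)∘φ = E * (H · ψ∘φ) for test
functions ψ supported near φ(y) (`IsIntertwiner.sum_conv`). Since D E = δ, the two sides of the
claim agree for f = E * ψ.

To reach arbitrary f, take a basis of V and let P be the symbol matrix of D. The difference of the
two sides at y depends on a finite jet of f at φ(y), so it is p(∂)f there for a row p of polynomials
(`exists_symbol`), and p(∂) kills every E * ψ at that point. The relation P E = δ forces det P ≠ 0,
and E * (det P(∂)ψ) = adj P(∂)ψ. Hence p · adj P kills all test functions, so it vanishes; then p ·
det P = 0 and p = 0 (`IsFundamental.eq_zero_of_row`, `IsFundamental.covariance`). Only the one-sided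
equation D E = δ and local integrability of E enter.

The reproducing property serves to show that the functions Z(·, v) span V
(`span_range_eq_of_separating`). This turns the delta equation for kernels into the matrix equation
P E = δ (`Frame.isFundamental`). -/

noncomputable section

namespace HigherSpin

variable {m : ℕ}

/-! ### Elementary identities in the Clifford algebra. -/

section Clifford

theorem negSq_apply (x : Vec m) : negSq m x = -‖x‖ ^ 2 := by
  simp [negSq]

theorem vec_mul_self (x : Vec m) : vec x * vec x = algebraMap ℝ (Cl m) (-‖x‖ ^ 2) := by
  rw [vec, CliffordAlgebra.ι_sq_scalar, negSq_apply]

theorem vec_add (x y : Vec m) : vec (x + y) = vec x + vec y := map_add _ _ _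

theorem vec_sub (x y : Vec m) : vec (x - y) = vec x - vec y := map_sub _ _ _

theorem vec_smul (r : ℝ) (x : Vec m) : vec (r • x) = r • vec x := map_smul _ _ _

@[simp] theorem vec_zero : vec (0 : Vec m) = 0 := map_zero _

theorem vec_mul_vec_add (x y : Vec m) :
    vec x * vec y + vec y * vec x = algebraMap ℝ (Cl m) (-2 * inner ℝ x y) := by
  rw [vec, vec, CliffordAlgebra.ι_mul_ι_add_swap]
  congr 1
  simp only [QuadraticMap.polar, negSq_apply, norm_add_sq_real]
  ring

@[simp] theorem rev_mul (a b : Cl m) : rev (a * b) = rev b * rev a := CliffordAlgebra.reverse.map_mul a b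

@[simp] theorem rev_rev (a : Cl m) : rev (rev a) = a := CliffordAlgebra.reverse_reverse a

@[simp] theorem rev_vec (x : Vec m) : rev (vec x) = vec x := CliffordAlgebra.reverse_ι x

@[simp] theorem rev_one : rev (1 : Cl m) = 1 := CliffordAlgebra.reverse.map_one

@[simp] theorem rev_zero : rev (0 : Cl m) = 0 := map_zero _

theorem rev_add (a b : Cl m) : rev (a + b) = rev a + rev b := map_add _ _ _

theorem rev_sub (a b : Cl m) : rev (a - b) = rev a - rev b := map_sub _ _ _

theorem rev_smul (r : ℝ) (a : Cl m) : rev (r • a) = r • rev a := map_smul _ _ _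

@[simp] theorem rev_algebraMap (r : ℝ) : rev (algebraMap ℝ (Cl m) r) = algebraMap ℝ (Cl m) r :=
  CliffordAlgebra.reverse.commutes r

@[simp] theorem conj_mul (a b : Cl m) : conj (a * b) = conj b * conj a := by
  simp [conj]

@[simp] theorem conj_vec (x : Vec m) : conj (vec x) = -vec x := by
  simp [conj, vec]

@[simp] theorem conj_one : conj (1 : Cl m) = 1 := by
  simp [conj]

theorem conj_add (a b : Cl m) : conj (a + b) = conj a + conj b := by
  simp [conj]

@[simp] theorem conj_algebraMap (r : ℝ) : conj (algebraMap ℝ (Cl m) r) = algebraMap ℝ (Cl m) r := by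
  simp [conj]

@[simp] theorem scalarPart_algebraMap (r : ℝ) : scalarPart (algebraMap ℝ (Cl m) r) = r := by
  rw [scalarPart]
  have : CliffordAlgebra.equivExterior (negSq m) (algebraMap ℝ (Cl m) r) = algebraMap ℝ _ r :=
    CliffordAlgebra.changeForm_algebraMap CliffordAlgebra.changeForm.associated_neg_proof r
  rw [this]
  exact ExteriorAlgebra.algebraMap_leftInverse _ r

@[simp] theorem vecPart_vec (x : Vec m) : vecPart (vec x) = x := by
  rw [vecPart]
  have : CliffordAlgebra.equivExterior (negSq m) (vec x) = ExteriorAlgebra.ι ℝ x :=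
    CliffordAlgebra.changeForm_ι CliffordAlgebra.changeForm.associated_neg_proof x
  rw [this]
  exact ExteriorAlgebra.ι_leftInverse x

theorem vec_injective : Function.Injective (vec : Vec m → Cl m) :=
  Function.LeftInverse.injective vecPart_vec

theorem vecPart_smul (r : ℝ) (a : Cl m) : vecPart (r • a) = r • vecPart a := by
  simp [vecPart]

theorem vec_eq_zero {x : Vec m} : vec x = 0 ↔ x = 0 :=
  ⟨fun h => vec_injective (by rw [h, vec_zero]), fun h => by rw [h, vec_zero]⟩

end Clifford

/-! ### Products of vectors: norm, sign and the rotations they induce. -/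

section VecProd

theorem isVecProd_vec (x : Vec m) : IsVecProd (vec x) := ⟨[x], by simp⟩

theorem isVecProd_one : IsVecProd (1 : Cl m) := ⟨[], by simp⟩

theorem IsVecProd.mul {s t : Cl m} (hs : IsVecProd s) (ht : IsVecProd t) : IsVecProd (s * t) := by
  obtain ⟨l, rfl⟩ := hs
  obtain ⟨l', rfl⟩ := ht
  exact ⟨l ++ l', by simp⟩

theorem IsVecProd.induction {C : ∀ s : Cl m, IsVecProd s → Prop} (one : C 1 isVecProd_one)
    (mul : ∀ (x : Vec m) (s : Cl m) (hs : IsVecProd s), C s hs →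
      C (vec x * s) ((isVecProd_vec x).mul hs)) {s : Cl m}
    (hs : IsVecProd s) : C s hs := by
  obtain ⟨l, rfl⟩ := hs
  induction l with
  | nil => simpa using one
  | cons x l ih => simpa using mul x _ ⟨l, rfl⟩ ih

theorem IsVecProd.rev {s : Cl m} (hs : IsVecProd s) : IsVecProd (rev s) := by
  induction hs using IsVecProd.induction with
  | one => simpa using isVecProd_one
  | mul x s _ ih => simpa using ih.mul (isVecProd_vec x)

/-- Vectors square to scalars, so adjacent equal factors cancel from the inside out: `r` is the
product of the squared norms and `σ` is −1 to the number of factors. The clause on `r = 0` is the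
definiteness that makes nonzero products invertible. -/
theorem IsVecProd.exists_sq {s : Cl m} (hs : IsVecProd s) : ∃ r : ℝ, 0 ≤ r ∧ (r = 0 → s = 0) ∧
    conj s * s = algebraMap ℝ (Cl m) r ∧ ∃ σ : ℝ, (σ = 1 ∨ σ = -1) ∧
      s * HigherSpin.rev s = algebraMap ℝ (Cl m) (σ * r) ∧
      HigherSpin.rev s * s = algebraMap ℝ (Cl m) (σ * r) := by
  induction hs using IsVecProd.induction with
  | one => exact ⟨1, by simp, by simp, by simp, 1, by simp⟩
  | mul x s _ ih =>
    obtain ⟨r, h0, hr, hc, σ, hσ, h1, h2⟩ := ih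
    refine ⟨‖x‖ ^ 2 * r, by positivity, ?_, ?_, -σ, ?_, ?_, ?_⟩
    · intro h
      rcases mul_eq_zero.1 h with h | h
      · simp [norm_eq_zero.1 (pow_eq_zero_iff (two_ne_zero) |>.1 h)]
      · simp [hr h]
    · calc conj (vec x * s) * (vec x * s) = -(conj s * (vec x * vec x) * s) := by
            simp [mul_assoc]
        _ = algebraMap ℝ (Cl m) (‖x‖ ^ 2 * r) := by
            rw [vec_mul_self, ← Algebra.commutes, mul_assoc, hc, ← map_mul, ← map_neg]
            ring_nf
    · rcases hσ with h | h <;> simp [h]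
    · calc vec x * s * HigherSpin.rev (vec x * s)
          = vec x * (s * HigherSpin.rev s) * vec x := by simp [mul_assoc]
        _ = _ := by
            rw [h1, ← Algebra.commutes, mul_assoc, vec_mul_self, ← map_mul]
            ring_nf
    · calc HigherSpin.rev (vec x * s) * (vec x * s)
          = HigherSpin.rev s * (vec x * vec x) * s := by simp [mul_assoc]
        _ = _ := by
            rw [vec_mul_self, ← Algebra.commutes, mul_assoc, h2, ← map_mul]
            ring_nf

theorem clNorm_nonneg (s : Cl m) : 0 ≤ clNorm s := Real.sqrt_nonneg _

theorem clNorm_eq {s : Cl m} {r : ℝ} (hr : 0 ≤ r) (h : conj s * s = algebraMap ℝ (Cl m) (r ^ 2)) :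
    clNorm s = r := by
  rw [clNorm, h, scalarPart_algebraMap, Real.sqrt_sq hr]

theorem IsVecProd.conj_mul_self {s : Cl m} (hs : IsVecProd s) :
    HigherSpin.conj s * s = algebraMap ℝ (Cl m) (clNorm s ^ 2) := by
  obtain ⟨r, h0, -, hc, -⟩ := hs.exists_sq
  rw [clNorm, hc, scalarPart_algebraMap, Real.sq_sqrt h0]

theorem IsVecProd.exists_sign {s : Cl m} (hs : IsVecProd s) : ∃ σ : ℝ, (σ = 1 ∨ σ = -1) ∧
      s * HigherSpin.rev s = algebraMap ℝ (Cl m) (σ * clNorm s ^ 2) ∧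
      HigherSpin.rev s * s = algebraMap ℝ (Cl m) (σ * clNorm s ^ 2) := by
  obtain ⟨r, h0, -, hc, σ, h⟩ := hs.exists_sq
  refine ⟨σ, ?_⟩
  rwa [clNorm, hc, scalarPart_algebraMap, Real.sq_sqrt h0]

theorem IsVecProd.clNorm_pos {s : Cl m} (hs : IsVecProd s) (h : s ≠ 0) : 0 < clNorm s := by
  obtain ⟨r, h0, hr, hc, -⟩ := hs.exists_sq
  rw [clNorm, hc, scalarPart_algebraMap, Real.sqrt_pos]
  exact lt_of_le_of_ne h0 fun h' => h (hr h'.symm)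

@[simp] theorem clNorm_zero : clNorm (0 : Cl m) = 0 :=
  clNorm_eq le_rfl (by simp)

@[simp] theorem clNorm_vec (x : Vec m) : clNorm (vec x) = ‖x‖ :=
  clNorm_eq (norm_nonneg _) (by rw [conj_vec, neg_mul, vec_mul_self, ← map_neg, neg_neg])

theorem IsVecProd.clNorm_mul {s t : Cl m} (hs : IsVecProd s) (ht : IsVecProd t) :
    clNorm (s * t) = clNorm s * clNorm t := by
  refine clNorm_eq (mul_nonneg (clNorm_nonneg _) (clNorm_nonneg _)) ?_
  calc HigherSpin.conj (s * t) * (s * t) = HigherSpin.conj t * (HigherSpin.conj s * s) * t := by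
        simp [mul_assoc]
    _ = _ := by
      rw [hs.conj_mul_self, ← Algebra.commutes, mul_assoc, ht.conj_mul_self, ← map_mul, mul_pow]

theorem IsVecProd.isUnit {s : Cl m} (hs : IsVecProd s) (h : s ≠ 0) : IsUnit s := by
  obtain ⟨σ, hσ, h1, h2⟩ := hs.exists_sign
  have hn := (hs.clNorm_pos h).ne'
  have hσ0 : σ ≠ 0 := by rcases hσ with rfl | rfl <;> norm_num
  have hne : σ * clNorm s ^ 2 ≠ 0 := mul_ne_zero hσ0 (pow_ne_zero _ hn)
  refine ⟨⟨s, (σ * clNorm s ^ 2)⁻¹ • HigherSpin.rev s, ?_, ?_⟩, rfl⟩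
  · rw [mul_smul_comm, h1, Algebra.algebraMap_eq_smul_one, smul_smul, inv_mul_cancel₀ hne, one_smul]
  · rw [smul_mul_assoc, h2, Algebra.algebraMap_eq_smul_one, smul_smul, inv_mul_cancel₀ hne, one_smul]

theorem IsVecProd.mul_ne_zero {s t : Cl m} (hs : IsVecProd s) (ht : IsVecProd t) (hs0 : s ≠ 0)
    (ht0 : t ≠ 0) : s * t ≠ 0 := by
  intro h
  have := hs.clNorm_mul ht
  rw [h, clNorm_zero] at this
  exact (mul_pos (hs.clNorm_pos hs0) (ht.clNorm_pos ht0)).ne this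

theorem vec_mul_vec_mul_vec (x u : Vec m) : vec x * vec u * vec x =
    vec (‖x‖ ^ 2 • u - (2 * inner ℝ x u) • x) := by
  have h := vec_mul_vec_add x u
  have : vec x * vec u = algebraMap ℝ (Cl m) (-2 * inner ℝ x u) - vec u * vec x :=
    eq_sub_of_add_eq h
  rw [this, sub_mul, mul_assoc, vec_mul_self, ← Algebra.commutes (-‖x‖ ^ 2), vec_sub, vec_smul,
    vec_smul, ← Algebra.smul_def, ← Algebra.smul_def, neg_smul, sub_neg_eq_add, neg_mul, neg_smul]
  abel

theorem rot_vec (x u : Vec m) : rot (vec x) u =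
    (‖x‖ ^ 2)⁻¹ • (‖x‖ ^ 2 • u - (2 * inner ℝ x u) • x) := by
  rw [rot, rev_vec, vec_mul_vec_mul_vec, vecPart_vec, clNorm_vec]

/-- Up to the factor ‖x‖², the map u ↦ x u x is the reflection in the hyperplane orthogonal to x; a
product of vectors gives a composition of such reflections. -/
theorem IsVecProd.exists_isometry {s : Cl m} (hs : IsVecProd s) (h : s ≠ 0) :
    ∃ L : Vec m ≃ₗᵢ[ℝ] Vec m, ∀ u,
      s * vec u * HigherSpin.rev s = clNorm s ^ 2 • vec (L u) := by
  induction hs using IsVecProd.induction with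
  | one =>
    have : clNorm (1 : Cl m) = 1 := clNorm_eq zero_le_one (by simp)
    exact ⟨LinearIsometryEquiv.refl ℝ _, fun u => by simp [this]⟩
  | mul x s hs ih =>
    have hs0 : s ≠ 0 := right_ne_zero_of_mul h
    have hx0 : x ≠ 0 := fun h' => h (by simp [h'])
    obtain ⟨L, hL⟩ := ih hs0
    refine ⟨L.trans (Submodule.reflection (ℝ ∙ x)ᗮ), fun u => ?_⟩
    have hx : ‖x‖ ^ 2 ≠ 0 := by simpa using hx0
    calc vec x * s * vec u * HigherSpin.rev (vec x * s)
        = vec x * (s * vec u * HigherSpin.rev s) * vec x := by simp [mul_assoc]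
      _ = clNorm s ^ 2 • (vec x * vec (L u) * vec x) := by
        rw [hL, mul_smul_comm, smul_mul_assoc]
      _ = _ := by
        rw [vec_mul_vec_mul_vec, (isVecProd_vec x).clNorm_mul hs, clNorm_vec, mul_pow,
          mul_comm (‖x‖ ^ 2), mul_smul (clNorm s ^ 2), ← vec_smul (‖x‖ ^ 2)]
        congr 2
        rw [LinearIsometryEquiv.trans_apply, Submodule.reflection_orthogonal_apply,
          Submodule.reflection_singleton_apply, neg_sub, smul_sub]
        congr 1
        rw [two_smul, ← two_smul ℝ, smul_smul, smul_smul]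
        congr 1
        simp
        field_simp

theorem IsVecProd.exists_rot_eq {s : Cl m} (hs : IsVecProd s) (h : s ≠ 0) :
    ∃ L : Vec m ≃ₗᵢ[ℝ] Vec m, (∀ u, rot s u = L u) ∧
      ∀ u, s * vec u * HigherSpin.rev s = clNorm s ^ 2 • vec (L u) := by
  obtain ⟨L, hL⟩ := hs.exists_isometry h
  refine ⟨L, fun u => ?_, hL⟩
  have := (hs.clNorm_pos h).ne'
  rw [rot, hL, vecPart_smul, vecPart_vec, smul_smul, inv_mul_cancel₀ (pow_ne_zero _ this), one_smul]

theorem IsVecProd.sandwich {s : Cl m} (hs : IsVecProd s) (h : s ≠ 0) (u : Vec m) :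
    s * vec u * HigherSpin.rev s = clNorm s ^ 2 • vec (rot s u) := by
  obtain ⟨L, h1, h2⟩ := hs.exists_rot_eq h
  rw [h1, h2]

theorem rot_mul {s t : Cl m} (hs : IsVecProd s) (ht : IsVecProd t) (hs0 : s ≠ 0) (ht0 : t ≠ 0)
    (u : Vec m) : rot (s * t) u = rot s (rot t u) := by
  have h0 := hs.mul_ne_zero ht hs0 ht0
  have h1 := (hs.mul ht).sandwich h0 u
  have h2 : s * t * vec u * rev (s * t) = clNorm (s * t) ^ 2 • vec (rot s (rot t u)) := by
    calc s * t * vec u * rev (s * t) = s * (t * vec u * rev t) * rev s := by simp [mul_assoc]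
      _ = _ := by
        rw [ht.sandwich ht0, mul_smul_comm, smul_mul_assoc, hs.sandwich hs0, hs.clNorm_mul ht,
          smul_smul, mul_pow, mul_comm]
  have h3 := h1.symm.trans h2
  have := pow_ne_zero 2 ((hs.mul ht).clNorm_pos h0).ne'
  rw [smul_right_inj this] at h3
  exact vec_injective h3

theorem clNorm_smul (r : ℝ) {s : Cl m} (hs : IsVecProd s) : clNorm (r • s) = |r| * clNorm s := by
  refine clNorm_eq (mul_nonneg (abs_nonneg _) (clNorm_nonneg _)) ?_
  have : conj (r • s) = r • conj s := by simp [conj]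
  rw [this, smul_mul_assoc, mul_smul_comm, hs.conj_mul_self, smul_smul, mul_pow, sq_abs, ← sq,
    Algebra.smul_def, ← map_mul]

theorem rot_smul {r : ℝ} (hr : r ≠ 0) {s : Cl m} (hs : IsVecProd s) (u : Vec m) :
    rot (r • s) u = rot s u := by
  rw [rot, rot, clNorm_smul r hs, rev_smul, smul_mul_assoc, smul_mul_assoc, mul_smul_comm,
    smul_smul, vecPart_smul, smul_smul, mul_pow, sq_abs, mul_inv, ← sq]
  congr 1
  field_simp

end VecProd

end HigherSpin

namespace HigherSpin

variable {m : ℕ}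

/-! ### Inverses of products of vectors. -/

section Inverse

variable {s : Cl m}

theorem IsVecProd.exists_inverse_eq (hs : IsVecProd s) (h : s ≠ 0) :
    ∃ r : ℝ, r ≠ 0 ∧ Ring.inverse s = r • HigherSpin.rev s ∧ r ^ 2 = (clNorm s ^ 4)⁻¹ := by
  obtain ⟨σ, hσ, h1, h2⟩ := hs.exists_sign
  have hn := (hs.clNorm_pos h).ne'
  have hσ0 : σ ≠ 0 := by rcases hσ with rfl | rfl <;> norm_num
  have hσ2 : σ ^ 2 = 1 := by rcases hσ with rfl | rfl <;> norm_num
  have hne : σ * clNorm s ^ 2 ≠ 0 := _root_.mul_ne_zero hσ0 (pow_ne_zero _ hn)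
  refine ⟨(σ * clNorm s ^ 2)⁻¹, inv_ne_zero hne, ?_, ?_⟩
  · have hu := Ring.inverse_mul_cancel s (hs.isUnit h)
    calc Ring.inverse s
        = Ring.inverse s * ((σ * clNorm s ^ 2)⁻¹ • (s * HigherSpin.rev s)) := by
          rw [h1, Algebra.algebraMap_eq_smul_one, smul_smul, inv_mul_cancel₀ hne, one_smul, mul_one]
      _ = _ := by rw [mul_smul_comm, ← mul_assoc, hu, one_mul]
  · rw [inv_pow, mul_pow, hσ2, one_mul, ← pow_mul]

theorem IsVecProd.clNorm_rev (hs : IsVecProd s) : clNorm (HigherSpin.rev s) = clNorm s := by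
  by_cases h : s = 0
  · simp [h]
  obtain ⟨σ, hσ, h1, h2⟩ := hs.exists_sign
  have hn := (hs.clNorm_pos h)
  have h3 := hs.clNorm_mul hs.rev
  rw [h1] at h3
  have h4 : clNorm (algebraMap ℝ (Cl m) (σ * clNorm s ^ 2)) = clNorm s ^ 2 := by
    refine clNorm_eq (by positivity) ?_
    rw [conj_algebraMap, ← map_mul]
    rcases hσ with rfl | rfl <;> ring_nf
  rw [h4, sq] at h3
  exact (mul_left_cancel₀ hn.ne' h3).symm

theorem IsVecProd.rev_ne_zero (h : s ≠ 0) : HigherSpin.rev s ≠ 0 := fun h' => h (by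
  rw [← rev_rev s, h', rev_zero])

/-- Conjugating a vector by the inverse of a product of vectors. -/
theorem IsVecProd.isVec_inverse_sandwich (hs : IsVecProd s) (h : s ≠ 0) {w : Cl m} (hw : IsVec w) :
    IsVec (Ring.inverse s * w * HigherSpin.rev (Ring.inverse s)) := by
  obtain ⟨r, -, h1, -⟩ := hs.exists_inverse_eq h
  obtain ⟨x, rfl⟩ := hw
  have := hs.rev.sandwich (IsVecProd.rev_ne_zero h) x
  rw [rev_rev] at this
  refine ⟨r • r • clNorm (HigherSpin.rev s) ^ 2 • rot (HigherSpin.rev s) x, ?_⟩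
  rw [h1, rev_smul, rev_rev, smul_mul_assoc, smul_mul_assoc, mul_smul_comm, this, vec_smul,
    vec_smul, vec_smul]

end Inverse

/-! ### Algebra of Möbius transformations. -/

section Mobius

variable {a b c d : Cl m}

theorem IsVec.rev_eq {w : Cl m} (h : IsVec w) : HigherSpin.rev w = w := by
  obtain ⟨x, rfl⟩ := h
  exact rev_vec x

namespace IsVahlen

theorem exists_det (hV : IsVahlen a b c d) : ∃ δ : ℝ, (δ = 1 ∨ δ = -1) ∧
    a * rev d - b * rev c = algebraMap ℝ (Cl m) δ := by
  rcases hV.det with h | h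
  · exact ⟨1, Or.inl rfl, by simpa using h⟩
  · exact ⟨-1, Or.inr rfl, by simpa using h⟩

/-- Symmetry of c d̃ and c̃ a under reversion gives c (d̃ a − b̃ c) = (d ã − c b̃) c = δ c, and an
invertible c cancels. If c = 0, then a is invertible and is cancelled instead. -/
theorem det' (hV : IsVahlen a b c d) {δ : ℝ} (hδ : δ ≠ 0)
    (h : a * rev d - b * rev c = algebraMap ℝ (Cl m) δ) :
    rev d * a - rev b * c = algebraMap ℝ (Cl m) δ := by
  have e1 : b * rev a = a * rev b := by simpa using hV.vec_ab.rev_eq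
  have e2 : d * rev c = c * rev d := by simpa using hV.vec_cd.rev_eq
  have e3 : rev a * c = rev c * a := by simpa using hV.vec_ca.rev_eq
  have e4 : rev b * d = rev d * b := by simpa using hV.vec_db.rev_eq
  have h' : d * rev a - c * rev b = algebraMap ℝ (Cl m) δ := by
    simpa [rev_sub] using congrArg rev h
  by_cases hc : c = 0
  · subst hc
    have ha : a ≠ 0 := by
      rintro rfl
      have : algebraMap ℝ (Cl m) δ = 0 := by simpa using h.symm
      exact hδ ((map_eq_zero_iff _ (algebraMap ℝ (Cl m)).injective).1 this)
    refine (hV.prod_a.isUnit ha).mul_left_cancel ?_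
    simp only [rev_zero, mul_zero, sub_zero] at h ⊢
    rw [← mul_assoc, h, Algebra.commutes]
  · refine (hV.prod_c.isUnit hc).mul_left_cancel ?_
    calc c * (rev d * a - rev b * c) = c * rev d * a - c * rev b * c := by
          rw [mul_sub, mul_assoc, mul_assoc]
      _ = (d * rev a - c * rev b) * c := by
          rw [← e2, sub_mul, mul_assoc d, mul_assoc d, e3]
      _ = _ := by rw [h', Algebra.commutes]

/-- The two normal forms of a Möbius transformation. -/
theorem normal_form (hV : IsVahlen a b c d) {δ : ℝ} (hδ : δ = 1 ∨ δ = -1)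
    (h : a * rev d - b * rev c = algebraMap ℝ (Cl m) δ) :
    (c = 0 ∧ d ≠ 0 ∧ ∃ (r : ℝ) (L : Vec m ≃ₗᵢ[ℝ] Vec m) (p : Vec m), ∀ y,
      (a * vec y + b) * Ring.inverse (c * vec y + d) = vec (r • L y + p)) ∨
    (c ≠ 0 ∧ ∃ (q : Vec m), d = c * vec q ∧ ∃ (r : ℝ) (L : Vec m ≃ₗᵢ[ℝ] Vec m) (p : Vec m), ∀ y,
      y + q ≠ 0 → (a * vec y + b) * Ring.inverse (c * vec y + d) =
        vec (r • (‖y + q‖ ^ 2)⁻¹ • L (y + q) + p)) := by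
  have hδ0 : δ ≠ 0 := by rcases hδ with rfl | rfl <;> norm_num
  have hA : algebraMap ℝ (Cl m) δ ≠ 0 := fun h0 =>
    hδ0 ((map_eq_zero_iff _ (algebraMap ℝ (Cl m)).injective).1 h0)
  have hdet := hV.det' hδ0 h
  have e2 : d * rev c = c * rev d := by simpa using hV.vec_cd.rev_eq
  have e3 : rev a * c = rev c * a := by simpa using hV.vec_ca.rev_eq
  by_cases hc : c = 0
  · left
    subst hc
    simp only [rev_zero, mul_zero, sub_zero] at h hdet
    have hd : d ≠ 0 := by
      rintro rfl
      exact hA (by simpa using h.symm)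
    refine ⟨rfl, hd, ?_⟩
    obtain ⟨L, -, hL⟩ := hV.prod_d.exists_rot_eq hd
    obtain ⟨r, hr, hinv, -⟩ := hV.prod_d.exists_inverse_eq hd
    have hu1 := Ring.inverse_mul_cancel d (hV.prod_d.isUnit hd)
    have hu2 := Ring.mul_inverse_cancel d (hV.prod_d.isUnit hd)
    have hr1 : rev (Ring.inverse d) * rev d = 1 := by rw [← rev_mul, hu2, rev_one]
    -- With c = 0 the determinant relation reads d̃ a = δ, so φ(y) = δ d̃⁻¹ y d⁻¹ + b d⁻¹; as d⁻¹ is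
    -- a real multiple of d̃, this is a similarity.
    have ha : a = δ • rev (Ring.inverse d) := by
      calc a = (rev (Ring.inverse d) * rev d) * a := by rw [hr1, one_mul]
        _ = _ := by rw [mul_assoc, hdet, ← Algebra.commutes, Algebra.smul_def]
    have hb : IsVec (b * Ring.inverse d) := by
      have hrd : rev d * rev (Ring.inverse d) = 1 := by rw [← rev_mul, hu1, rev_one]
      have hi : Ring.inverse (rev d) = rev (Ring.inverse d) := 
        left_inv_eq_right_inv (Ring.inverse_mul_cancel _
          (hV.prod_d.rev.isUnit (IsVecProd.rev_ne_zero hd))) hrd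
      have := hV.prod_d.rev.isVec_inverse_sandwich (IsVecProd.rev_ne_zero hd) hV.vec_db
      rwa [hi, rev_rev, ← mul_assoc, hr1, one_mul] at this
    obtain ⟨p, hp⟩ := hb
    refine ⟨δ * r * r * clNorm d ^ 2, L, p, fun y => ?_⟩
    rw [zero_mul, zero_add, add_mul, hp, vec_add, ha, hinv, rev_smul, rev_rev, vec_smul]
    congr 1
    rw [smul_mul_assoc, smul_mul_assoc, smul_mul_assoc, smul_mul_assoc, mul_smul_comm, hL,
      smul_smul, smul_smul, smul_smul]
  · right
    refine ⟨hc, ?_⟩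
    have hu1 := Ring.inverse_mul_cancel c (hV.prod_c.isUnit hc)
    have hu2 := Ring.mul_inverse_cancel c (hV.prod_c.isUnit hc)
    have hr1 : rev (Ring.inverse c) * rev c = 1 := by rw [← rev_mul, hu2, rev_one]
    have hr2 : rev c * rev (Ring.inverse c) = 1 := by rw [← rev_mul, hu1, rev_one]
    have hi : Ring.inverse (rev c) = rev (Ring.inverse c) := 
      left_inv_eq_right_inv (Ring.inverse_mul_cancel _
        (hV.prod_c.rev.isUnit (IsVecProd.rev_ne_zero hc))) hr2
    have hq : IsVec (Ring.inverse c * d) := by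
      have := hV.prod_c.isVec_inverse_sandwich hc hV.vec_cd
      rwa [← e2, ← mul_assoc, mul_assoc _ (rev c), hr2, mul_one] at this
    have hp : IsVec (a * Ring.inverse c) := by
      have := hV.prod_c.rev.isVec_inverse_sandwich (IsVecProd.rev_ne_zero hc) hV.vec_ca
      rwa [hi, rev_rev, ← mul_assoc, hr1, one_mul] at this
    obtain ⟨q, hq⟩ := hq
    obtain ⟨p, hp⟩ := hp
    obtain ⟨L, -, hL⟩ := hV.prod_c.exists_rot_eq hc
    have hcn := (hV.prod_c.clNorm_pos hc).ne'
    have hd : d = c * vec q := by rw [← hq, ← mul_assoc, hu2, one_mul]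
    refine ⟨q, hd, δ * (clNorm c ^ 2)⁻¹, L, p, fun y hy => ?_⟩
    -- Here φ(y) = p + (b − a q)(c (y + q))⁻¹ with p = a c⁻¹. Since b − a q = −δ c̃⁻¹, the second
    -- term is a scaled, rotated inversion of y + q.
    set s := c * vec y + d with hs
    have hs' : s = c * vec (y + q) := by rw [hs, hd, vec_add, mul_add]
    have hy' : vec (y + q) ≠ 0 := fun h => hy (vec_eq_zero.1 h)
    have hsP : IsVecProd s := hs' ▸ hV.prod_c.mul (isVecProd_vec _)
    have hs0 : s ≠ 0 := hs' ▸ hV.prod_c.mul_ne_zero (isVecProd_vec _) hc hy'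
    have hsu := hsP.isUnit hs0
    have hyn : ‖y + q‖ ^ 2 ≠ 0 := by simpa using hy
    refine hsu.mul_right_cancel ?_
    rw [mul_assoc, Ring.inverse_mul_cancel _ hsu, mul_one, vec_add, add_mul, ← hp, mul_assoc a]
    have k1 : Ring.inverse c * s = vec y + vec q := by
      rw [hs', ← mul_assoc, hu1, one_mul, vec_add]
    have k2 : vec ((δ * (clNorm c ^ 2)⁻¹) • (‖y + q‖ ^ 2)⁻¹ • L (y + q)) * s
        = -(δ • rev (Ring.inverse c)) := by
      have : vec (L (y + q)) = (clNorm c ^ 2)⁻¹ • (c * vec (y + q) * rev c) := by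
        rw [hL, smul_smul, inv_mul_cancel₀ (pow_ne_zero _ hcn), one_smul]
      obtain ⟨σ, hσ, -, g2⟩ := hV.prod_c.exists_sign
      have hσ0 : σ ≠ 0 := by rcases hσ with rfl | rfl <;> norm_num
      have hσ2 : σ * σ = 1 := by rcases hσ with rfl | rfl <;> norm_num
      have k3 : c * vec (y + q) * rev c * s = (-(σ * clNorm c ^ 2 * ‖y + q‖ ^ 2)) • c := by
        calc c * vec (y + q) * rev c * s = c * (vec (y + q) * (rev c * c) * vec (y + q)) := by
              rw [hs']; simp only [mul_assoc]
          _ = _ := by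
            rw [g2, ← Algebra.commutes, mul_assoc, vec_mul_self, ← map_mul, ← Algebra.commutes,
              Algebra.smul_def]
            ring_nf
      have k4 : rev (Ring.inverse c) = (σ * (clNorm c ^ 2)⁻¹) • c := by
        calc rev (Ring.inverse c)
            = (σ * (clNorm c ^ 2)⁻¹) • (rev (Ring.inverse c) * (rev c * c)) := by
              rw [g2, Algebra.algebraMap_eq_smul_one, mul_smul_comm, smul_smul, mul_one]
              have : σ * (clNorm c ^ 2)⁻¹ * (σ * clNorm c ^ 2) = 1 := by
                field_simp; rw [sq]; exact hσ2
              rw [this, one_smul]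
          _ = _ := by rw [← mul_assoc, hr1, one_mul]
      rw [vec_smul, vec_smul, this, k4, smul_mul_assoc, smul_mul_assoc, smul_mul_assoc, k3,
        smul_smul, smul_smul, smul_smul, smul_smul, ← neg_smul]
      congr 1
      field_simp
    rw [k1, k2, mul_add]
    have k5 : b - a * vec q = -(δ • rev (Ring.inverse c)) := by
      calc b - a * vec q = rev (Ring.inverse c) * (rev c * (b - a * vec q)) := by
            rw [← mul_assoc, hr1, one_mul]
        _ = rev (Ring.inverse c) * (-rev (rev d * a - rev b * c)) := by
            congr 1
            rw [mul_sub, ← mul_assoc, ← e3, mul_assoc, ← hd, rev_sub]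
            simp
        _ = _ := by rw [hdet, rev_algebraMap, mul_neg, ← Algebra.commutes, Algebra.smul_def]
    rw [← k5]
    abel

/-- A sum of products of vectors need not be such a product; here either c = 0 or the sum factors as
c (y + q). -/
theorem isVecProd_denom (hV : IsVahlen a b c d) (y : Vec m) : IsVecProd (c * vec y + d) := by
  obtain ⟨δ, hδ, h⟩ := hV.exists_det
  rcases hV.normal_form hδ h with ⟨hc, -⟩ | ⟨-, q, hd, -⟩
  · simpa [hc] using hV.prod_d
  · rw [hd, ← mul_add, ← vec_add]
    exact hV.prod_c.mul (isVecProd_vec _)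

theorem vec_mobius_mul (hV : IsVahlen a b c d) {y : Vec m} (hy : c * vec y + d ≠ 0) :
    vec (mobius a b c d y) * (c * vec y + d) = a * vec y + b := by
  obtain ⟨δ, hδ, h⟩ := hV.exists_det
  have hu := (hV.isVecProd_denom y).isUnit hy
  have key : ∃ x, (a * vec y + b) * Ring.inverse (c * vec y + d) = vec x := by
    rcases hV.normal_form hδ h with ⟨-, -, r, L, p, hm⟩ | ⟨-, q, hd, r, L, p, hm⟩
    · exact ⟨_, hm y⟩
    · refine ⟨_, hm y fun h0 => hy ?_⟩
      rw [hd, ← mul_add, ← vec_add, h0, vec_zero, mul_zero]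
  obtain ⟨x, hx⟩ := key
  rw [mobius, hx, vecPart_vec, ← hx, mul_assoc, Ring.inverse_mul_cancel _ hu, mul_one]

/-- As φ(y) is a vector, reversing φ(y) s_y = a y + b gives s̃_y φ(y) = (a y + b)~. The left side
thus becomes polynomial in x and y, and the Vahlen relations cancel the term in both variables and
the constant term. -/
theorem rev_denom_mul_sub_mul (hV : IsVahlen a b c d) {δ : ℝ} (hδ : δ = 1 ∨ δ = -1)
    (h : a * rev d - b * rev c = algebraMap ℝ (Cl m) δ) {x y : Vec m}
    (hx : c * vec x + d ≠ 0) (hy : c * vec y + d ≠ 0) :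
    rev (c * vec y + d) * vec (mobius a b c d x - mobius a b c d y) * (c * vec x + d) =
      δ • vec (x - y) := by
  have hδ0 : δ ≠ 0 := by rcases hδ with rfl | rfl <;> norm_num
  have hdet := hV.det' hδ0 h
  have hdet' : rev a * d - rev c * b = algebraMap ℝ (Cl m) δ := by
    simpa [rev_sub] using congrArg rev hdet
  have e3 : rev a * c = rev c * a := by simpa using hV.vec_ca.rev_eq
  have e4 : rev b * d = rev d * b := by simpa using hV.vec_db.rev_eq
  have k1 : rev (c * vec y + d) * vec (mobius a b c d y) = rev (a * vec y + b) := by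
    rw [← hV.vec_mobius_mul hy, rev_mul, rev_vec]
  rw [vec_sub, mul_sub, sub_mul, mul_assoc, hV.vec_mobius_mul hx, k1, rev_add, rev_add, rev_mul,
    rev_mul, rev_vec, vec_sub, smul_sub, Algebra.smul_def, Algebra.smul_def,
    Algebra.commutes δ (vec y)]
  -- The scalar δ takes two shapes: d̃ a − b̃ c as the coefficient to the left of x, and ã d − c̃ b
  -- as the coefficient to the right of y.
  rw [← hdet]
  nth_rw 2 [hdet]
  rw [← hdet']
  simp only [mul_add, add_mul, mul_sub, sub_mul, mul_assoc]
  rw [← mul_assoc (rev c) a, ← e3, mul_assoc, e4]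
  abel

/-- Multiplying `rev_denom_mul_sub_mul` by s_y removes s̃_y through s s̃ = σ‖s‖². Both sides are
then products of vectors up to a real scalar, as needed for applying a multiplicative action. -/
theorem vec_mobius_sub_mul (hV : IsVahlen a b c d) {δ σ : ℝ} (hδ : δ = 1 ∨ δ = -1)
    (h : a * rev d - b * rev c = algebraMap ℝ (Cl m) δ) {x y : Vec m}
    (hx : c * vec x + d ≠ 0) (hy : c * vec y + d ≠ 0) (hσ : σ = 1 ∨ σ = -1)
    (hs : (c * vec y + d) * rev (c * vec y + d) =
      algebraMap ℝ (Cl m) (σ * clNorm (c * vec y + d) ^ 2)) :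
    vec (mobius a b c d x - mobius a b c d y) * (c * vec x + d) =
      (δ * σ * (clNorm (c * vec y + d) ^ 2)⁻¹) • ((c * vec y + d) * vec (x - y)) := by
  have h1 := hV.rev_denom_mul_sub_mul hδ h hx hy
  have hn := ((hV.isVecProd_denom y).clNorm_pos hy).ne'
  have hσ2 : σ * σ = 1 := by rcases hσ with rfl | rfl <;> norm_num
  set s := c * vec y + d
  set Δ := vec (mobius a b c d x - mobius a b c d y)
  set s' := c * vec x + d
  have h2 : (σ * clNorm s ^ 2) • (Δ * s') = δ • (s * vec (x - y)) := by
    rw [Algebra.smul_def, ← hs, ← mul_smul_comm, ← h1]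
    simp only [mul_assoc]
  calc Δ * s' = (σ * (clNorm s ^ 2)⁻¹ * (σ * clNorm s ^ 2)) • (Δ * s') := by
        have : σ * (clNorm s ^ 2)⁻¹ * (σ * clNorm s ^ 2) = 1 := by
          field_simp; rw [sq]; exact hσ2
        rw [this, one_smul]
    _ = _ := by
        rw [mul_smul, h2, smul_smul]
        congr 1
        ring

end IsVahlen

end Mobius

end HigherSpin

/-! ### Regularity, distortion and Jacobian of Möbius transformations. -/

namespace HigherSpin

variable {m : ℕ}

/-- Divided by r, the map is an isometry; it preserves the unit ball and its volume, so its
determinant is ±1. -/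
theorem abs_det_of_norm_eq {r : ℝ} (hr : 0 < r) {A : Vec m →L[ℝ] Vec m}
    (hA : ∀ h, ‖A h‖ = r * ‖h‖) : |A.det| = r ^ m := by
  let B : Vec m →ₗᵢ[ℝ] Vec m := ⟨r⁻¹ • (A : Vec m →ₗ[ℝ] Vec m), fun h => by
    simp [norm_smul, hA, abs_of_pos hr, hr.ne']⟩
  have hB : (A : Vec m →ₗ[ℝ] Vec m) = r • ((B.toLinearIsometryEquiv rfl).toLinearEquiv :
      Vec m →ₗ[ℝ] Vec m) := by
    ext h : 1
    simp [B, hr.ne']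
  have h1 : |LinearMap.det ((B.toLinearIsometryEquiv rfl).toLinearEquiv : Vec m →ₗ[ℝ] Vec m)|
      = 1 := by
    set e := B.toLinearIsometryEquiv rfl
    have h2 := Measure.addHaar_image_linearMap volume (e.toLinearEquiv : Vec m →ₗ[ℝ] Vec m)
      (Metric.ball 0 1)
    have h3 : (e.toLinearEquiv : Vec m →ₗ[ℝ] Vec m) '' Metric.ball 0 1 = Metric.ball 0 1 := by
      simp
    rw [h3] at h2
    have h4 : volume (Metric.ball (0 : Vec m) 1) ≠ 0 := (Metric.measure_ball_pos _ _ one_pos).ne'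
    have h5 : volume (Metric.ball (0 : Vec m) 1) ≠ ⊤ := measure_ball_lt_top.ne
    have h6 := (ENNReal.mul_eq_right h4 h5).1 h2.symm
    exact (ENNReal.ofReal_eq_one).1 h6
  rw [ContinuousLinearMap.det, hB, LinearMap.det_smul, abs_mul, h1]
  simp [abs_of_pos hr]

namespace IsVahlen

variable {a b c d : Cl m}

theorem denom_form (hV : IsVahlen a b c d) : (c = 0 ∧ d ≠ 0) ∨ (c ≠ 0 ∧ ∃ q : Vec m,
    d = c * vec q) := by
  obtain ⟨δ, hδ, h⟩ := hV.exists_det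
  rcases hV.normal_form hδ h with ⟨hc, hd, -⟩ | ⟨hc, q, hd, -⟩
  · exact Or.inl ⟨hc, hd⟩
  · exact Or.inr ⟨hc, q, hd⟩

theorem denom_ne_zero_iff (hc : c ≠ 0) (hV : IsVahlen a b c d) {q : Vec m} (hd : d = c * vec q)
    (y : Vec m) : c * vec y + d ≠ 0 ↔ y + q ≠ 0 := by
  rw [hd, ← mul_add, ← vec_add]
  refine ⟨fun h h' => h (by simp [h']), fun h => ?_⟩
  exact hV.prod_c.mul_ne_zero (isVecProd_vec _) hc fun h' => h (vec_eq_zero.1 h')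

theorem isOpen_denom_ne_zero (hV : IsVahlen a b c d) :
    IsOpen {y : Vec m | c * vec y + d ≠ 0} := by
  rcases hV.denom_form with ⟨hc, hd⟩ | ⟨hc, q, hd⟩
  · simp [hc, hd]
  · simp only [denom_ne_zero_iff hc hV hd]
    exact isOpen_ne.preimage (continuous_id.add continuous_const)

theorem contDiffAt_mobius (hV : IsVahlen a b c d) {y : Vec m} (hy : c * vec y + d ≠ 0) :
    ContDiffAt ℝ ∞ (mobius a b c d) y := by
  obtain ⟨δ, hδ, h⟩ := hV.exists_det
  rcases hV.normal_form hδ h with ⟨hc, hd, r, L, p, hm⟩ | ⟨hc, q, hd, r, L, p, hm⟩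
  · have : mobius a b c d = fun y => r • L y + p := by
      ext1 y
      rw [mobius, hm, vecPart_vec]
    rw [this]
    have hL : ContDiff ℝ ∞ fun y => L y := L.contDiff
    fun_prop
  · have hy' := (denom_ne_zero_iff hc hV hd y).1 hy
    have : mobius a b c d =ᶠ[nhds y] fun y => r • (‖y + q‖ ^ 2)⁻¹ • L (y + q) + p := by
      filter_upwards [hV.isOpen_denom_ne_zero.mem_nhds hy] with z hz
      rw [mobius, hm _ ((denom_ne_zero_iff hc hV hd z).1 hz), vecPart_vec]
    refine ContDiffAt.congr_of_eventuallyEq ?_ this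
    have h1 : ContDiffAt ℝ ∞ (fun y : Vec m => y + q) y := by fun_prop
    have h2 : ContDiffAt ℝ ∞ (fun y : Vec m => (‖y + q‖ ^ 2)⁻¹) y :=
      (h1.norm_sq ℝ).inv (by simpa using hy')
    have h3 : ContDiffAt ℝ ∞ (fun y => L (y + q)) y := L.contDiff.contDiffAt.comp y h1
    fun_prop

theorem continuous_clNorm_denom (hV : IsVahlen a b c d) :
    Continuous fun y : Vec m => clNorm (c * vec y + d) := by
  rcases hV.denom_form with ⟨hc, hd⟩ | ⟨hc, q, hd⟩
  · simp [hc, continuous_const]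
  · have : (fun y : Vec m => clNorm (c * vec y + d)) = fun y => clNorm c * ‖y + q‖ := by
      ext1 y
      rw [hd, ← mul_add, ← vec_add, hV.prod_c.clNorm_mul (isVecProd_vec _), clNorm_vec]
    rw [this]
    fun_prop

/-- Take norms in `rev_denom_mul_sub_mul`: `clNorm` is multiplicative on products of vectors. Both
injectivity and the Jacobian follow from this formula. -/
theorem norm_mobius_sub (hV : IsVahlen a b c d) {x y : Vec m}
    (hx : c * vec x + d ≠ 0) (hy : c * vec y + d ≠ 0) :
    ‖mobius a b c d x - mobius a b c d y‖ =
      (clNorm (c * vec x + d))⁻¹ * (clNorm (c * vec y + d))⁻¹ * ‖x - y‖ := by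
  obtain ⟨δ, hδ, h⟩ := hV.exists_det
  have h1 := hV.rev_denom_mul_sub_mul hδ h hx hy
  have hsx := hV.isVecProd_denom x
  have hsy := hV.isVecProd_denom y
  have h2 := congrArg clNorm h1
  rw [(hsy.rev.mul (isVecProd_vec _)).clNorm_mul hsx, hsy.rev.clNorm_mul (isVecProd_vec _),
    hsy.clNorm_rev, clNorm_smul δ (isVecProd_vec _), clNorm_vec, clNorm_vec] at h2
  have hδ1 : |δ| = 1 := by rcases hδ with rfl | rfl <;> norm_num
  rw [hδ1, one_mul] at h2
  rw [← h2]
  have := (hsx.clNorm_pos hx).ne'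
  have := (hsy.clNorm_pos hy).ne'
  field_simp

theorem injOn_mobius (hV : IsVahlen a b c d) :
    Set.InjOn (mobius a b c d) {y : Vec m | c * vec y + d ≠ 0} := by
  intro x hx y hy hxy
  have h := hV.norm_mobius_sub hx hy
  rw [hxy, sub_self, norm_zero] at h
  have := ((hV.isVecProd_denom x).clNorm_pos hx).ne'
  have := ((hV.isVecProd_denom y).clNorm_pos hy).ne'
  have h3 : ‖x - y‖ = 0 := by
    simpa [this, ‹clNorm (c * vec x + d) ≠ 0›] using h.symm
  exact sub_eq_zero.1 (norm_eq_zero.1 h3)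

/-- Dividing `norm_mobius_sub` by t along the line y + t h and letting t → 0 shows that the
derivative scales every h by ‖cy + d‖⁻², with no formula for the derivative itself. -/
theorem abs_det_fderiv_mobius (hV : IsVahlen a b c d) {y : Vec m} (hy : c * vec y + d ≠ 0) :
    |(fderiv ℝ (mobius a b c d) y).det| = ((clNorm (c * vec y + d) ^ 2)⁻¹) ^ m := by
  have hn := (hV.isVecProd_denom y).clNorm_pos hy
  refine abs_det_of_norm_eq (by positivity) fun h => ?_
  have hd : HasFDerivAt (mobius a b c d) (fderiv ℝ (mobius a b c d) y) y :=
    ((hV.contDiffAt_mobius hy).differentiableAt (by simp)).hasFDerivAt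
  have hl : HasDerivAt (fun t : ℝ => y + t • h) h 0 := by
    simpa using ((hasDerivAt_id (0 : ℝ)).smul_const h).const_add y
  have hd0 : HasFDerivAt (mobius a b c d) (fderiv ℝ (mobius a b c d) y) (y + (0 : ℝ) • h) := by
    simpa using hd
  have h1 := (hd0.comp_hasDerivAt 0 hl).tendsto_slope.norm
  have hcont : Continuous fun t : ℝ => clNorm (c * vec (y + t • h) + d) :=
    hV.continuous_clNorm_denom.comp (by fun_prop)
  have h2 : Filter.Tendsto (fun t : ℝ => (clNorm (c * vec (y + t • h) + d))⁻¹ *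
      (clNorm (c * vec y + d))⁻¹ * ‖h‖) (nhdsWithin 0 {0}ᶜ)
      (nhds ((clNorm (c * vec y + d))⁻¹ * (clNorm (c * vec y + d))⁻¹ * ‖h‖)) := by
    have : Filter.Tendsto (fun t : ℝ => clNorm (c * vec (y + t • h) + d)) (nhds 0)
        (nhds (clNorm (c * vec y + d))) := by
      simpa using hcont.tendsto 0
    exact (((this.inv₀ hn.ne').mul_const _).mul_const _).mono_left nhdsWithin_le_nhds
  have hev : ∀ᶠ t : ℝ in nhds 0, c * vec (y + t • h) + d ≠ 0 := by
    have : Filter.Tendsto (fun t : ℝ => y + t • h) (nhds 0) (nhds y) := by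
      simpa using hl.continuousAt.tendsto
    exact this (hV.isOpen_denom_ne_zero.mem_nhds hy)
  have h3 := h2.congr' (f₂ := fun t => ‖slope (mobius a b c d ∘ fun t : ℝ => y + t • h) 0 t‖) (by
    filter_upwards [hev.filter_mono nhdsWithin_le_nhds, self_mem_nhdsWithin] with t ht ht0
    have ht0' : t ≠ 0 := ht0
    rw [slope_def_module, norm_smul, Function.comp_apply, Function.comp_apply, zero_smul,
      add_zero, hV.norm_mobius_sub ht hy, add_sub_cancel_left, norm_smul, sub_zero, norm_inv]
    have : ‖t‖ ≠ 0 := by simpa using ht0'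
    field_simp)
  rw [tendsto_nhds_unique h1 h3]
  congr 1
  rw [sq, mul_inv]

end IsVahlen

end HigherSpin

namespace HigherSpin

variable {m : ℕ} {W : Type*} [NormedAddCommGroup W] [NormedSpace ℂ W]

/-! ### Homogeneous polynomials: smoothness, finite dimension, linear substitutions. -/

section HomPoly

theorem homPoly_contDiff {k : ℕ} {f : Vec m → W} (hf : f ∈ homPoly m k W) : ContDiff ℝ ∞ f := by
  induction hf using Submodule.span_induction with
  | mem f hf =>
    obtain ⟨α, w, -, rfl⟩ := hf
    have h1 : ∀ i : Fin m, ContDiff ℝ ∞ fun u : Vec m => u i := fun i =>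
      (EuclideanSpace.proj (𝕜 := ℝ) i).contDiff
    have h2 : ContDiff ℝ ∞ fun u : Vec m => ∏ i, u i ^ α i :=
      contDiff_prod fun i _ => (h1 i).pow (α i)
    exact (Complex.ofRealCLM.contDiff.comp h2).smul contDiff_const
  | zero => exact contDiff_const (c := (0 : W))
  | add f g _ _ hf hg => exact hf.add hg
  | smul c f _ hf => exact contDiff_const.smul hf

instance homPoly_finiteDimensional (k : ℕ) [FiniteDimensional ℂ W] :
    FiniteDimensional ℂ (homPoly m k W) := by
  let b := Module.finBasis ℂ W
  let S : Set (Vec m → W) := Set.range fun p : (Fin m → Fin (k + 1)) × Fin (Module.finrank ℂ W) =>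
    fun u => ((∏ i, u i ^ (p.1 i : ℕ) : ℝ) : ℂ) • b p.2
  have hS : S.Finite := Set.finite_range _
  have : FiniteDimensional ℂ (Submodule.span ℂ S) := FiniteDimensional.span_of_finite ℂ hS
  refine Submodule.finiteDimensional_of_le (S₂ := Submodule.span ℂ S) ?_
  rw [homPoly, Submodule.span_le]
  rintro _ ⟨α, w, hα, rfl⟩
  have hle : ∀ i, α i < k + 1 := fun i => Nat.lt_succ_of_le (by
    rw [← hα]
    exact Finset.single_le_sum (fun _ _ => Nat.zero_le _) (Finset.mem_univ i))
  have : (fun u : Vec m => ((∏ i, u i ^ α i : ℝ) : ℂ) • w) =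
      ∑ j, b.repr w j • fun u : Vec m => ((∏ i, u i ^ α i : ℝ) : ℂ) • b j := by
    ext1 u
    conv_lhs => rw [← b.sum_repr w]
    simp only [Finset.smul_sum, Finset.sum_apply, Pi.smul_apply]
    exact Finset.sum_congr rfl fun j _ => smul_comm _ _ _
  rw [this]
  exact Submodule.sum_mem _ fun j _ => Submodule.smul_mem _ _
    (Submodule.subset_span ⟨(fun i => ⟨α i, hle i⟩, j), rfl⟩)

theorem homPoly_coord_mul {k : ℕ} {f : Vec m → W} (hf : f ∈ homPoly m k W) (i : Fin m) :
    (fun u : Vec m => ((u i : ℝ) : ℂ) • f u) ∈ homPoly m (k + 1) W := by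
  induction hf using Submodule.span_induction with
  | mem f hf =>
    obtain ⟨α, w, hα, rfl⟩ := hf
    refine Submodule.subset_span ⟨α + Pi.single i 1, w, ?_, ?_⟩
    · simp [Finset.sum_add_distrib, hα]
    · ext1 u
      rw [smul_smul, ← Complex.ofReal_mul]
      congr 2
      simp only [Pi.add_apply, pow_add, Finset.prod_mul_distrib]
      rw [mul_comm]
      congr 1
      rw [Finset.prod_eq_single i]
      · simp
      · intro j _ hj
        simp [hj]
      · simp
  | zero =>
    convert Submodule.zero_mem (homPoly m (k + 1) W) using 1
    ext1 u
    simp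
  | add f g _ _ hf hg =>
    convert Submodule.add_mem _ hf hg using 1
    ext1 u
    simp
  | smul c f _ hf =>
    convert Submodule.smul_mem _ c hf using 1
    ext1 u
    exact smul_comm _ _ _

theorem homPoly_linear_mul {k : ℕ} {f : Vec m → W} (hf : f ∈ homPoly m k W)
    (l : Vec m →ₗ[ℝ] ℝ) : (fun u : Vec m => ((l u : ℝ) : ℂ) • f u) ∈ homPoly m (k + 1) W := by
  have : (fun u : Vec m => ((l u : ℝ) : ℂ) • f u) =
      ∑ i, ((l (stdVec i) : ℝ) : ℂ) • fun u : Vec m => ((u i : ℝ) : ℂ) • f u := by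
    ext1 u
    have hu : u = ∑ i, u i • stdVec i := by
      simpa [stdVec] using ((EuclideanSpace.basisFun (Fin m) ℝ).sum_repr u).symm
    have hl : l u = ∑ i, u i * l (stdVec i) := by
      conv_lhs => rw [hu]
      simp
    simp only [hl, Complex.ofReal_sum, Complex.ofReal_mul, Finset.sum_smul, Finset.sum_apply,
      Pi.smul_apply, smul_smul]
    exact Finset.sum_congr rfl fun i _ => by rw [mul_comm]
  rw [this]
  exact Submodule.sum_mem _ fun i _ => Submodule.smul_mem _ _ (homPoly_coord_mul hf i)

theorem homPoly_comp_linear {k : ℕ} {f : Vec m → W} (hf : f ∈ homPoly m k W)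
    (A : Vec m →ₗ[ℝ] Vec m) : (fun u => f (A u)) ∈ homPoly m k W := by
  induction hf using Submodule.span_induction with
  | mem f hf =>
    obtain ⟨α, w, hα, rfl⟩ := hf
    have hl : ∀ i, ∃ l : Vec m →ₗ[ℝ] ℝ, ∀ u, l u = A u i := fun i =>
      ⟨(EuclideanSpace.proj (𝕜 := ℝ) i : Vec m →ₗ[ℝ] ℝ) ∘ₗ A, fun u => rfl⟩
    choose l hl using hl
    have hpow : ∀ (n j : ℕ) (i : Fin m) (g : Vec m → W), g ∈ homPoly m j W →
        (fun u : Vec m => ((l i u ^ n : ℝ) : ℂ) • g u) ∈ homPoly m (n + j) W := by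
      intro n j i g hg
      induction n with
      | zero => simpa using hg
      | succ n ih =>
        have := homPoly_linear_mul ih (l i)
        simp only [smul_smul, ← Complex.ofReal_mul, ← pow_succ'] at this
        convert this using 2
        ring
    have hprod : ∀ s : Finset (Fin m),
        (fun u : Vec m => ((∏ i ∈ s, l i u ^ α i : ℝ) : ℂ) • w) ∈ homPoly m (∑ i ∈ s, α i) W := by
      intro s
      induction s using Finset.induction_on with
      | empty => exact Submodule.subset_span ⟨0, w, by simp, by simp⟩
      | insert i s hi ih =>
        have := hpow (α i) _ i _ ih
        rw [Finset.sum_insert hi]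
        convert this using 2 with u
        rw [Finset.prod_insert hi, smul_smul, ← Complex.ofReal_mul]
    have := hprod Finset.univ
    rw [hα] at this
    simpa only [hl] using this
  | zero => exact Submodule.zero_mem _
  | add f g _ _ hf hg => exact Submodule.add_mem _ hf hg
  | smul c f _ hf => exact Submodule.smul_mem _ c hf

theorem homPoly_linear_comp {k : ℕ} {f : Vec m → W} (hf : f ∈ homPoly m k W)
    (T : W →ₗ[ℂ] W) : (fun u => T (f u)) ∈ homPoly m k W := by
  induction hf using Submodule.span_induction with
  | mem f hf =>
    obtain ⟨α, w, hα, rfl⟩ := hf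
    exact Submodule.subset_span ⟨α, T w, hα, by simp⟩
  | zero =>
    convert Submodule.zero_mem (homPoly m k W) using 1
    ext1 u
    simp
  | add f g _ _ hf hg =>
    convert Submodule.add_mem _ hf hg using 1
    ext1 u
    simp
  | smul c f _ hf =>
    convert Submodule.smul_mem _ c hf using 1
    ext1 u
    simp

end HomPoly

/-! ### Harmonic polynomials and their invariance under isometries. -/

section Harmonic

/-- The space `𝓗_k`. -/
def harmonicSpace (m k : ℕ) : Submodule ℂ (Vec m → ℂ) where
  carrier := {f | IsHarmonicPoly k f}
  add_mem' {f g} hf hg := ⟨Submodule.add_mem _ hf.1 hg.1, fun u => by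
    rw [ContDiffAt.laplacian_add
      (((homPoly_contDiff hf.1).of_le (WithTop.coe_le_coe.2 le_top)).contDiffAt)
      (((homPoly_contDiff hg.1).of_le (WithTop.coe_le_coe.2 le_top)).contDiffAt), hf.2, hg.2,
      add_zero]⟩
  zero_mem' := ⟨Submodule.zero_mem _, fun u => by
    have : (0 : Vec m → ℂ) = fun _ => 0 := rfl
    rw [this, InnerProductSpace.laplacian_const]
    rfl⟩
  smul_mem' c f hf := ⟨Submodule.smul_mem _ c hf.1, fun u => by
    rw [InnerProductSpace.laplacian_smul c
      (((homPoly_contDiff hf.1).of_le (WithTop.coe_le_coe.2 le_top)).contDiffAt), hf.2, smul_zero]⟩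

theorem laplacian_comp_isometry {f : Vec m → ℂ} (hf : ContDiff ℝ 2 f) (L : Vec m ≃ₗᵢ[ℝ] Vec m)
    (u : Vec m) : Laplacian.laplacian (fun u => f (L u)) u = Laplacian.laplacian f (L u) := by
  let b := EuclideanSpace.basisFun (Fin m) ℝ
  rw [InnerProductSpace.laplacian_eq_iteratedFDeriv_orthonormalBasis _ b,
    InnerProductSpace.laplacian_eq_iteratedFDeriv_orthonormalBasis _ (b.map L)]
  refine Finset.sum_congr rfl fun i _ => ?_
  have := (L.toContinuousLinearEquiv : Vec m →L[ℝ] Vec m).iteratedFDeriv_comp_right hf u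
    (i := 2) le_rfl
  have h2 : (f ∘ (L.toContinuousLinearEquiv : Vec m →L[ℝ] Vec m)) = fun u => f (L u) := rfl
  rw [h2] at this
  rw [this, ContinuousMultilinearMap.compContinuousLinearMap_apply]
  congr 1
  ext j
  fin_cases j <;> simp

theorem isHarmonicPoly_comp_isometry {k : ℕ} {f : Vec m → ℂ} (hf : IsHarmonicPoly k f)
    (L : Vec m ≃ₗᵢ[ℝ] Vec m) : IsHarmonicPoly k fun u => f (L u) :=
  ⟨homPoly_comp_linear hf.1 (L.toLinearEquiv : Vec m →ₗ[ℝ] Vec m), fun u => by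
    rw [laplacian_comp_isometry ((homPoly_contDiff hf.1).of_le (WithTop.coe_le_coe.2 le_top)), hf.2]⟩

end Harmonic

/-! ### Monogenic polynomials and their invariance under the twisted action of vectors. -/

section Monogenic

variable (ρ : Cl m →ₐ[ℝ] Module.End ℂ W)

/-- The space `𝓜_k`. -/
def monogenicSpace (k : ℕ) : Submodule ℂ (Vec m → W) where
  carrier := {f | IsMonogenicPoly ρ k f}
  add_mem' {f g} hf hg := ⟨Submodule.add_mem _ hf.1 hg.1, fun u => by
    have h1 := (homPoly_contDiff hf.1).differentiable (by simp) u
    have h2 := (homPoly_contDiff hg.1).differentiable (by simp) u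
    have h3 := hf.2 u
    have h4 := hg.2 u
    rw [dirac] at h3 h4 ⊢
    simp only [fderiv_add h1 h2, add_apply, map_add, Finset.sum_add_distrib,
      h3, h4, add_zero]⟩
  zero_mem' := ⟨Submodule.zero_mem _, fun u => by simp [dirac]⟩
  smul_mem' c f hf := ⟨Submodule.smul_mem _ c hf.1, fun u => by
    have h1 := (homPoly_contDiff hf.1).differentiable (by simp) u
    have h3 := hf.2 u
    rw [dirac] at h3 ⊢
    simp only [fderiv_const_smul h1 c, smul_apply, map_smul,
      ← Finset.smul_sum, h3, smul_zero]⟩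

/-- The trace of a bilinear map does not depend on the orthonormal basis. -/
theorem sum_bilin_isometry {X : Type*} [AddCommGroup X] [Module ℝ X]
    (B : Vec m →ₗ[ℝ] Vec m →ₗ[ℝ] X) (L : Vec m ≃ₗᵢ[ℝ] Vec m) :
    ∑ i, B (L (stdVec i)) (L (stdVec i)) = ∑ i, B (stdVec i) (stdVec i) := by
  let b := EuclideanSpace.basisFun (Fin m) ℝ
  have hb : ∀ i, b i = stdVec i := fun i => by simp [b, stdVec]
  have h1 : ∀ i, L (stdVec i) = ∑ j, inner ℝ (stdVec j) (L (stdVec i)) • stdVec j := by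
    intro i
    simpa [hb] using (b.sum_repr' (L (stdVec i))).symm
  have h2 : ∀ j, ∑ i, inner ℝ (stdVec j) (L (stdVec i)) • L (stdVec i) = stdVec j := by
    intro j
    have := (b.map L).sum_repr' (stdVec j)
    simpa [hb, real_inner_comm] using this
  calc ∑ i, B (L (stdVec i)) (L (stdVec i))
      = ∑ i, ∑ j, B (stdVec j) (inner ℝ (stdVec j) (L (stdVec i)) • L (stdVec i)) := by
        refine Finset.sum_congr rfl fun i _ => ?_
        nth_rw 1 [h1 i]
        simp only [map_sum, map_smul, LinearMap.sum_apply, LinearMap.smul_apply]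
    _ = ∑ j, B (stdVec j) (stdVec j) := by
        rw [Finset.sum_comm]
        refine Finset.sum_congr rfl fun j _ => ?_
        rw [← map_sum, h2]

/-- Immediate from x v x = ‖x‖² `rot (vec x) v` and x² = −‖x‖². It moves the e_i of the Dirac
operator past x. -/
theorem vec_mul_vec_eq_neg {x : Vec m} (hx : x ≠ 0) (v : Vec m) :
    vec v * vec x = -(vec x * vec (rot (vec x) v)) := by
  have h := (isVecProd_vec x).sandwich (fun h => hx (vec_eq_zero.1 h)) v
  rw [clNorm_vec, rev_vec] at h
  have hn : ‖x‖ ^ 2 ≠ 0 := by simpa using hx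
  have h2 : vec (rot (vec x) v) = (‖x‖ ^ 2)⁻¹ • (vec x * vec v * vec x) := by
    rw [h, smul_smul, inv_mul_cancel₀ hn, one_smul]
  rw [h2, mul_smul_comm, ← mul_assoc, ← mul_assoc, vec_mul_self, mul_assoc, ← Algebra.smul_def,
    smul_smul, ← neg_smul]
  have : -((‖x‖ ^ 2)⁻¹ * -‖x‖ ^ 2) = 1 := by
    rw [mul_neg, neg_neg, inv_mul_cancel₀ hn]
  rw [this, one_smul]

/-- Moving e_i past x yields −x (L e_i), and the chain rule yields the derivative along L e_i. The
sum is −x times a Dirac operator written in the orthonormal basis L e_i, so it equals −x (D f)(L u)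
= 0. -/
theorem isMonogenicPoly_act [FiniteDimensional ℂ W] {k : ℕ} {f : Vec m → W}
    (hf : IsMonogenicPoly ρ k f) {x : Vec m}
    (hx : x ≠ 0) : IsMonogenicPoly ρ k fun u => ρ (vec x) (f (rot (vec x) u)) := by
  obtain ⟨L, hL, -⟩ := (isVecProd_vec x).exists_rot_eq (fun h => hx (vec_eq_zero.1 h))
  refine ⟨homPoly_linear_comp ?_ (ρ (vec x)), fun u => ?_⟩
  · simp only [hL]
    exact homPoly_comp_linear hf.1 (L.toLinearEquiv : Vec m →ₗ[ℝ] Vec m)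
  · let T : W →L[ℝ] W := (LinearMap.toContinuousLinearMap (ρ (vec x) : W →ₗ[ℂ] W)).restrictScalars ℝ
    have hd : DifferentiableAt ℝ f (L u) := (homPoly_contDiff hf.1).differentiable (by simp) _
    have h1 : HasFDerivAt (fun u => ρ (vec x) (f (rot (vec x) u)))
        (T.comp ((fderiv ℝ f (L u)).comp (L.toContinuousLinearEquiv : Vec m →L[ℝ] Vec m))) u := by
      simp only [hL]
      exact T.hasFDerivAt.comp u (hd.hasFDerivAt.comp u
        (L.toContinuousLinearEquiv : Vec m →L[ℝ] Vec m).hasFDerivAt)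
    let B : Vec m →ₗ[ℝ] Vec m →ₗ[ℝ] W := LinearMap.mk₂ ℝ
      (fun v v' => ρ (vec v) (fderiv ℝ f (L u) v'))
      (fun v v' w => by simp [vec_add]) (fun c v w => by simp [vec_smul])
      (fun v v' w => by simp) (fun c v w => by simp)
    have h2 : ∑ i, B (L (stdVec i)) (L (stdVec i)) = 0 := by
      rw [sum_bilin_isometry]
      exact hf.2 (L u)
    rw [dirac, h1.fderiv]
    have h3 : ∀ i : Fin m, ρ (vec (stdVec i)) (T (fderiv ℝ f (L u) (L (stdVec i)))) =
        -(ρ (vec x) (B (L (stdVec i)) (L (stdVec i)))) := by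
      intro i
      change (ρ (vec (stdVec i)) * ρ (vec x)) (fderiv ℝ f (L u) (L (stdVec i))) =
        -((ρ (vec x) * ρ (vec (L (stdVec i)))) (fderiv ℝ f (L u) (L (stdVec i))))
      rw [← map_mul, ← map_mul, vec_mul_vec_eq_neg hx, hL, map_neg]
      rfl
    calc ∑ i, ρ (vec (stdVec i)) (T (fderiv ℝ f (L u) (L (stdVec i))))
        = -(ρ (vec x) (∑ i, B (L (stdVec i)) (L (stdVec i)))) := by
          rw [Finset.sum_congr rfl fun i _ => h3 i, Finset.sum_neg_distrib, map_sum]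
      _ = 0 := by rw [h2, map_zero, neg_zero]

end Monogenic

end HigherSpin

namespace HigherSpin

variable {m : ℕ} {W : Type*} [NormedAddCommGroup W] [NormedSpace ℂ W]

/-! ### Invariant positive definite forms on Clifford modules. -/

section Form

/-- Sesquilinear forms. -/
abbrev SesqForm (W : Type*) [NormedAddCommGroup W] [NormedSpace ℂ W] : Type _ :=
  W →ₗ⋆[ℂ] W →ₗ[ℂ] ℂ

theorem exists_posDef_form [FiniteDimensional ℂ W] :
    ∃ B : SesqForm W, ∀ w, w ≠ 0 → 0 < (B w w).re := by
  let b := Module.finBasis ℂ W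
  let B : SesqForm W := LinearMap.mk₂'ₛₗ (starRingEnd ℂ) (RingHom.id ℂ)
    (fun w w' => ∑ i, starRingEnd ℂ (b.repr w i) * b.repr w' i)
    (fun v w w' => by simp [add_mul, Finset.sum_add_distrib])
    (fun c w w' => by simp [Finset.mul_sum, mul_assoc])
    (fun v w w' => by simp [mul_add, Finset.sum_add_distrib])
    (fun c w w' => by simp [Finset.mul_sum, mul_left_comm])
  refine ⟨B, fun w hw => ?_⟩
  have h1 : (B w w).re = ∑ i, ‖b.repr w i‖ ^ 2 := by
    change (∑ i, starRingEnd ℂ (b.repr w i) * b.repr w i).re = _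
    rw [Complex.re_sum]
    refine Finset.sum_congr rfl fun i _ => ?_
    rw [mul_comm, Complex.mul_conj, Complex.normSq_eq_norm_sq, Complex.ofReal_re]
  rw [h1]
  have hne : b.repr w ≠ 0 := fun h => hw (by simpa using h)
  obtain ⟨i, hi⟩ := Finsupp.ne_iff.1 hne
  refine Finset.sum_pos' (fun _ _ => by positivity) ⟨i, Finset.mem_univ i, ?_⟩
  have : ‖b.repr w i‖ ≠ 0 := by simpa using hi
  positivity

variable (ρ : Cl m →ₐ[ℝ] Module.End ℂ W)

theorem rho_stdVec_sq (i : Fin m) (w : W) :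
    ρ (vec (stdVec i)) (ρ (vec (stdVec i)) w) = -w := by
  have h : ρ (vec (stdVec i)) * ρ (vec (stdVec i)) = -1 := by
    rw [← map_mul, vec_mul_self]
    simp [stdVec]
  exact congrArg (fun T : Module.End ℂ W => T w) h

theorem rho_stdVec_anticomm {i j : Fin m} (hij : i ≠ j) (w : W) :
    ρ (vec (stdVec i)) (ρ (vec (stdVec j)) w) = -ρ (vec (stdVec j)) (ρ (vec (stdVec i)) w) := by
  have h : ρ (vec (stdVec i)) * ρ (vec (stdVec j)) = -(ρ (vec (stdVec j)) * ρ (vec (stdVec i))) := by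
    rw [← map_mul, ← map_mul, ← map_neg]
    refine congrArg ρ (eq_neg_of_add_eq_zero_left ?_)
    have h0 : inner ℝ (stdVec i) (stdVec j) = 0 := by
      simp [stdVec, EuclideanSpace.inner_single_left, hij]
    rw [vec_mul_vec_add, h0, mul_zero, map_zero]
  exact congrArg (fun T : Module.End ℂ W => T w) h

/-- A positive definite form for which vectors act by skew-adjoint maps. -/
theorem exists_invariant_form [FiniteDimensional ℂ W] : ∃ B : SesqForm W,
    (∀ w, w ≠ 0 → 0 < (B w w).re) ∧
      ∀ a w w', B (ρ a w) w' = B w (ρ (conj a) w') := by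
  -- Average the form over 1 and e_i, one index at a time. Since e_i² = −1 the average is invariant
  -- under e_i, and anticommutation preserves the invariance under the earlier e_j.
  have key : ∀ s : Finset (Fin m), ∃ B : SesqForm W, (∀ w, w ≠ 0 → 0 < (B w w).re) ∧
      ∀ i ∈ s, ∀ w w', B (ρ (vec (stdVec i)) w) (ρ (vec (stdVec i)) w') = B w w' := by
    intro s
    induction s using Finset.induction_on with
    | empty =>
      obtain ⟨B, hB⟩ := exists_posDef_form (W := W)
      exact ⟨B, hB, by simp⟩
    | insert i s hi ih =>
      obtain ⟨B, hpos, hinv⟩ := ih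
      let B' : SesqForm W := LinearMap.mk₂'ₛₗ (starRingEnd ℂ) (RingHom.id ℂ)
        (fun w w' => B w w' + B (ρ (vec (stdVec i)) w) (ρ (vec (stdVec i)) w'))
        (fun v w w' => by simp; ring) (fun c w w' => by simp; ring)
        (fun v w w' => by simp; ring) (fun c w w' => by simp; ring)
      have hB' : ∀ w w', B' w w' =
        B w w' + B (ρ (vec (stdVec i)) w) (ρ (vec (stdVec i)) w') := fun w w' => rfl
      refine ⟨B', fun w hw => ?_, fun j hj w w' => ?_⟩
      · have hne : ρ (vec (stdVec i)) w ≠ 0 := by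
          intro h
          have := rho_stdVec_sq ρ i w
          rw [h, map_zero] at this
          exact hw (neg_eq_zero.1 this.symm)
        rw [hB', Complex.add_re]
        exact add_pos (hpos w hw) (hpos _ hne)
      · by_cases hji : j = i
        · subst hji
          rw [hB', hB', rho_stdVec_sq, rho_stdVec_sq, map_neg, map_neg, LinearMap.neg_apply,
            neg_neg, add_comm]
        · have hjs : j ∈ s := (Finset.mem_insert.1 hj).resolve_left hji
          rw [hB', hB', hinv j hjs, rho_stdVec_anticomm ρ (Ne.symm hji) w,
            rho_stdVec_anticomm ρ (Ne.symm hji) w', map_neg, map_neg, LinearMap.neg_apply,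
            neg_neg, hinv j hjs]
  obtain ⟨B, hpos, hinv⟩ := key Finset.univ
  refine ⟨B, hpos, fun a => ?_⟩
  -- Invariance together with e_i² = −1 makes e_i skew-adjoint; this is the claim for basis vectors,
  -- and it extends multiplicatively to all of the algebra.
  have hstd : ∀ i w w', B (ρ (vec (stdVec i)) w) w' = -B w (ρ (vec (stdVec i)) w') := by
    intro i w w'
    have := hinv i (Finset.mem_univ i) w (ρ (vec (stdVec i)) w')
    rw [rho_stdVec_sq, map_neg] at this
    rw [← this, neg_neg]
  have hvec : ∀ x w w', B (ρ (vec x) w) w' = B w (ρ (conj (vec x)) w') := by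
    intro x w w'
    have hx : vec x = ∑ i, x i • vec (stdVec i) := by
      have : x = ∑ i, x i • stdVec i := by
        simpa [stdVec] using ((EuclideanSpace.basisFun (Fin m) ℝ).sum_repr x).symm
      conv_lhs => rw [this]
      simp [vec]
    have hreal : ∀ (r : ℝ) (v : W), r • v = (r : ℂ) • v := fun r v => (Complex.coe_smul r v).symm
    rw [conj_vec, map_neg, LinearMap.neg_apply, map_neg, hx]
    simp only [map_sum, map_smul, LinearMap.sum_apply, LinearMap.smul_apply, hreal, map_smulₛₗ,
      Complex.conj_ofReal, hstd, smul_neg, Finset.sum_neg_distrib]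
  induction a using CliffordAlgebra.induction with
  | algebraMap r =>
    intro w w'
    have hr : ∀ v : W, ρ (algebraMap ℝ (Cl m) r) v = (r : ℂ) • v := fun v => by
      rw [AlgHom.commutes, Module.algebraMap_end_apply, Complex.coe_smul]
    rw [conj_algebraMap, hr, hr, map_smulₛₗ, map_smul, Complex.conj_ofReal]
    rfl
  | ι x => exact hvec x
  | mul a b ha hb =>
    intro w w'
    rw [conj_mul, map_mul, map_mul, Module.End.mul_apply, Module.End.mul_apply, ha, hb]
  | add a b ha hb =>
    intro w w'
    rw [conj_add, map_add, map_add, LinearMap.add_apply, LinearMap.add_apply, map_add, map_add,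
      LinearMap.add_apply, ha, hb]

end Form

/-! ### Reproducing kernels span their space. -/

section Spanning

variable [FiniteDimensional ℂ W]

theorem SesqForm.continuous_comp (B : SesqForm W) {X : Type*} [TopologicalSpace X] {f g : X → W}
    (hf : Continuous f) (hg : Continuous g) : Continuous fun x => B (f x) (g x) := by
  let b := Module.finBasis ℂ W
  have h : (fun x => B (f x) (g x)) =
      fun x => ∑ i, starRingEnd ℂ (b.repr (f x) i) * B (b i) (g x) := by
    ext1 x
    have hB : B (f x) = B (∑ i, b.repr (f x) i • b i) := by rw [b.sum_repr]
    rw [hB]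
    simp only [map_sum, map_smulₛₗ, LinearMap.sum_apply, LinearMap.smul_apply, smul_eq_mul]
  rw [h]
  refine continuous_finsetSum _ fun i _ => ?_
  have h1 : Continuous fun x => b.repr (f x) i :=
    (LinearMap.continuous_of_finiteDimensional (b.coord i)).comp hf
  have h2 : Continuous fun x => B (b i) (g x) :=
    (LinearMap.continuous_of_finiteDimensional (B (b i))).comp hg
  exact (Complex.continuous_conj.comp h1).mul h2

/-- A family in a finite-dimensional function space spans it, if it separates points under a
sesquilinear pairing on the sphere. -/
theorem span_range_eq_of_separating (B : SesqForm W) (V : Submodule ℂ (Vec m → W))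
    [FiniteDimensional ℂ V] (hcont : ∀ f ∈ V, Continuous f) {I : Type*} (Z : I → Vec m → W)
    (hZ : ∀ i, Z i ∈ V)
    (hsep : ∀ f ∈ V, (∀ i, ∫ u : Metric.sphere (0 : Vec m) 1,
      B (Z i u) (f u) ∂(sphereMeasure m) = 0) → f = 0) :
    Submodule.span ℂ (Set.range Z) = V := by
  set V' := Submodule.span ℂ (Set.range Z) with hV'
  have hle : V' ≤ V := Submodule.span_le.2 (by rintro _ ⟨i, rfl⟩; exact hZ i)
  by_contra hne
  have hfd : FiniteDimensional ℂ V' := Submodule.finiteDimensional_of_le hle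
  have hlt : Module.finrank ℂ V' < Module.finrank ℂ V :=
    Submodule.finrank_lt_finrank_of_lt (lt_of_le_of_ne hle hne)
  let b := Module.finBasis ℂ V'
  have hfin : IsFiniteMeasure (sphereMeasure m) := by
    unfold sphereMeasure
    infer_instance
  have hint : ∀ f ∈ V, ∀ g ∈ V, Integrable (fun u : Metric.sphere (0 : Vec m) 1 =>
      B (f u) (g u)) (sphereMeasure m) := fun f hf g hg =>
    (B.continuous_comp ((hcont f hf).comp continuous_subtype_val)
      ((hcont g hg).comp continuous_subtype_val)).integrable_of_hasCompactSupport
      (HasCompactSupport.of_compactSpace _)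
  -- Dimension count: were the span proper, pairing with a basis of it would impose fewer than dim V
  -- linear conditions. A nonzero f would satisfy them all, contradicting separation.
  let Λ : V →ₗ[ℂ] (Fin (Module.finrank ℂ V') → ℂ) :=
    { toFun := fun f i => ∫ u : Metric.sphere (0 : Vec m) 1,
        B ((b i : Vec m → W) u) ((f : Vec m → W) u) ∂(sphereMeasure m)
      map_add' := fun f g => by
        ext i
        simp only [Submodule.coe_add, Pi.add_apply, map_add]
        exact integral_add (hint _ (hle (b i).2) _ f.2) (hint _ (hle (b i).2) _ g.2)
      map_smul' := fun c f => by
        ext i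
        simp only [Submodule.coe_smul, Pi.smul_apply, map_smul, RingHom.id_apply]
        exact integral_const_mul c _ }
  have hker : LinearMap.ker Λ ≠ ⊥ := LinearMap.ker_ne_bot_of_finrank_lt (by simpa using hlt)
  obtain ⟨f, hf, hf0⟩ := Submodule.exists_mem_ne_zero_of_ne_bot hker
  refine hf0 (Subtype.ext (hsep f f.2 fun i => ?_))
  have hZi : Z i ∈ V' := Submodule.subset_span ⟨i, rfl⟩
  have hexp : ∀ u, Z i u = ∑ j, b.repr ⟨Z i, hZi⟩ j • (b j : Vec m → W) u := by
    intro u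
    have h := congrArg (fun g : V' => (g : Vec m → W) u) (b.sum_repr ⟨Z i, hZi⟩)
    refine h.symm.trans ?_
    rw [AddSubmonoidClass.coe_finsetSum, Finset.sum_apply]
    rfl
  simp only [hexp, map_sum, LinearMap.sum_apply, map_smulₛₗ, LinearMap.smul_apply]
  rw [integral_finsetSum]
  · refine Finset.sum_eq_zero fun j _ => ?_
    have := congrFun (LinearMap.mem_ker.1 hf) j
    simp only [smul_eq_mul]
    rw [integral_const_mul]
    change _ * Λ f j = 0
    rw [this]
    simp
  · intro j _
    exact (hint _ (hle (b j).2) _ f.2).const_mul _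

end Spanning

end HigherSpin

namespace HigherSpin

variable {m : ℕ}

/-! ### Constant coefficient operators on smooth functions. -/

section SmoothFunctions

/-- Smooth complex-valued functions on `ℝ^m`. -/
def Smooth (m : ℕ) : Submodule ℂ (Vec m → ℂ) where
  carrier := {f | ContDiff ℝ ∞ f}
  add_mem' {f g} hf hg := by
    have hf' : ContDiff ℝ ∞ f := hf
    exact hf'.add hg
  zero_mem' := by
    change ContDiff ℝ ∞ fun _ => (0 : ℂ)
    exact contDiff_const
  smul_mem' c f hf := by
    have hf' : ContDiff ℝ ∞ f := hf
    exact contDiff_const.smul hf'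

theorem smooth_contDiff (f : Smooth m) : ContDiff ℝ ∞ (f : Vec m → ℂ) := f.2

theorem smooth_differentiable (f : Smooth m) : Differentiable ℝ (f : Vec m → ℂ) :=
  (smooth_contDiff f).differentiable (by simp)

/-- The partial derivative `∂_i`. -/
def partialD (i : Fin m) : Smooth m →ₗ[ℂ] Smooth m where
  toFun f := ⟨fun x => fderiv ℝ (f : Vec m → ℂ) x (stdVec i),
    ((smooth_contDiff f).fderiv_right (m := ∞) (by simp)).clm_apply contDiff_const⟩
  map_add' f g := by
    ext x
    simp [fderiv_add (smooth_differentiable f x) (smooth_differentiable g x)]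
  map_smul' c f := by
    ext x
    simp [fderiv_const_smul (smooth_differentiable f x) c]

theorem partialD_apply (i : Fin m) (f : Smooth m) (x : Vec m) :
    (partialD i f : Vec m → ℂ) x = fderiv ℝ (f : Vec m → ℂ) x (stdVec i) := rfl

/-- Symmetry of second derivatives. It makes the partial derivatives generate a commutative algebra,
in which polynomials can be evaluated. -/
theorem partialD_comm (i j : Fin m) : partialD i * partialD j = partialD j * partialD i := by
  ext f x
  have hd : Differentiable ℝ (fderiv ℝ (f : Vec m → ℂ)) :=
    ((smooth_contDiff f).fderiv_right (m := ∞) (by simp)).differentiable (by simp)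
  have h : ∀ i j : Fin m, ((partialD i * partialD j) f : Vec m → ℂ) x =
      fderiv ℝ (fderiv ℝ (f : Vec m → ℂ)) x (stdVec i) (stdVec j) := by
    intro i j
    rw [Module.End.mul_apply, partialD_apply]
    have : ((partialD j f : Smooth m) : Vec m → ℂ) = fun x => fderiv ℝ (f : Vec m → ℂ) x (stdVec j) := rfl
    rw [this, fderiv_clm_apply (hd x) (by fun_prop)]
    simp
  rw [h, h]
  exact ((smooth_contDiff f).contDiffAt.isSymmSndFDerivAt (by simp; exact WithTop.coe_le_coe.2 le_top)) _ _

open scoped IsMulCommutative in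
/-- The constant coefficient differential operator with symbol `p`. -/
def diffPoly : MvPolynomial (Fin m) ℂ →ₐ[ℂ] Module.End ℂ (Smooth m) :=
  haveI := Algebra.isMulCommutative_adjoin ℂ (s := Set.range (partialD (m := m))) (by
    rintro _ ⟨i, rfl⟩ _ ⟨j, rfl⟩
    exact partialD_comm i j)
  (Subalgebra.val _).comp (MvPolynomial.aeval fun i =>
    (⟨partialD i, Algebra.subset_adjoin ⟨i, rfl⟩⟩ :
      Algebra.adjoin ℂ (Set.range (partialD (m := m)))))

@[simp] theorem diffPoly_X (i : Fin m) : diffPoly (MvPolynomial.X i) = partialD i := by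
  simp [diffPoly]

theorem diffPoly_C (c : ℂ) (f : Smooth m) : diffPoly (MvPolynomial.C c) f = c • f := by
  have : (MvPolynomial.C c : MvPolynomial (Fin m) ℂ) = algebraMap ℂ _ c := rfl
  rw [this, AlgHom.commutes]
  rfl

theorem diffPoly_mul (p q : MvPolynomial (Fin m) ℂ) (f : Smooth m) :
    diffPoly (p * q) f = diffPoly p (diffPoly q f) := by
  rw [map_mul, Module.End.mul_apply]

theorem diffPoly_prod_X (n : ℕ) (I : Fin n → Fin m) (f : Smooth m) (x : Vec m) :
    (diffPoly (∏ l, MvPolynomial.X (I l)) f : Vec m → ℂ) x =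
      iteratedFDeriv ℝ n (f : Vec m → ℂ) x fun l => stdVec (I l) := by
  induction n generalizing x with
  | zero => simp
  | succ n ih =>
    rw [Fin.prod_univ_succ, diffPoly_mul, diffPoly_X, partialD_apply, iteratedFDeriv_succ_apply_left]
    have h : ((diffPoly (∏ l : Fin n, MvPolynomial.X (I l.succ)) f : Smooth m) : Vec m → ℂ) =
        fun x => iteratedFDeriv ℝ n (f : Vec m → ℂ) x fun l => stdVec (I l.succ) :=
      funext fun x => ih _ x
    rw [h]
    have hd : DifferentiableAt ℝ (iteratedFDeriv ℝ n (f : Vec m → ℂ)) x :=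
      (smooth_contDiff f).differentiable_iteratedFDeriv (WithTop.coe_lt_coe.2 (WithTop.coe_lt_top _)) x
    rw [fderiv_continuousMultilinear_apply_const_apply hd]
    rfl

/-- Closure of a property of smooth functions under `diffPoly`. -/
theorem diffPoly_induction {C : Smooth m → Prop} (hadd : ∀ f g, C f → C g → C (f + g))
    (hsmul : ∀ (c : ℂ) f, C f → C (c • f)) (hd : ∀ i f, C f → C (partialD i f))
    (p : MvPolynomial (Fin m) ℂ) (f : Smooth m) (hf : C f) : C (diffPoly p f) := by
  induction p using MvPolynomial.induction_on generalizing f with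
  | C c => rw [diffPoly_C]; exact hsmul c f hf
  | add p q hp hq => rw [map_add, LinearMap.add_apply]; exact hadd _ _ (hp f hf) (hq f hf)
  | mul_X p i hp => rw [diffPoly_mul, diffPoly_X]; exact hp _ (hd i f hf)

theorem diffPoly_eventuallyEq_zero (p : MvPolynomial (Fin m) ℂ) (f : Smooth m) (y : Vec m)
    (hf : (f : Vec m → ℂ) =ᶠ[nhds y] 0) : (diffPoly p f : Vec m → ℂ) =ᶠ[nhds y] 0 := by
  refine diffPoly_induction (C := fun f => (f : Vec m → ℂ) =ᶠ[nhds y] 0) ?_ ?_ ?_ p f hf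
  · intro f g hf hg
    simpa using hf.add hg
  · intro c f hf
    filter_upwards [hf] with x hx
    simp [hx]
  · intro i f hf
    filter_upwards [hf.fderiv (𝕜 := ℝ)] with x hx
    rw [partialD_apply, hx]
    simp

theorem diffPoly_congr (p : MvPolynomial (Fin m) ℂ) {f g : Smooth m} {y : Vec m}
    (hf : (f : Vec m → ℂ) =ᶠ[nhds y] g) :
    (diffPoly p f : Vec m → ℂ) y = (diffPoly p g : Vec m → ℂ) y := by
  have := (diffPoly_eventuallyEq_zero p (f - g) y (by
    filter_upwards [hf] with x hx
    simp [hx])).self_of_nhds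
  rw [map_sub] at this
  simpa [sub_eq_zero] using this

/-- Smooth functions vanishing off a set `K`. -/
def VanishOff (K : Set (Vec m)) (f : Smooth m) : Prop := ∀ x ∉ K, (f : Vec m → ℂ) x = 0

theorem VanishOff.diffPoly {K : Set (Vec m)} (hK : IsClosed K) (p : MvPolynomial (Fin m) ℂ)
    {f : Smooth m} (hf : VanishOff K f) : VanishOff K (diffPoly p f) := fun x hx =>
  (diffPoly_eventuallyEq_zero p f x (by
    filter_upwards [hK.isOpen_compl.mem_nhds hx] with z hz using hf z hz)).self_of_nhds

theorem VanishOff.hasCompactSupport {K : Set (Vec m)} (hK : IsCompact K) {f : Smooth m}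
    (hf : VanishOff K f) : HasCompactSupport (f : Vec m → ℂ) :=
  HasCompactSupport.intro hK hf

/-- The exponential `x ↦ exp ⟨ξ, x⟩`. -/
def expFun (ξ : Fin m → ℂ) : Smooth m :=
  ⟨fun x => Complex.exp (∑ i, ξ i * (x i : ℂ)), by
    have : ∀ i : Fin m, ContDiff ℝ ∞ fun x : Vec m => ((x i : ℝ) : ℂ) := fun i =>
      Complex.ofRealCLM.contDiff.comp (EuclideanSpace.proj (𝕜 := ℝ) i).contDiff
    change ContDiff ℝ ∞ _
    fun_prop⟩

theorem partialD_expFun (i : Fin m) (ξ : Fin m → ℂ) : partialD i (expFun ξ) = ξ i • expFun ξ := by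
  ext x
  rw [partialD_apply]
  have h : ∀ i : Fin m, HasFDerivAt (fun x : Vec m => ((x i : ℝ) : ℂ))
      (Complex.ofRealCLM.comp (EuclideanSpace.proj (𝕜 := ℝ) i)) x := fun i =>
    (Complex.ofRealCLM.comp (EuclideanSpace.proj (𝕜 := ℝ) i)).hasFDerivAt
  have h1 : HasFDerivAt (expFun ξ : Vec m → ℂ) _ x :=
    (HasFDerivAt.fun_sum (u := Finset.univ) fun i _ => (h i).const_mul (ξ i)).cexp
  rw [h1.fderiv]
  simp [expFun, stdVec, mul_comm, apply_ite]

theorem diffPoly_expFun (p : MvPolynomial (Fin m) ℂ) (ξ : Fin m → ℂ) :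
    diffPoly p (expFun ξ) = MvPolynomial.eval ξ p • expFun ξ := by
  induction p using MvPolynomial.induction_on with
  | C c => simp
  | add p q hp hq => simp [hp, hq, add_smul]
  | mul_X p i hp => simp [partialD_expFun, hp, smul_smul, mul_comm]

/-- A polynomial whose operator kills all test functions near a point is zero. -/
theorem eq_zero_of_diffPoly_eq_zero (p : MvPolynomial (Fin m) ℂ) (y : Vec m) {r : ℝ} (hr : 0 < r)
    (h : ∀ φ : Smooth m, VanishOff (Metric.closedBall y r) φ →
      (diffPoly p φ : Vec m → ℂ) y = 0) : p = 0 := by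
  refine MvPolynomial.funext fun ξ => ?_
  -- The test function is an exponential cut off near y. Where the cut-off is 1 the operator
  -- multiplies it by p(ξ), so p vanishes at every ξ.
  let χ : ContDiffBump y := ⟨r / 2, r, by positivity, by linarith⟩
  have hχ : ContDiff ℝ ∞ fun x => ((χ x : ℝ) : ℂ) := Complex.ofRealCLM.contDiff.comp χ.contDiff
  let φ : Smooth m := ⟨fun x => (χ x : ℂ) * (expFun ξ : Vec m → ℂ) x, hχ.mul (smooth_contDiff (expFun ξ))⟩
  have h1 : VanishOff (Metric.closedBall y r) φ := by
    intro x hx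
    have : χ x = 0 := χ.zero_of_le_dist (by simpa using (not_le.1 hx).le)
    simp [φ, this]
  have h2 : (φ : Vec m → ℂ) =ᶠ[nhds y] expFun ξ := by
    filter_upwards [χ.eventuallyEq_one] with x hx
    simp [φ, hx]
  have h3 := h φ h1
  rw [diffPoly_congr p h2, diffPoly_expFun] at h3
  have h4 : (expFun ξ : Vec m → ℂ) y ≠ 0 := Complex.exp_ne_zero _
  simpa [h4] using h3

end SmoothFunctions

end HigherSpin

namespace HigherSpin

variable {m : ℕ}

/-! ### Convolution with a locally integrable kernel. -/

section Convolution

/-- Convolution of a kernel with a function. -/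
def conv (e φ : Vec m → ℂ) (x : Vec m) : ℂ := ∫ t, e t * φ (x - t)

open scoped Classical in
/-- Convolution as a smooth function, whenever it is one. -/
def convS (e : Vec m → ℂ) (φ : Smooth m) : Smooth m :=
  if h : ContDiff ℝ ∞ (conv e φ) then ⟨conv e φ, h⟩ else 0

variable {e : Vec m → ℂ} {φ ψ : Smooth m}

theorem conv_eq_convolution (e φ : Vec m → ℂ) :
    conv e φ = convolution e φ (ContinuousLinearMap.mul ℝ ℂ) volume := rfl

theorem coe_convS (he : LocallyIntegrable e) (hφ : HasCompactSupport (φ : Vec m → ℂ)) :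
    (convS e φ : Vec m → ℂ) = conv e φ := by
  have h : ContDiff ℝ ∞ (conv e φ) :=
    hφ.contDiff_convolution_right (ContinuousLinearMap.mul ℝ ℂ) he (smooth_contDiff φ)
  rw [convS, dif_pos h]

theorem integrable_conv (he : LocallyIntegrable e) (hφ : HasCompactSupport (φ : Vec m → ℂ))
    (x : Vec m) : Integrable fun t => e t * (φ : Vec m → ℂ) (x - t) :=
  hφ.convolutionExists_right (ContinuousLinearMap.mul ℝ ℂ) he (smooth_contDiff φ).continuous x

theorem convS_add (he : LocallyIntegrable e) (hφ : HasCompactSupport (φ : Vec m → ℂ))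
    (hψ : HasCompactSupport (ψ : Vec m → ℂ)) : convS e (φ + ψ) = convS e φ + convS e ψ := by
  ext x
  have h : HasCompactSupport ((φ + ψ : Smooth m) : Vec m → ℂ) := hφ.add hψ
  rw [coe_convS he h, Submodule.coe_add, Submodule.coe_add, Pi.add_apply, coe_convS he hφ,
    coe_convS he hψ, conv, conv, conv, ← integral_add (integrable_conv he hφ x) (integrable_conv he hψ x)]
  simp [mul_add]

theorem convS_smul (he : LocallyIntegrable e) (hφ : HasCompactSupport (φ : Vec m → ℂ)) (c : ℂ) :
    convS e (c • φ) = c • convS e φ := by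
  ext x
  have h : HasCompactSupport ((c • φ : Smooth m) : Vec m → ℂ) := hφ.smul_left (f := fun _ => c)
  rw [coe_convS he h, Submodule.coe_smul, Submodule.coe_smul, Pi.smul_apply, coe_convS he hφ, conv, conv, smul_eq_mul,
    ← integral_const_mul]
  congr 1
  ext t
  simp
  ring

theorem partialD_convS (he : LocallyIntegrable e) {K : Set (Vec m)} (hK : IsCompact K)
    (hφ : VanishOff K φ) (i : Fin m) : partialD i (convS e φ) = convS e (partialD i φ) := by
  ext x
  have hφc := hφ.hasCompactSupport hK
  have hdφ : VanishOff K (partialD i φ) := by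
    simpa using hφ.diffPoly hK.isClosed (MvPolynomial.X i)
  rw [partialD_apply, coe_convS he hφc, coe_convS he (hdφ.hasCompactSupport hK),
    conv_eq_convolution]
  have h1 : ContDiff ℝ 1 (φ : Vec m → ℂ) := (smooth_contDiff φ).of_le (by simp)
  rw [(hφc.hasFDerivAt_convolution_right (ContinuousLinearMap.mul ℝ ℂ) he h1 x).fderiv,
    convolution_precompR_apply _ he (hφc.fderiv ℝ) (h1.continuous_fderiv one_ne_zero)]
  rfl

/-- All derivatives fall on the smooth factor, so no regularity of the kernel beyond local
integrability is needed. -/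
theorem diffPoly_convS (he : LocallyIntegrable e) {K : Set (Vec m)} (hK : IsCompact K)
    (hφ : VanishOff K φ) (p : MvPolynomial (Fin m) ℂ) :
    diffPoly p (convS e φ) = convS e (diffPoly p φ) := by
  induction p using MvPolynomial.induction_on generalizing φ with
  | C c => rw [diffPoly_C, diffPoly_C, convS_smul he (hφ.hasCompactSupport hK)]
  | add p q hp hq =>
    rw [map_add, LinearMap.add_apply, LinearMap.add_apply, hp hφ, hq hφ,
      convS_add he ((hφ.diffPoly hK.isClosed p).hasCompactSupport hK)
        ((hφ.diffPoly hK.isClosed q).hasCompactSupport hK)]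
  | mul_X p i hp =>
    have h := hφ.diffPoly hK.isClosed (MvPolynomial.X i)
    rw [diffPoly_X] at h
    rw [diffPoly_mul, diffPoly_mul, diffPoly_X, partialD_convS he hK hφ, hp h]

end Convolution

/-! ### Matrix symbols and fundamental solutions. -/

section Symbol

variable {ι : Type*} [Fintype ι] [DecidableEq ι]

/-- `E` is a (matrix-valued) fundamental solution of the operator with symbol matrix `P`. -/
structure IsFundamental (P : Matrix ι ι (MvPolynomial (Fin m) ℂ)) (E : ι → ι → Vec m → ℂ) :
    Prop where
  locallyIntegrable : ∀ α γ, LocallyIntegrable (E α γ)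
  eq : ∀ φ : Smooth m, HasCompactSupport (φ : Vec m → ℂ) → ∀ β γ,
    ∑ α, diffPoly (P β α) (convS (E α γ) φ) = if β = γ then φ else 0

variable {P : Matrix ι ι (MvPolynomial (Fin m) ℂ)} {E : ι → ι → Vec m → ℂ}

/-- This is P E = δ composed on the left with the row r of operators. -/
theorem IsFundamental.sum_row (hE : IsFundamental P E) (r : ι → MvPolynomial (Fin m) ℂ)
    {φ : Smooth m} (hφ : HasCompactSupport (φ : Vec m → ℂ)) (γ : ι) :
    ∑ α, diffPoly (Matrix.vecMul r P α) (convS (E α γ) φ) = diffPoly (r γ) φ := by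
  calc ∑ α, diffPoly (Matrix.vecMul r P α) (convS (E α γ) φ)
      = ∑ α, ∑ β, diffPoly (r β) (diffPoly (P β α) (convS (E α γ) φ)) := by
        refine Finset.sum_congr rfl fun α _ => ?_
        rw [Matrix.vecMul, dotProduct, map_sum, LinearMap.sum_apply]
        exact Finset.sum_congr rfl fun β _ => diffPoly_mul _ _ _
    _ = ∑ β, diffPoly (r β) (if β = γ then φ else 0) := by
        rw [Finset.sum_comm]
        refine Finset.sum_congr rfl fun β _ => ?_
        rw [← map_sum, hE.eq φ hφ]
    _ = _ := by
        simp only [apply_ite (diffPoly (r _)), map_zero]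
        rw [Finset.sum_eq_single γ]
        · simp
        · intro β _ hβ
          simp [hβ]
        · simp

/-- A singular P over an integral domain has a nonzero row r with r P = 0; by `sum_row` every entry
of r would annihilate all test functions, hence vanish. -/
theorem IsFundamental.det_ne_zero (hE : IsFundamental P E) : P.det ≠ 0 := by
  intro h
  obtain ⟨r, hr0, hr⟩ := Matrix.exists_vecMul_eq_zero_iff.2 h
  refine hr0 (funext fun γ => eq_zero_of_diffPoly_eq_zero _ (0 : Vec m) one_pos fun φ hφ => ?_)
  rw [← hE.sum_row r (hφ.hasCompactSupport (isCompact_closedBall _ _)) γ, hr]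
  simp

/-- No nonzero constant coefficient operator kills all convolutions with a fundamental solution. -/
theorem IsFundamental.eq_zero_of_row (hE : IsFundamental P E) (p : ι → MvPolynomial (Fin m) ℂ)
    (y : Vec m) {r : ℝ} (hr : 0 < r)
    (h : ∀ γ, ∀ φ : Smooth m, VanishOff (Metric.closedBall y r) φ →
      (((∑ α, diffPoly (p α) (convS (E α γ) φ) : Smooth m) : Vec m → ℂ) y) = 0) : p = 0 := by
  have hK := isCompact_closedBall y r
  have h1 : Matrix.vecMul p P.adjugate = 0 := by
    refine funext fun γ => eq_zero_of_diffPoly_eq_zero _ y hr fun φ hφ => ?_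
    -- Test on det P(∂)φ. Moving det P(∂) onto E * φ and writing det P as adj P · P turns the
    -- convolution into adj P(∂)φ.
    have h2 := h γ _ (hφ.diffPoly hK.isClosed P.det)
    rw [← h2, Matrix.vecMul, dotProduct]
    rw [map_sum, LinearMap.sum_apply]
    refine congrArg (fun f : Smooth m => (f : Vec m → ℂ) y) (Finset.sum_congr rfl fun α _ => ?_)
    rw [diffPoly_mul, ← diffPoly_convS (hE.locallyIntegrable α γ) hK hφ]
    congr 1
    rw [← hE.sum_row (P.adjugate α) (hφ.hasCompactSupport hK) γ]
    have h3 : Matrix.vecMul (P.adjugate α) P = fun α' => if α = α' then P.det else 0 := by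
      have := congrFun (Matrix.adjugate_mul P) α
      funext α'
      have := congrFun this α'
      simpa [Matrix.mul_apply, Matrix.vecMul, dotProduct, Matrix.one_apply] using this
    rw [h3, Finset.sum_eq_single α]
    · simp
    · intro b _ hb
      simp [hb.symm]
    · simp
  have h2 : Matrix.vecMul (Matrix.vecMul p P.adjugate) P = P.det • p := by
    rw [Matrix.vecMul_vecMul, Matrix.adjugate_mul, Matrix.vecMul_smul, Matrix.vecMul_one]
  rw [h1, Matrix.zero_vecMul] at h2
  exact (smul_eq_zero.1 h2.symm).resolve_left hE.det_ne_zero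

end Symbol

end HigherSpin

namespace HigherSpin

variable {m : ℕ}

/-! ### Functionals that depend on a finite jet. -/

section Jets

/-- All derivatives of `f` of order at most `N` vanish at `y`. -/
def IsFlat (N : ℕ) (f : Smooth m) (y : Vec m) : Prop :=
  ∀ n ≤ N, iteratedFDeriv ℝ n (f : Vec m → ℂ) y = 0

theorem exists_flat_imp_diffPoly (p : MvPolynomial (Fin m) ℂ) : ∃ N : ℕ, ∀ (f : Smooth m)
    (y : Vec m), IsFlat N f y → (diffPoly p f : Vec m → ℂ) y = 0 := by
  -- The trailing monomial makes the induction close: it absorbs each new variable, until a constant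
  -- remains and `diffPoly_prod_X` applies.
  suffices H : ∀ (k : ℕ) (J : Fin k → Fin m), ∃ N : ℕ, ∀ (f : Smooth m) (y : Vec m),
      IsFlat N f y →
        (diffPoly (p * ∏ l, MvPolynomial.X (J l)) f : Vec m → ℂ) y = 0 by
    simpa using H 0 Fin.elim0
  induction p using MvPolynomial.induction_on with
  | C c =>
    refine fun k J => ⟨k, fun f y hf => ?_⟩
    rw [diffPoly_mul, diffPoly_C, Submodule.coe_smul, Pi.smul_apply, diffPoly_prod_X, hf k le_rfl]
    simp
  | add p q hp hq =>
    intro k J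
    obtain ⟨N₁, h₁⟩ := hp k J
    obtain ⟨N₂, h₂⟩ := hq k J
    refine ⟨max N₁ N₂, fun f y hf => ?_⟩
    rw [add_mul, map_add, LinearMap.add_apply, Submodule.coe_add, Pi.add_apply,
      h₁ f y fun n hn => hf n (hn.trans (le_max_left _ _)),
      h₂ f y fun n hn => hf n (hn.trans (le_max_right _ _)), add_zero]
  | mul_X p i hp =>
    intro k J
    obtain ⟨N, h⟩ := hp (k + 1) (Fin.cons i J)
    refine ⟨N, fun f y hf => ?_⟩
    have := h f y hf
    rwa [Fin.prod_univ_succ, ← mul_assoc] at this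

theorem isFlat_of_forall {N : ℕ} {f : Smooth m} {y : Vec m}
    (h : ∀ n ≤ N, ∀ I : Fin n → Fin m,
      (diffPoly (∏ l, MvPolynomial.X (I l)) f : Vec m → ℂ) y = 0) : IsFlat N f y := by
  intro n hn
  ext v
  have : (iteratedFDeriv ℝ n (f : Vec m → ℂ) y).toMultilinearMap = 0 := by
    refine Module.Basis.ext_multilinear (fun _ => (EuclideanSpace.basisFun (Fin m) ℝ).toBasis) ?_
    intro I
    have h2 := h n hn I
    rw [diffPoly_prod_X] at h2
    simpa [stdVec] using h2
  exact congrArg (fun T : MultilinearMap ℝ (fun _ : Fin n => Vec m) ℂ => T v) this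

/-- A functional depending only on a finite jet is given by a constant coefficient operator. -/
theorem exists_symbol (L : Smooth m →ₗ[ℂ] ℂ) (y : Vec m) (N : ℕ)
    (hL : ∀ f, IsFlat N f y → L f = 0) :
    ∃ p : MvPolynomial (Fin m) ℂ, ∀ f, L f = (diffPoly p f : Vec m → ℂ) y := by
  let ev : MvPolynomial (Fin m) ℂ →ₗ[ℂ] Smooth m →ₗ[ℂ] ℂ :=
    { toFun := fun p => (LinearMap.proj y ∘ₗ (Smooth m).subtype) ∘ₗ diffPoly p
      map_add' := fun p q => by ext f; simp
      map_smul' := fun c p => by ext f; simp }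
  let K : (Σ n : Fin (N + 1), Fin n → Fin m) → Smooth m →ₗ[ℂ] ℂ := fun I =>
    ev (∏ l, MvPolynomial.X (I.2 l))
  -- Finitely many partial derivatives at y control the jet. A functional vanishing on their common
  -- kernel is a linear combination of them.
  have h1 : L ∈ Submodule.span ℂ (Set.range K) := by
    refine mem_span_of_iInf_ker_le_ker fun f hf => ?_
    simp only [Submodule.mem_iInf, LinearMap.mem_ker] at hf ⊢
    exact hL f (isFlat_of_forall fun n hn I => hf ⟨⟨n, Nat.lt_succ_of_le hn⟩, I⟩)
  have h2 : Submodule.span ℂ (Set.range K) ≤ LinearMap.range ev := by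
    rw [Submodule.span_le]
    rintro _ ⟨I, rfl⟩
    exact ⟨_, rfl⟩
  obtain ⟨p, hp⟩ := h2 h1
  exact ⟨p, fun f => by rw [← hp]; rfl⟩

/-- Weighted pull-back of functions. -/
def pull (w : Vec m → ℂ) (e : Vec m → Vec m)
    (h : ∀ f : Smooth m, ContDiff ℝ ∞ fun x => w x * (f : Vec m → ℂ) (e x)) :
    Smooth m →ₗ[ℂ] Smooth m where
  toFun f := ⟨fun x => w x * (f : Vec m → ℂ) (e x), h f⟩
  map_add' f g := by ext x; simp [mul_add]
  map_smul' c f := by ext x; simp [mul_left_comm]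

/-- By the chain rule and Leibniz's rule, each derivative of the pull-back up to order N is linear
in derivatives of f of no higher order at the image point. -/
theorem isFlat_pull {w : Vec m → ℂ} {e : Vec m → Vec m}
    (h : ∀ f : Smooth m, ContDiff ℝ ∞ fun x => w x * (f : Vec m → ℂ) (e x)) {U : Set (Vec m)}
    (hU : IsOpen U) (hw : ContDiffOn ℝ ∞ w U) (he : ContDiffOn ℝ ∞ e U) {y : Vec m} (hy : y ∈ U)
    {N : ℕ} {f : Smooth m} (hf : IsFlat N f (e y)) : IsFlat N (pull w e h f) y := by
  have hle : ∀ n : ℕ, (n : ℕ∞ω) ≤ ∞ := fun n => by exact_mod_cast le_top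
  have hcomp : ∀ n ≤ N, iteratedFDerivWithin ℝ n ((f : Vec m → ℂ) ∘ e) U y = 0 := by
    intro n hn
    -- The composition bound requires the i-th derivative of e to be at most D ^ i; the summand 1
    -- ensures D ≤ D ^ i for i ≥ 1. With `C = 0` the bound then gives zero.
    let D : ℝ := 1 + ∑ i ∈ Finset.range (n + 1), ‖iteratedFDerivWithin ℝ i e U y‖
    have hsum : 0 ≤ ∑ i ∈ Finset.range (n + 1), ‖iteratedFDerivWithin ℝ i e U y‖ :=
      Finset.sum_nonneg fun _ _ => norm_nonneg _
    have hD1 : 1 ≤ D := by simp only [D]; linarith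
    have := norm_iteratedFDerivWithin_comp_le (n := n) (C := 0) (D := D) (t := Set.univ)
      (smooth_contDiff f).contDiffOn he (hle n) uniqueDiffOn_univ hU.uniqueDiffOn
      (Set.mapsTo_univ _ _) hy (fun i hi => by
        rw [iteratedFDerivWithin_univ, hf i (hi.trans hn), norm_zero])
      (fun i h1 hi => by
        refine le_trans ?_ (le_self_pow₀ hD1 (Nat.one_le_iff_ne_zero.1 h1))
        have := Finset.single_le_sum (f := fun i => ‖iteratedFDerivWithin ℝ i e U y‖)
          (fun _ _ => norm_nonneg _) (Finset.mem_range.2 (Nat.lt_succ_of_le hi))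
        simp only [D]
        linarith)
    simpa using this
  intro n hn
  have h1 := norm_iteratedFDerivWithin_mul_le hw ((smooth_contDiff f).comp_contDiffOn he)
    hU.uniqueDiffOn hy (hle n)
  rw [Finset.sum_eq_zero] at h1
  · rw [← iteratedFDerivWithin_of_isOpen n hU hy]
    exact norm_le_zero_iff.1 h1
  · intro i hi
    rw [hcomp (n - i) ((Nat.sub_le _ _).trans hn)]
    simp

end Jets

end HigherSpin

namespace HigherSpin

variable {m : ℕ}

/-! ### Covariance under intertwiners of the fundamental solution. -/

section Covariance

/-- Extension by zero of a function that is smooth on an open set and vanishes there off a compact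
subset. -/
theorem contDiff_indicator_of_compact {U K : Set (Vec m)} (hU : IsOpen U) (hK : IsCompact K)
    (hKU : K ⊆ U) {g : Vec m → ℂ} (hg : ContDiffOn ℝ ∞ g U) (h0 : ∀ x ∈ U, x ∉ K → g x = 0) :
    ContDiff ℝ ∞ (U.indicator g) := by
  rw [contDiff_iff_contDiffAt]
  intro x
  by_cases hx : x ∈ U
  · refine (hg.contDiffAt (hU.mem_nhds hx)).congr_of_eventuallyEq ?_
    filter_upwards [hU.mem_nhds hx] with z hz
    rw [Set.indicator_of_mem hz]
  · have hxK : x ∉ K := fun h => hx (hKU h)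
    refine (contDiffAt_const (c := (0 : ℂ))).congr_of_eventuallyEq ?_
    filter_upwards [hK.isClosed.isOpen_compl.mem_nhds hxK] with z hz
    by_cases hzU : z ∈ U
    · rw [Set.indicator_of_mem hzU, h0 z hzU hz]
    · rw [Set.indicator_of_notMem hzU]

variable {ι : Type*} [Fintype ι]

/-- A local diffeomorphism together with matrix weights that intertwine the kernel `E`. -/
structure IsIntertwiner (E : ι → ι → Vec m → ℂ) (e : OpenPartialHomeomorph (Vec m) (Vec m))
    (G H : ι → ι → Vec m → ℂ) : Prop where
  contDiffOn : ContDiffOn ℝ ∞ e e.source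
  contDiffOn_left : ∀ α β, ContDiffOn ℝ ∞ (G α β) e.source
  contDiffOn_right : ∀ α β, ContDiffOn ℝ ∞ (H α β) e.source
  eq : ∀ x ∈ e.source, ∀ z ∈ e.source, x ≠ z → ∀ β γ,
    ((|(fderiv ℝ e z).det| : ℝ) : ℂ) * ∑ α, G β α x * E α γ (e x - e z) =
      ∑ α, E β α (x - z) * H α γ z

variable {P : Matrix ι ι (MvPolynomial (Fin m) ℂ)} {E : ι → ι → Vec m → ℂ}
  {e : OpenPartialHomeomorph (Vec m) (Vec m)} {G H : ι → ι → Vec m → ℂ}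

/-- The source of a convolution transforms with the right weight. -/
def transport (e : OpenPartialHomeomorph (Vec m) (Vec m)) (w φ : Vec m → ℂ) : Vec m → ℂ :=
  e.source.indicator fun z => w z * φ (e z)

theorem IsIntertwiner.exists_transport (hI : IsIntertwiner E e G H) {K : Set (Vec m)}
    (hK : IsCompact K) (hKt : K ⊆ e.target) {φ : Smooth m} (hφ : VanishOff K φ) (α γ : ι) :
    ∃ k : Smooth m, (k : Vec m → ℂ) = transport e (H α γ) φ ∧
      HasCompactSupport (k : Vec m → ℂ) := by
  have hK' : IsCompact (e.symm '' K) := hK.image_of_continuousOn (e.continuousOn_symm.mono hKt)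
  have hsub : e.symm '' K ⊆ e.source := by
    rintro _ ⟨z, hz, rfl⟩
    exact e.map_target (hKt hz)
  have h0 : ∀ x ∈ e.source, x ∉ e.symm '' K → H α γ x * (φ : Vec m → ℂ) (e x) = 0 := by
    intro x hx hxK
    rw [hφ (e x) fun h => hxK ⟨e x, h, e.left_inv hx⟩, mul_zero]
  refine ⟨⟨transport e (H α γ) φ, contDiff_indicator_of_compact e.open_source hK' hsub
    ((hI.contDiffOn_right α γ).mul ((smooth_contDiff φ).comp_contDiffOn hI.contDiffOn)) h0⟩, rfl, ?_⟩
  refine HasCompactSupport.intro hK' fun x hx => ?_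
  change transport e (H α γ) φ x = 0
  by_cases hxs : x ∈ e.source
  · rw [transport, Set.indicator_of_mem hxs, h0 x hxs hx]
  · rw [transport, Set.indicator_of_notMem hxs]

theorem conv_swap (f φ : Vec m → ℂ) (x : Vec m) : conv f φ x = ∫ z, f (x - z) * φ z := by
  rw [conv, ← integral_sub_left_eq_self _ _ x]
  simp

/-- Substitute e z for the variable of integration in (E * φ)(e x); the Jacobian that appears is the
one in the intertwining identity, which moves the weight from x to the source. -/
theorem IsIntertwiner.sum_conv (hm : 1 ≤ m) (hI : IsIntertwiner E e G H)
    (hE : ∀ α γ, LocallyIntegrable (E α γ)) {K : Set (Vec m)}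
    (hK : IsCompact K) (hKt : K ⊆ e.target) {φ : Smooth m} (hφ : VanishOff K φ) (γ : ι)
    {x : Vec m} (hx : x ∈ e.source) (β : ι) :
    ∑ α, G β α x * conv (E α γ) φ (e x) = ∑ α, conv (E β α) (transport e (H α γ) φ) x := by
  have hφc := hφ.hasCompactSupport hK
  have hd : ∀ z ∈ e.source, HasFDerivAt e (fderiv ℝ e z) z := fun z hz =>
    ((hI.contDiffOn.contDiffAt (e.open_source.mem_nhds hz)).differentiableAt
      (by simp)).hasFDerivAt
  have hint : ∀ α, Integrable fun z => E α γ (e x - z) * (φ : Vec m → ℂ) z := fun α => by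
    simpa using (integrable_conv (hE α γ) hφc (e x)).comp_sub_left (e x)
  have hint' : ∀ α, IntegrableOn (fun z => |(fderiv ℝ e z).det| •
      (E α γ (e x - e z) * (φ : Vec m → ℂ) (e z))) e.source := fun α => by
    rw [← integrableOn_image_iff_integrableOn_abs_det_fderiv_smul volume
      e.open_source.measurableSet (fun z hz => (hd z hz).hasFDerivWithinAt) e.injOn
      (fun z => E α γ (e x - z) * (φ : Vec m → ℂ) z)]
    exact (hint α).integrableOn
  have h1 : ∀ α, conv (E α γ) φ (e x) = ∫ z in e.source, |(fderiv ℝ e z).det| •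
      (E α γ (e x - e z) * (φ : Vec m → ℂ) (e z)) := by
    intro α
    rw [conv_swap, ← integral_target_eq_integral_abs_det_fderiv_smul volume hd
      (fun z => E α γ (e x - z) * (φ : Vec m → ℂ) z), setIntegral_eq_integral_of_forall_compl_eq_zero]
    intro z hz
    rw [hφ z fun h => hz (hKt h), mul_zero]
  have h2 : ∀ α, conv (E β α) (transport e (H α γ) φ) x =
      ∫ z in e.source, E β α (x - z) * (H α γ z * (φ : Vec m → ℂ) (e z)) := by
    intro α
    rw [conv_swap, ← integral_indicator e.open_source.measurableSet]
    congr 1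
    ext z
    rw [transport]
    by_cases hz : z ∈ e.source <;> simp [hz]
  have hint2 : ∀ α, IntegrableOn (fun z => E β α (x - z) * (H α γ z * (φ : Vec m → ℂ) (e z)))
      e.source := by
    intro α
    obtain ⟨k, hk, hkc⟩ := hI.exists_transport hK hKt hφ α γ
    have h3 : Integrable fun z => E β α (x - z) * (k : Vec m → ℂ) z := by
      simpa using (integrable_conv (hE β α) hkc x).comp_sub_left x
    refine h3.integrableOn.congr_fun (fun z hz => ?_) e.open_source.measurableSet
    simp only [hk, transport, Set.indicator_of_mem hz]
  simp only [h1, h2]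
  rw [← integral_finsetSum _ fun α _ => hint2 α]
  simp only [← integral_const_mul]
  rw [← integral_finsetSum _ fun α _ => (hint' α).const_mul (G β α x)]
  have : Nonempty (Fin m) := ⟨⟨0, hm⟩⟩
  -- The intertwining identity excludes the diagonal z = x, a null set because m ≥ 1.
  have hne : ∀ᵐ z : Vec m ∂(volume.restrict e.source), z ≠ x :=
    ae_restrict_of_ae (by simp [ae_iff])
  refine integral_congr_ae ?_
  filter_upwards [hne, ae_restrict_mem e.open_source.measurableSet] with z hzx hz
  calc ∑ α, G β α x * |(fderiv ℝ e z).det| • (E α γ (e x - e z) * (φ : Vec m → ℂ) (e z))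
      = (((|(fderiv ℝ e z).det| : ℝ) : ℂ) * ∑ α, G β α x * E α γ (e x - e z)) *
          (φ : Vec m → ℂ) (e z) := by
        rw [Finset.mul_sum, Finset.sum_mul]
        refine Finset.sum_congr rfl fun α _ => ?_
        rw [Complex.real_smul]
        ring
    _ = _ := by
        rw [hI.eq x hx z hz hzx.symm, Finset.sum_mul]
        exact Finset.sum_congr rfl fun α _ => by ring

theorem exists_cutoff {U : Set (Vec m)} (hU : IsOpen U) {y : Vec m} (hy : y ∈ U) :
    ∃ (χ : Vec m → ℂ) (K : Set (Vec m)), ContDiff ℝ ∞ χ ∧ IsCompact K ∧ K ⊆ U ∧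
      (∀ x ∉ K, χ x = 0) ∧ χ =ᶠ[nhds y] 1 := by
  obtain ⟨r, hr, hrU⟩ := Metric.nhds_basis_closedBall.mem_iff.1 (hU.mem_nhds hy)
  let χ : ContDiffBump y := ⟨r / 2, r, by positivity, by linarith⟩
  refine ⟨fun x => ((χ x : ℝ) : ℂ), _, Complex.ofRealCLM.contDiff.comp χ.contDiff,
    isCompact_closedBall y r, hrU, fun x hx => ?_, ?_⟩
  · have : χ x = 0 := χ.zero_of_le_dist (by simpa using (not_le.1 hx).le)
    simp [this]
  · filter_upwards [χ.eventuallyEq_one] with x hx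
    simp [hx]

variable [DecidableEq ι]

/-- An operator is covariant under every intertwiner of its fundamental solution. -/
theorem IsFundamental.covariance (hm : 1 ≤ m) (hE : IsFundamental P E)
    (hI : IsIntertwiner E e G H) {y : Vec m} (hy : y ∈ e.source) (f g : ι → Smooth m)
    (hg : ∀ β, (g β : Vec m → ℂ) =ᶠ[nhds y] fun x => ∑ α, G β α x * (f α : Vec m → ℂ) (e x))
    (δ : ι) :
    ∑ γ, H δ γ y * ∑ α, (diffPoly (P γ α) (f α) : Vec m → ℂ) (e y) =
      ∑ β, (diffPoly (P δ β) (g β) : Vec m → ℂ) y := by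
  obtain ⟨χ, K₀, hχ, hK₀, hK₀s, hχ0, hχ1⟩ := exists_cutoff e.open_source hy
  have hw : ∀ β α, ContDiffOn ℝ ∞ (fun x => χ x * G β α x) e.source := fun β α =>
    hχ.contDiffOn.mul (hI.contDiffOn_left β α)
  -- Cut off and extended by zero, the weight gives a pull-back on globally smooth functions.
  -- Differential operators are local, so values at y are unaffected.
  let w : ι → ι → Vec m → ℂ := fun β α => e.source.indicator fun x => χ x * G β α x
  have hws : ∀ β α, ContDiffOn ℝ ∞ (w β α) e.source := fun β α =>
    (hw β α).congr fun x hx => by simp only [w, Set.indicator_of_mem hx]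
  have hpull : ∀ β α, ∀ f : Smooth m,
      ContDiff ℝ ∞ fun x => w β α x * (f : Vec m → ℂ) (e x) := by
    intro β α f
    have := contDiff_indicator_of_compact e.open_source hK₀ hK₀s
      ((hw β α).mul ((smooth_contDiff f).comp_contDiffOn hI.contDiffOn))
      (fun x _ hx => by simp [hχ0 x hx])
    convert this using 2 with x
    by_cases hx : x ∈ e.source <;> simp [w, hx]
  let T : ι → ι → Smooth m →ₗ[ℂ] Smooth m := fun β α => pull (w β α) e (hpull β α)
  have hT : ∀ (f : ι → Smooth m) β, ((∑ α, T β α (f α) : Smooth m) : Vec m → ℂ) =ᶠ[nhds y]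
      fun x => ∑ α, G β α x * (f α : Vec m → ℂ) (e x) := by
    intro f β
    filter_upwards [hχ1, e.open_source.mem_nhds hy] with x hx hxs
    simp [T, pull, w, hxs, hx]
  let ev : Vec m → Smooth m →ₗ[ℂ] ℂ := fun x => LinearMap.proj x ∘ₗ (Smooth m).subtype
  -- The difference of the two sides at y, split according to the components of f.
  let L : ι → Smooth m →ₗ[ℂ] ℂ := fun α =>
    ∑ γ, H δ γ y • (ev (e y) ∘ₗ diffPoly (P γ α)) - ∑ β, ev y ∘ₗ diffPoly (P δ β) ∘ₗ T β α
  have hL : ∀ f : ι → Smooth m, ∑ α, L α (f α) =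
      ∑ γ, H δ γ y * ∑ α, (diffPoly (P γ α) (f α) : Vec m → ℂ) (e y) -
      ∑ β, (diffPoly (P δ β) (∑ α, T β α (f α)) : Vec m → ℂ) y := by
    intro f
    simp only [L, LinearMap.sub_apply, LinearMap.sum_apply, Finset.sum_sub_distrib]
    congr 1
    · rw [Finset.sum_comm]
      refine Finset.sum_congr rfl fun γ _ => ?_
      rw [Finset.mul_sum]
      rfl
    · rw [Finset.sum_comm]
      refine Finset.sum_congr rfl fun β _ => ?_
      change ∑ α, ev y (diffPoly (P δ β) (T β α (f α))) = ev y _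
      rw [map_sum, map_sum]
  have hflat : ∀ α, ∃ N, ∀ f, IsFlat N f (e y) → L α f = 0 := by
    intro α
    choose N₁ hN₁ using fun γ => exists_flat_imp_diffPoly (P γ α)
    choose N₂ hN₂ using fun β => exists_flat_imp_diffPoly (P δ β)
    refine ⟨∑ γ, N₁ γ + ∑ β, N₂ β, fun f hf => ?_⟩
    have hf₁ : ∀ γ, IsFlat (N₁ γ) f (e y) := fun γ n hn => hf n (hn.trans
      ((Finset.single_le_sum (fun _ _ => Nat.zero_le _) (Finset.mem_univ γ)).trans
        (Nat.le_add_right _ _)))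
    have hf₂ : ∀ β, IsFlat (N₂ β) f (e y) := fun β n hn => hf n (hn.trans
      ((Finset.single_le_sum (fun _ _ => Nat.zero_le _) (Finset.mem_univ β)).trans
        (Nat.le_add_left _ _)))
    simp only [L, LinearMap.sub_apply, LinearMap.sum_apply]
    rw [Finset.sum_eq_zero, Finset.sum_eq_zero, sub_zero]
    · intro β _
      exact hN₂ β _ y (isFlat_pull (hpull β α) e.open_source (hws β α) hI.contDiffOn hy (hf₂ β))
    · intro γ _
      change H δ γ y • (diffPoly (P γ α) f : Vec m → ℂ) (e y) = 0
      rw [hN₁ γ f _ (hf₁ γ), smul_zero]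
  choose N hN using hflat
  choose p hp using fun α => exists_symbol (L α) (e y) (N α) (hN α)
  obtain ⟨r, hr, hrt⟩ := Metric.nhds_basis_closedBall.mem_iff.1
    (e.open_target.mem_nhds (e.map_source hy))
  have hK := isCompact_closedBall (e y) r
  have hp0 : p = 0 := by
    -- For a column of E * φ both sides equal `H δ γ y * φ (e y)`: on the left because P E = δ at e
    -- y, on the right because `sum_conv` rewrites the pull-back as E convolved with the transported
    -- source.
    refine hE.eq_zero_of_row p (e y) hr fun γ φ hφ => ?_
    have hφc := hφ.hasCompactSupport hK
    have hsum := hL fun α => convS (E α γ) φ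
    simp only [hp] at hsum
    have : ((∑ α, diffPoly (p α) (convS (E α γ) φ) : Smooth m) : Vec m → ℂ) (e y) =
        ∑ α, (diffPoly (p α) (convS (E α γ) φ) : Vec m → ℂ) (e y) := by
      simp
    rw [this, hsum, sub_eq_zero]
    choose k hk hkc using fun α => hI.exists_transport hK hrt hφ α γ
    have hTk : ∀ β, ((∑ α, T β α (convS (E α γ) φ) : Smooth m) : Vec m → ℂ) =ᶠ[nhds y]
        ((∑ α, convS (E β α) (k α) : Smooth m) : Vec m → ℂ) := by
      intro β
      filter_upwards [hT (fun α => convS (E α γ) φ) β, e.open_source.mem_nhds hy] with x hx hxs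
      rw [hx]
      simp only [coe_convS (hE.locallyIntegrable _ _) hφc]
      rw [hI.sum_conv hm hE.locallyIntegrable hK hrt hφ γ hxs β]
      simp [coe_convS (hE.locallyIntegrable _ _) (hkc _), hk]
    have hleft : ∀ γ', ∑ α, (diffPoly (P γ' α) (convS (E α γ) φ) : Vec m → ℂ) (e y) =
        if γ' = γ then (φ : Vec m → ℂ) (e y) else 0 := by
      intro γ'
      have := congrArg (fun f : Smooth m => (f : Vec m → ℂ) (e y)) (hE.eq φ hφc γ' γ)
      by_cases h : γ' = γ <;> simpa [h] using this
    have hright : ∑ β, (diffPoly (P δ β) (∑ α, T β α (convS (E α γ) φ)) : Vec m → ℂ) y =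
        (k δ : Vec m → ℂ) y := by
      calc ∑ β, (diffPoly (P δ β) (∑ α, T β α (convS (E α γ) φ)) : Vec m → ℂ) y
          = ∑ β, ev y (diffPoly (P δ β) (∑ α, convS (E β α) (k α))) :=
            Finset.sum_congr rfl fun β _ => diffPoly_congr _ (hTk β)
        _ = ∑ α, ev y (∑ β, diffPoly (P δ β) (convS (E β α) (k α))) := by
            simp only [map_sum]
            rw [Finset.sum_comm]
        _ = ∑ α, if δ = α then ev y (k α) else 0 := by
            refine Finset.sum_congr rfl fun α _ => ?_
            rw [hE.eq (k α) (hkc α) δ α]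
            by_cases h : δ = α <;> simp [h]
        _ = _ := by simp [ev]
    rw [hright, hk, transport, Set.indicator_of_mem hy]
    simp [hleft]
  have hfin := hL f
  simp only [hp, hp0] at hfin
  simp only [Pi.zero_apply, map_zero, LinearMap.zero_apply, Submodule.coe_zero,
    Finset.sum_const_zero] at hfin
  rw [sub_eq_zero.1 hfin.symm]
  exact Finset.sum_congr rfl fun β _ => diffPoly_congr _ ((hT f β).trans (hg β).symm)

end Covariance

end HigherSpin

/-! ### Spin actions on function spaces, and their matrices in a basis. -/

namespace HigherSpin

variable {m : ℕ} {W : Type*} [NormedAddCommGroup W] [NormedSpace ℂ W]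

/-- An action of the products of vectors on the values of a field, of degree `p` in the vectors. -/
structure SpinAction (m : ℕ) (W : Type*) [NormedAddCommGroup W] [NormedSpace ℂ W] where
  val : Cl m → W →ₗ[ℂ] W
  deg : ℕ
  val_one : ∀ w, val 1 w = w
  val_mul : ∀ s t w, val (s * t) w = val t (val s w)
  val_smul : ∀ (r : ℝ) s w, val (r • s) w = ((r ^ deg : ℝ) : ℂ) • val s w
  val_contDiff : ∀ w, ContDiff ℝ ∞ fun x => val (vec x) w

/-- The induced action on functions. -/
def SpinAction.act (A : SpinAction m W) (s : Cl m) (g : Vec m → W) (u : Vec m) : W :=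
  A.val s (g (rot s u))

namespace SpinAction

variable (A : SpinAction m W) {s t : Cl m}

theorem act_smul (c : ℂ) (f : Vec m → W) : A.act s (c • f) = c • A.act s f := by
  ext u; simp [act]

theorem act_sum {κ : Type*} (S : Finset κ) (f : κ → Vec m → W) :
    A.act s (∑ i ∈ S, f i) = ∑ i ∈ S, A.act s (f i) := by
  ext u; simp [act]

/-- The order reverses twice consistently: `val` is antimultiplicative by definition, and
substituting `rot s` and then `rot t` into g gives g(rot s (rot t u)). -/
theorem act_mul (hs : IsVecProd s) (ht : IsVecProd t) (hs0 : s ≠ 0) (ht0 : t ≠ 0)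
    (g : Vec m → W) : A.act (s * t) g = A.act t (A.act s g) := by
  ext u
  rw [act, act, act, A.val_mul, rot_mul hs ht hs0 ht0]

theorem act_real_smul {r : ℝ} (hr : r ≠ 0) (hs : IsVecProd s) (g : Vec m → W) :
    A.act (r • s) g = ((r ^ A.deg : ℝ) : ℂ) • A.act s g := by
  ext u
  rw [act, A.val_smul, rot_smul hr hs]
  rfl

theorem act_mem {V : Submodule ℂ (Vec m → W)}
    (hV : ∀ x : Vec m, x ≠ 0 → ∀ g ∈ V, A.act (vec x) g ∈ V) (hs : IsVecProd s) (hs0 : s ≠ 0)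
    {g : Vec m → W} (hg : g ∈ V) : A.act s g ∈ V := by
  induction hs using IsVecProd.induction generalizing g with
  | one =>
    obtain ⟨L, h1, h2⟩ := (isVecProd_one (m := m)).exists_rot_eq hs0
    have hn : clNorm (1 : Cl m) = 1 := clNorm_eq zero_le_one (by simp)
    have : A.act 1 g = g := by
      ext u
      have h3 := h2 u
      rw [hn, one_mul, rev_one, mul_one, one_pow, one_smul] at h3
      rw [act, A.val_one, h1, ← vec_injective h3]
    rwa [this]
  | mul x s hs ih =>
    have hs0' : s ≠ 0 := right_ne_zero_of_mul hs0
    have hx0 : vec x ≠ 0 := left_ne_zero_of_mul hs0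
    rw [A.act_mul (isVecProd_vec x) hs hx0 hs0']
    exact ih hs0' (hV x (fun h => hx0 (by rw [h, vec_zero])) g hg)

end SpinAction

section PointFunctional

/-- The span of the functionals `g ↦ ℓ (g u)`. -/
def pointFunctionals (m : ℕ) (W : Type*) [NormedAddCommGroup W] [NormedSpace ℂ W] :
    Submodule ℂ (Module.Dual ℂ (Vec m → W)) :=
  Submodule.span ℂ (Set.range fun q : Vec m × Module.Dual ℂ W => q.2 ∘ₗ LinearMap.proj q.1)

/-- Values at points separate the elements of a finite-dimensional V, so the point functionals span
its dual. Coordinates of a family in V therefore depend smoothly on a parameter as soon as its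
values do. -/
theorem exists_pointFunctional (V : Submodule ℂ (Vec m → W)) [FiniteDimensional ℂ V]
    (l : Module.Dual ℂ V) : ∃ c ∈ pointFunctionals m W, ∀ v : V, c v = l v := by
  let R : Module.Dual ℂ (Vec m → W) →ₗ[ℂ] Module.Dual ℂ V := LinearMap.lcomp ℂ ℂ V.subtype
  have h1 : l ∈ Submodule.span ℂ (Set.range fun q : Vec m × Module.Dual ℂ W =>
      R (q.2 ∘ₗ LinearMap.proj q.1)) := by
    refine FiniteDimensional.mem_span_of_iInf_ker_le_ker fun v hv => ?_
    simp only [Submodule.mem_iInf, LinearMap.mem_ker] at hv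
    have : v = 0 := by
      ext u
      refine (Module.forall_dual_apply_eq_zero_iff ℂ _).1 fun ℓ => ?_
      exact hv (u, ℓ)
    simp [this]
  have h2 : (Set.range fun q : Vec m × Module.Dual ℂ W => R (q.2 ∘ₗ LinearMap.proj q.1)) =
      R '' Set.range fun q : Vec m × Module.Dual ℂ W => q.2 ∘ₗ LinearMap.proj q.1 := by
    rw [← Set.range_comp]
    rfl
  rw [h2, ← Submodule.map_span] at h1
  obtain ⟨c, hc, rfl⟩ := h1
  exact ⟨c, hc, fun v => rfl⟩

theorem pointFunctional_contDiffOn [FiniteDimensional ℂ W] {c : Module.Dual ℂ (Vec m → W)}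
    (hc : c ∈ pointFunctionals m W) {F : Vec m → Vec m → W} {U : Set (Vec m)}
    (hF : ∀ u, ContDiffOn ℝ ∞ (fun x => F x u) U) : ContDiffOn ℝ ∞ (fun x => c (F x)) U := by
  induction hc using Submodule.span_induction with
  | mem c hc =>
    obtain ⟨⟨u, ℓ⟩, rfl⟩ := hc
    let T : W →L[ℝ] ℂ := (LinearMap.toContinuousLinearMap ℓ).restrictScalars ℝ
    exact T.contDiff.comp_contDiffOn (hF u)
  | zero => exact contDiffOn_const
  | add c c' _ _ h h' => exact h.add h'
  | smul r c _ h => exact contDiffOn_const.smul h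

end PointFunctional

/-- A basis of a space of functions, with coordinates expressed by point functionals. -/
structure Frame (V : Submodule ℂ (Vec m → W)) (ι : Type*) where
  basis : Module.Basis ι ℂ V
  coord : ι → Module.Dual ℂ (Vec m → W)
  coord_mem : ∀ α, coord α ∈ pointFunctionals m W
  coord_eq : ∀ α (v : V), coord α v = basis.repr v α

theorem exists_frame (V : Submodule ℂ (Vec m → W)) [FiniteDimensional ℂ V] :
    Nonempty (Frame V (Fin (Module.finrank ℂ V))) := by
  let b := Module.finBasis ℂ V
  choose c hc hcb using fun α => exists_pointFunctional V (b.coord α)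
  exact ⟨⟨b, c, hc, fun α v => by rw [hcb]; rfl⟩⟩

namespace Frame

variable {V : Submodule ℂ (Vec m → W)} {ι : Type*} (F : Frame V ι)

theorem sum_coord [Fintype ι] {g : Vec m → W} (hg : g ∈ V) :
    g = ∑ α, F.coord α g • (F.basis α : Vec m → W) := by
  have h := congrArg (fun v : V => (v : Vec m → W)) (F.basis.sum_repr ⟨g, hg⟩)
  simp only [AddSubmonoidClass.coe_finsetSum, Submodule.coe_smul] at h
  rw [← h]
  exact Finset.sum_congr rfl fun α _ => by rw [h, ← F.coord_eq α ⟨g, hg⟩]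

theorem coord_basis [DecidableEq ι] (α β : ι) :
    F.coord α (F.basis β) = if α = β then 1 else 0 := by
  rw [F.coord_eq, F.basis.repr_self, Finsupp.single_apply]
  simp [eq_comm]

variable (A : SpinAction m W)

/-- The matrix of the action of `s` on `V`. -/
def mat (s : Cl m) (α β : ι) : ℂ := F.coord α (A.act s (F.basis β))

variable {s t : Cl m}

theorem act_basis [Fintype ι] (hV : ∀ x : Vec m, x ≠ 0 → ∀ g ∈ V, A.act (vec x) g ∈ V)
    (hs : IsVecProd s) (hs0 : s ≠ 0) (β : ι) :
    A.act s (F.basis β) = ∑ α, F.mat A s α β • (F.basis α : Vec m → W) :=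
  F.sum_coord (A.act_mem hV hs hs0 (F.basis β).2)

theorem mat_mul [Fintype ι] (hV : ∀ x : Vec m, x ≠ 0 → ∀ g ∈ V, A.act (vec x) g ∈ V)
    (hs : IsVecProd s) (ht : IsVecProd t) (hs0 : s ≠ 0) (ht0 : t ≠ 0) (α β : ι) :
    F.mat A (s * t) α β = ∑ γ, F.mat A t α γ * F.mat A s γ β := by
  rw [mat, A.act_mul hs ht hs0 ht0, F.act_basis A hV hs hs0, A.act_sum, map_sum]
  refine Finset.sum_congr rfl fun γ _ => ?_
  rw [A.act_smul, map_smul, smul_eq_mul, mul_comm, mat]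
  rfl

theorem mat_smul {r : ℝ} (hr : r ≠ 0) (hs : IsVecProd s) (α β : ι) :
    F.mat A (r • s) α β = ((r ^ A.deg : ℝ) : ℂ) * F.mat A s α β := by
  rw [mat, A.act_real_smul hr hs, map_smul, smul_eq_mul, mat]

theorem coord_act [Fintype ι]
    (hs : ∀ β, A.act s (F.basis β) = ∑ α, F.mat A s α β • (F.basis α : Vec m → W))
    {g : Vec m → W} (hg : g ∈ V) :
    A.act s g = ∑ α, (∑ β, F.mat A s α β * F.coord β g) • (F.basis α : Vec m → W) := by
  conv_lhs => rw [F.sum_coord hg]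
  simp only [A.act_sum, A.act_smul, hs, Finset.smul_sum, smul_smul, Finset.sum_smul]
  rw [Finset.sum_comm]
  exact Finset.sum_congr rfl fun α _ => Finset.sum_congr rfl fun β _ => by rw [mul_comm]

theorem contDiffOn_mat_vec [FiniteDimensional ℂ W] (hsm : ∀ g ∈ V, ContDiff ℝ ∞ g) (α β : ι) :
    ContDiffOn ℝ ∞ (fun x => F.mat A (vec x) α β) {0}ᶜ := by
  refine pointFunctional_contDiffOn (F.coord_mem α) fun u => ?_
  let b := Module.finBasis ℂ W
  have h1 : ContDiffOn ℝ ∞ (fun x : Vec m => rot (vec x) u) {0}ᶜ := by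
    intro x hx
    have hx0 : ‖x‖ ^ 2 ≠ 0 := by simpa using hx
    simp only [rot_vec]
    have h2 : ContDiffAt ℝ ∞ (fun x : Vec m => (‖x‖ ^ 2)⁻¹) x :=
      (contDiffAt_id.norm_sq ℝ).inv hx0
    have h3 : ContDiffAt ℝ ∞ (fun x : Vec m => ‖x‖ ^ 2) x := contDiffAt_id.norm_sq ℝ
    have h4 : ContDiffAt ℝ ∞ (fun x : Vec m => inner ℝ x u) x :=
      contDiffAt_id.inner ℝ contDiffAt_const
    exact ContDiffAt.contDiffWithinAt (by fun_prop)
  have h2 : ContDiffOn ℝ ∞ (fun x : Vec m => (F.basis β : Vec m → W) (rot (vec x) u)) {0}ᶜ :=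
    (hsm _ (F.basis β).2).comp_contDiffOn h1
  have h3 : (fun x : Vec m => A.act (vec x) (F.basis β) u) = fun x =>
      ∑ i, b.coord i ((F.basis β : Vec m → W) (rot (vec x) u)) • A.val (vec x) (b i) := by
    ext1 x
    rw [SpinAction.act]
    conv_lhs => rw [← b.sum_repr ((F.basis β : Vec m → W) (rot (vec x) u))]
    simp only [map_sum, map_smul, Module.Basis.coord_apply]
  rw [h3]
  refine ContDiffOn.sum fun i _ => ContDiffOn.smul ?_ (A.val_contDiff (b i)).contDiffOn
  let T : W →L[ℝ] ℂ := (LinearMap.toContinuousLinearMap (b.coord i)).restrictScalars ℝ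
  exact T.contDiff.comp_contDiffOn h2

/-- The kernel `κ ‖x‖^n (action of x)` in coordinates. -/
def kernel (κ : ℂ) (n : ℤ) (α β : ι) (x : Vec m) : ℂ :=
  κ * (((‖x‖ ^ n : ℝ) : ℂ) * F.mat A (vec x) α β)

/-- The kernel is bounded by a constant times ‖x‖ to the power n + `A.deg`: the matrix is
homogeneous of degree `A.deg` under positive scaling and bounded on the unit sphere. The hypothesis
`hn` puts this exponent above −m. -/
theorem locallyIntegrable_kernel [FiniteDimensional ℂ W] (hm : 1 ≤ m)
    (hsm : ∀ g ∈ V, ContDiff ℝ ∞ g) (κ : ℂ)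
    {n : ℤ} (hn : 1 ≤ n + A.deg + m) (α β : ι) : LocallyIntegrable (F.kernel A κ n α β) := by
  have : Nonempty (Fin m) := ⟨⟨0, hm⟩⟩
  have hc : ContinuousOn (fun x : Vec m => F.mat A (vec x) α β) {0}ᶜ :=
    (F.contDiffOn_mat_vec A hsm α β).continuousOn
  have hsph : Metric.sphere (0 : Vec m) 1 ⊆ {0}ᶜ := by
    intro x hx h
    rw [Set.mem_singleton_iff] at h
    simp [h] at hx
  obtain ⟨C, hC⟩ := (isCompact_sphere (0 : Vec m) 1).exists_bound_of_continuousOn (hc.mono hsph)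
  refine locallyIntegrable_of_norm_le_rpow (C := ‖κ‖ * C) (α := -((n + A.deg : ℤ) : ℝ)) ?_ ?_ ?_ ?_
  · simpa using hm
  · simp only [finrank_euclideanSpace, Fintype.card_fin]
    have : (0 : ℝ) < ((n + A.deg + m : ℤ) : ℝ) := by exact_mod_cast hn
    push_cast at this ⊢
    linarith
  · have hne : ∀ᵐ x : Vec m, x ≠ 0 := by simp [ae_iff]
    filter_upwards [hne] with x hx
    have hx0 : 0 < ‖x‖ := norm_pos_iff.2 hx
    have h1 : F.mat A (vec x) α β =
        ((‖x‖ ^ A.deg : ℝ) : ℂ) * F.mat A (vec (‖x‖⁻¹ • x)) α β := by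
      rw [← F.mat_smul A hx0.ne' (isVecProd_vec _), ← vec_smul, smul_smul,
        mul_inv_cancel₀ hx0.ne', one_smul]
    have h2 : ‖F.mat A (vec (‖x‖⁻¹ • x)) α β‖ ≤ C := hC _ (by
      simp [norm_smul, hx0.ne'])
    rw [neg_neg, Real.rpow_intCast, kernel, h1, norm_mul, norm_mul, norm_mul, Complex.norm_real,
      Complex.norm_real, Real.norm_of_nonneg (by positivity), Real.norm_of_nonneg (by positivity),
      zpow_add₀ hx0.ne', zpow_natCast]
    calc ‖κ‖ * (‖x‖ ^ n * (‖x‖ ^ A.deg * ‖F.mat A (vec (‖x‖⁻¹ • x)) α β‖))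
        ≤ ‖κ‖ * (‖x‖ ^ n * (‖x‖ ^ A.deg * C)) := by gcongr
      _ = _ := by ring
  · have h1 : ContinuousOn (F.kernel A κ n α β) {0}ᶜ := by
      refine continuousOn_const.mul (ContinuousOn.mul ?_ hc)
      refine Complex.continuous_ofReal.comp_continuousOn ?_
      intro x hx
      exact ((continuous_norm.continuousAt (x := x)).zpow₀ n
        (Or.inl (norm_ne_zero_iff.2 hx))).continuousWithinAt
    have h2 := h1.aestronglyMeasurable (μ := (volume : Measure (Vec m)))
      (measurableSet_singleton (0 : Vec m)).compl
    have hne : ∀ᵐ x : Vec m, x ∈ ({0}ᶜ : Set (Vec m)) := by simp [ae_iff]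
    rwa [Measure.restrict_eq_self_of_ae_mem hne] at h2

end Frame

end HigherSpin

/-! ### From distributional delta equations to matrix fundamental solutions. -/

namespace HigherSpin

variable {m : ℕ} {W : Type*} [NormedAddCommGroup W] [NormedSpace ℂ W]

/-- The reflected function `x ↦ φ (z - x)`. -/
def reflect (z : Vec m) (φ : Smooth m) : Smooth m :=
  ⟨fun x => (φ : Vec m → ℂ) (z - x), (smooth_contDiff φ).comp (contDiff_const.sub contDiff_id)⟩

theorem partialD_reflect (z : Vec m) (φ : Smooth m) (i : Fin m) :
    partialD i (reflect z φ) = -reflect z (partialD i φ) := by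
  ext x
  have h : HasFDerivAt (reflect z φ : Vec m → ℂ)
      ((fderiv ℝ (φ : Vec m → ℂ) (z - x)).comp (-ContinuousLinearMap.id ℝ (Vec m))) x :=
    HasFDerivAt.comp (f := fun x => z - x) x (smooth_differentiable φ (z - x)).hasFDerivAt
      ((hasFDerivAt_id x).const_sub z)
  rw [partialD_apply, h.fderiv]
  simp [reflect, partialD_apply]

/-- The sign produced by reflection cancels the sign from integration by parts in `EqDelta`. -/
theorem diffPoly_prod_X_reflect (z : Vec m) (φ : Smooth m) (n : ℕ) (I : Fin n → Fin m) :
    diffPoly (∏ l, MvPolynomial.X (I l)) (reflect z φ) =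
      (-1 : ℂ) ^ n • reflect z (diffPoly (∏ l, MvPolynomial.X (I l)) φ) := by
  induction n with
  | zero => simp
  | succ n ih =>
    rw [Fin.prod_univ_succ, diffPoly_mul, diffPoly_mul, ih, diffPoly_X, map_smul, partialD_reflect,
      pow_succ, mul_smul, neg_one_smul]

section Symbol

variable {V : Submodule ℂ (Vec m → W)} {ι : Type*} (F : Frame V ι)

/-- The symbol of a differential operator in coordinates. -/
def DiffOp.symbol (D : DiffOp m W) : Matrix ι ι (MvPolynomial (Fin m) ℂ) := fun β α =>
  ∑ n ∈ Finset.range (D.order + 1), ∑ I : Fin n → Fin m,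
    MvPolynomial.C (F.coord β (D.coeff n I (F.basis α))) * ∏ l, MvPolynomial.X (I l)

theorem DiffOp.diffPoly_symbol (D : DiffOp m W) (β α : ι) (g : Smooth m) (x : Vec m) :
    (diffPoly (D.symbol F β α) g : Vec m → ℂ) x =
      ∑ n ∈ Finset.range (D.order + 1), ∑ I : Fin n → Fin m,
        F.coord β (D.coeff n I (F.basis α)) *
          (diffPoly (∏ l, MvPolynomial.X (I l)) g : Vec m → ℂ) x := by
  simp only [symbol, map_sum, LinearMap.sum_apply, diffPoly_mul, diffPoly_C,
    AddSubmonoidClass.coe_finsetSum, Finset.sum_apply, Submodule.coe_smul, Pi.smul_apply,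
    smul_eq_mul]

theorem iteratedFDeriv_sum_smul [Fintype ι] (g : ι → Smooth m) (w : ι → W) (n : ℕ) (I : Fin n → Fin m)
    (x : Vec m) :
    iteratedFDeriv ℝ n (fun x => ∑ α, (g α : Vec m → ℂ) x • w α) x (fun l => stdVec (I l)) =
      ∑ α, (diffPoly (∏ l, MvPolynomial.X (I l)) (g α) : Vec m → ℂ) x • w α := by
  have hc : ∀ α, ContDiff ℝ ∞ fun x => (g α : Vec m → ℂ) x • w α := fun α =>
    (smooth_contDiff (g α)).smul contDiff_const
  have hle : (n : ℕ∞ω) ≤ ∞ := by exact_mod_cast le_top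
  rw [iteratedFDeriv_fun_sum_apply fun α _ => ((hc α).of_le hle).contDiffAt]
  rw [sum_apply]
  refine Finset.sum_congr rfl fun α _ => ?_
  let T : ℂ →L[ℝ] W := (ContinuousLinearMap.toSpanSingleton ℂ (w α)).restrictScalars ℝ
  have h := T.iteratedFDeriv_comp_left ((smooth_contDiff (g α)).contDiffAt (x := x)) (i := n) hle
  have h2 : (T ∘ (g α : Vec m → ℂ)) = fun x => (g α : Vec m → ℂ) x • w α := rfl
  rw [h2] at h
  rw [h, diffPoly_prod_X]
  rfl

theorem DiffOp.app_eq [Fintype ι] {D : DiffOp m W} (hD : ∀ n I, ∀ g ∈ V, D.coeff n I g ∈ V)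
    {f : Vec m → Vec m → W} {x : Vec m} {g : ι → Smooth m}
    (hf : ∀ᶠ x' in nhds x, f x' = ∑ α, (g α : Vec m → ℂ) x' • (F.basis α : Vec m → W)) (u : Vec m) :
    D.app f x u = ∑ β, (∑ α, (diffPoly (D.symbol F β α) (g α) : Vec m → ℂ) x) •
      (F.basis β : Vec m → W) u := by
  have h1 : ∀ (n : ℕ) (I : Fin n → Fin m),
      (fun u' => iteratedFDeriv ℝ n (fun x' => f x' u') x (fun i => stdVec (I i))) =
        ∑ α, (diffPoly (∏ l, MvPolynomial.X (I l)) (g α) : Vec m → ℂ) x •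
          (F.basis α : Vec m → W) := by
    intro n I
    ext1 u'
    have : (fun x' => f x' u') =ᶠ[nhds x]
        fun x' => ∑ α, (g α : Vec m → ℂ) x' • (F.basis α : Vec m → W) u' := by
      filter_upwards [hf] with x' hx'
      rw [hx']
      simp
    rw [(this.iteratedFDeriv ℝ n).self_of_nhds, iteratedFDeriv_sum_smul]
    simp
  have h2 : ∀ (n : ℕ) (I : Fin n → Fin m) (α : ι), D.coeff n I (F.basis α) =
      ∑ β, F.coord β (D.coeff n I (F.basis α)) • (F.basis β : Vec m → W) := fun n I α =>
    F.sum_coord (hD n I _ (F.basis α).2)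
  simp only [app, h1, map_sum, map_smul, Finset.sum_apply, Pi.smul_apply]
  have h3 : ∀ (n : ℕ) (I : Fin n → Fin m) (α : ι), D.coeff n I (F.basis α) u =
      ∑ β, F.coord β (D.coeff n I (F.basis α)) • (F.basis β : Vec m → W) u := fun n I α => by
    conv_lhs => rw [h2 n I α]
    simp
  simp only [DiffOp.diffPoly_symbol, Finset.sum_smul]
  calc ∑ n ∈ Finset.range (D.order + 1), ∑ I : Fin n → Fin m, ∑ α,
        (diffPoly (∏ l, MvPolynomial.X (I l)) (g α) : Vec m → ℂ) x • D.coeff n I (F.basis α) u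
      = ∑ n ∈ Finset.range (D.order + 1), ∑ I : Fin n → Fin m, ∑ α, ∑ β,
        (F.coord β (D.coeff n I (F.basis α)) *
          (diffPoly (∏ l, MvPolynomial.X (I l)) (g α) : Vec m → ℂ) x) •
            (F.basis β : Vec m → W) u := by
        refine Finset.sum_congr rfl fun n _ => Finset.sum_congr rfl fun I _ =>
          Finset.sum_congr rfl fun α _ => ?_
        rw [h3, Finset.smul_sum]
        exact Finset.sum_congr rfl fun β _ => by rw [smul_smul, mul_comm]
    _ = _ := by
        simp only [Finset.sum_comm (s := Finset.univ (α := ι)) (t := Finset.range (D.order + 1))]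
        refine Finset.sum_congr rfl fun n _ => ?_
        have hcomm : ∀ β, ∑ α, ∑ I : Fin n → Fin m, (F.coord β (D.coeff n I (F.basis α)) *
            (diffPoly (∏ l, MvPolynomial.X (I l)) (g α) : Vec m → ℂ) x) •
              (F.basis β : Vec m → W) u = ∑ I : Fin n → Fin m, ∑ α,
              (F.coord β (D.coeff n I (F.basis α)) *
            (diffPoly (∏ l, MvPolynomial.X (I l)) (g α) : Vec m → ℂ) x) •
              (F.basis β : Vec m → W) u := fun β => Finset.sum_comm
        simp only [hcomm]
        rw [Finset.sum_comm (γ := ι)]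
        exact Finset.sum_congr rfl fun I _ => Finset.sum_comm

end Symbol

section Fundamental

variable [FiniteDimensional ℂ W] {V : Submodule ℂ (Vec m → W)} {ι : Type*} [Fintype ι]
  (F : Frame V ι) (A : SpinAction m W)

/-- Pairing with the reflected function x ↦ φ(z − x) is convolution with φ at z; expanding the
kernel in the frame expresses the distributional left side through derivatives of `convS`. -/
theorem Frame.integral_pairing (hm : 1 ≤ m) (hsm : ∀ g ∈ V, ContDiff ℝ ∞ g)
    (hV : ∀ x : Vec m, x ≠ 0 → ∀ g ∈ V, A.act (vec x) g ∈ V) (D : DiffOp m W) (κ : ℂ) {w : ℤ}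
    (hw : 1 ≤ w + A.deg + m) {φ : Smooth m} (hφ : HasCompactSupport (φ : Vec m → ℂ)) (z : Vec m)
    {g : Vec m → W} (hg : g ∈ V) (u : Vec m) :
    ∫ x : Vec m, (∑ n ∈ Finset.range (D.order + 1), ∑ I : Fin n → Fin m,
      ((-1 : ℂ) ^ n * iteratedFDeriv ℝ n (reflect z φ : Vec m → ℂ) x (fun i => stdVec (I i))) •
        D.coeff n I (fun u => κ • ((‖x‖ ^ w : ℝ) : ℂ) • A.act (vec x) g u) u) =
    ∑ n ∈ Finset.range (D.order + 1), ∑ I : Fin n → Fin m, ∑ α, ∑ γ,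
      ((diffPoly (∏ l, MvPolynomial.X (I l)) (convS (F.kernel A κ w α γ) φ) : Vec m → ℂ) z *
        F.coord γ g) • D.coeff n I (F.basis α) u := by
  have : Nonempty (Fin m) := ⟨⟨0, hm⟩⟩
  have hloc := F.locallyIntegrable_kernel A hm hsm κ hw
  set K := tsupport (φ : Vec m → ℂ) with hKdef
  have hK : IsCompact K := hφ
  have hφK : VanishOff K φ := fun x hx => image_eq_zero_of_notMem_tsupport hx
  have hder : ∀ (n : ℕ) (I : Fin n → Fin m), HasCompactSupport
      ((diffPoly (∏ l, MvPolynomial.X (I l)) φ : Smooth m) : Vec m → ℂ) := fun n I =>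
    (hφK.diffPoly hK.isClosed _).hasCompactSupport hK
  have hae : ∀ᵐ x : Vec m, (∑ n ∈ Finset.range (D.order + 1), ∑ I : Fin n → Fin m,
      ((-1 : ℂ) ^ n * iteratedFDeriv ℝ n (reflect z φ : Vec m → ℂ) x (fun i => stdVec (I i))) •
        D.coeff n I (fun u => κ • ((‖x‖ ^ w : ℝ) : ℂ) • A.act (vec x) g u) u) =
      ∑ n ∈ Finset.range (D.order + 1), ∑ I : Fin n → Fin m, ∑ α, ∑ γ,
        (F.kernel A κ w α γ x *
          (diffPoly (∏ l, MvPolynomial.X (I l)) φ : Vec m → ℂ) (z - x)) •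
            (F.coord γ g • D.coeff n I (F.basis α) u) := by
    have hne : ∀ᵐ x : Vec m, x ≠ 0 := by simp [ae_iff]
    filter_upwards [hne] with x hx
    refine Finset.sum_congr rfl fun n _ => Finset.sum_congr rfl fun I _ => ?_
    have h1 : (fun u => κ • ((‖x‖ ^ w : ℝ) : ℂ) • A.act (vec x) g u) =
        ∑ α, ∑ γ, (F.kernel A κ w α γ x * F.coord γ g) • (F.basis α : Vec m → W) := by
      have h2 := F.coord_act A (s := vec x) (F.act_basis A hV (isVecProd_vec x)
        fun h => hx (vec_eq_zero.1 h)) hg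
      change κ • ((‖x‖ ^ w : ℝ) : ℂ) • A.act (vec x) g = _
      rw [h2, Finset.smul_sum, Finset.smul_sum]
      refine Finset.sum_congr rfl fun α _ => ?_
      rw [smul_smul, smul_smul, ← Finset.sum_smul, Finset.mul_sum]
      congr 1
      exact Finset.sum_congr rfl fun γ _ => by rw [kernel]; ring
    rw [h1, ← diffPoly_prod_X, diffPoly_prod_X_reflect, Submodule.coe_smul, Pi.smul_apply,
      smul_eq_mul, ← mul_assoc, ← mul_pow]
    simp only [map_sum, map_smul, Finset.sum_apply, Pi.smul_apply, Finset.smul_sum]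
    refine Finset.sum_congr rfl fun α _ => Finset.sum_congr rfl fun γ _ => ?_
    rw [smul_smul, smul_smul]
    congr 1
    simp [reflect]
    ring
  have hint : ∀ (n : ℕ) (I : Fin n → Fin m) (α γ : ι), Integrable fun x =>
      (F.kernel A κ w α γ x *
        (diffPoly (∏ l, MvPolynomial.X (I l)) φ : Vec m → ℂ) (z - x)) •
          (F.coord γ g • D.coeff n I (F.basis α) u) := fun n I α γ =>
    (integrable_conv (hloc α γ) (hder n I) z).smul_const _
  rw [integral_congr_ae hae, integral_finsetSum _ fun n _ => integrable_finsetSum _ fun I _ =>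
    integrable_finsetSum _ fun α _ => integrable_finsetSum _ fun γ _ => hint n I α γ]
  refine Finset.sum_congr rfl fun n _ => ?_
  rw [integral_finsetSum _ fun I _ => integrable_finsetSum _ fun α _ =>
    integrable_finsetSum _ fun γ _ => hint n I α γ]
  refine Finset.sum_congr rfl fun I _ => ?_
  rw [integral_finsetSum _ fun α _ => integrable_finsetSum _ fun γ _ => hint n I α γ]
  refine Finset.sum_congr rfl fun α _ => ?_
  rw [integral_finsetSum _ fun γ _ => hint n I α γ]
  refine Finset.sum_congr rfl fun γ _ => ?_
  rw [integral_smul_const, smul_smul, diffPoly_convS (hloc α γ) hK hφK,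
    coe_convS (hloc α γ) (hder n I), conv]

/-- An operator with fundamental solution `κ ‖x‖^w (action of x)` on a spanning family is
fundamental in coordinates. -/
theorem Frame.isFundamental [DecidableEq ι] (hm : 1 ≤ m) (hsm : ∀ g ∈ V, ContDiff ℝ ∞ g)
    (hV : ∀ x : Vec m, x ≠ 0 → ∀ g ∈ V, A.act (vec x) g ∈ V) {D : DiffOp m W} {κ : ℂ} {w : ℤ}
    (hw : 1 ≤ w + A.deg + m) {J : Type*} {Z : J → Vec m → W}
    (hZ : Submodule.span ℂ (Set.range Z) = V)
    (hΔ : ∀ i, D.EqDelta (fun x u => κ • ((‖x‖ ^ w : ℝ) : ℂ) • A.act (vec x) (Z i) u) (Z i)) :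
    IsFundamental (D.symbol F) (F.kernel A κ w) := by
  have hloc := F.locallyIntegrable_kernel A hm hsm κ hw
  refine ⟨hloc, fun φ hφ β γ => ?_⟩
  ext z
  have hc : HasCompactSupport (reflect z φ : Vec m → ℂ) :=
    hφ.comp_homeomorph (Homeomorph.subLeft z)
  -- T sends g to D applied to the kernel of g convolved with φ, at z. The delta equation says T g =
  -- φ(z) g for g = Z i; both sides are linear in g, so this holds on the span V, and basis elements
  -- give the matrix identity.
  let T : (Vec m → W) →ₗ[ℂ] (Vec m → W) :=
    ∑ n ∈ Finset.range (D.order + 1), ∑ I : Fin n → Fin m, ∑ α, ∑ γ,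
      (F.coord γ).smulRight
        ((diffPoly (∏ l, MvPolynomial.X (I l)) (convS (F.kernel A κ w α γ) φ) : Vec m → ℂ) z •
          D.coeff n I (F.basis α))
  have hT : ∀ g, T g = ∑ n ∈ Finset.range (D.order + 1), ∑ I : Fin n → Fin m, ∑ α, ∑ γ,
      ((diffPoly (∏ l, MvPolynomial.X (I l)) (convS (F.kernel A κ w α γ) φ) : Vec m → ℂ) z *
        F.coord γ g) • D.coeff n I (F.basis α) := by
    intro g
    simp only [T, LinearMap.sum_apply, LinearMap.smulRight_apply, smul_smul]
    simp only [mul_comm]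
  have hTV : ∀ g ∈ V, T g = (φ : Vec m → ℂ) z • g := by
    intro g hg
    rw [← hZ] at hg
    induction hg using Submodule.span_induction with
    | mem g hg =>
      obtain ⟨i, rfl⟩ := hg
      have hi : Z i ∈ V := hZ ▸ Submodule.subset_span ⟨i, rfl⟩
      ext1 u
      have h1 := hΔ i _ (smooth_contDiff (reflect z φ)) hc u
      rw [F.integral_pairing A hm hsm hV D κ hw hφ z hi u] at h1
      rw [hT]
      simp only [Finset.sum_apply, Pi.smul_apply]
      rw [h1]
      simp [reflect]
    | zero => simp
    | add f g _ _ hf hg => rw [map_add, hf, hg, smul_add]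
    | smul c f _ hf => rw [map_smul, hf, smul_comm]
  have h := congrArg (F.coord β) (hTV _ (F.basis γ).2)
  rw [hT, map_smul, F.coord_basis] at h
  simp only [map_sum, map_smul, F.coord_basis, smul_eq_mul] at h
  rw [AddSubmonoidClass.coe_finsetSum, Finset.sum_apply]
  simp only [DiffOp.diffPoly_symbol]
  have h2 : (((if β = γ then φ else 0 : Smooth m) : Vec m → ℂ) z) =
      (φ : Vec m → ℂ) z * if β = γ then 1 else 0 := by
    by_cases hβ : β = γ <;> simp [hβ]
  rw [h2, ← h, Finset.sum_comm]
  refine Finset.sum_congr rfl fun n _ => ?_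
  rw [Finset.sum_comm]
  refine Finset.sum_congr rfl fun I _ => Finset.sum_congr rfl fun α _ => ?_
  rw [Finset.sum_eq_single γ]
  · simp [mul_comm]
  · intro γ' _ hγ'
    simp [hγ']
  · simp

end Fundamental

end HigherSpin

/-! ### Möbius transformations as intertwiners. -/

namespace HigherSpin

variable {m : ℕ} {W : Type*} [NormedAddCommGroup W] [NormedSpace ℂ W]

namespace IsVahlen

variable {a b c d : Cl m}

/-- One sign serves all y: the denominator is d, or c (y + q) with exactly one vector more than c.
-/
theorem exists_sign_denom (hV : IsVahlen a b c d) : ∃ σ : ℝ, (σ = 1 ∨ σ = -1) ∧ ∀ y : Vec m,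
    (c * vec y + d) * rev (c * vec y + d) =
      algebraMap ℝ (Cl m) (σ * clNorm (c * vec y + d) ^ 2) := by
  rcases hV.denom_form with ⟨hc, hd⟩ | ⟨hc, q, hd⟩
  · obtain ⟨σ, hσ, h, -⟩ := hV.prod_d.exists_sign
    exact ⟨σ, hσ, fun y => by simpa [hc] using h⟩
  · obtain ⟨σ, hσ, h, -⟩ := hV.prod_c.exists_sign
    refine ⟨-σ, by rcases hσ with rfl | rfl <;> simp, fun y => ?_⟩
    rw [hd, ← mul_add, ← vec_add, hV.prod_c.clNorm_mul (isVecProd_vec _), clNorm_vec]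
    calc c * vec (y + q) * rev (c * vec (y + q)) = c * (vec (y + q) * vec (y + q)) * rev c := by
          simp [mul_assoc]
      _ = _ := by
          rw [vec_mul_self, ← Algebra.commutes, mul_assoc, h, ← map_mul]
          ring_nf

theorem contDiffOn_clNorm_zpow (hV : IsVahlen a b c d) (w : ℤ) :
    ContDiffOn ℝ ∞ (fun y : Vec m => ((clNorm (c * vec y + d) ^ w : ℝ) : ℂ))
      {y | c * vec y + d ≠ 0} := by
  suffices hreal : ContDiffOn ℝ ∞ (fun y : Vec m => clNorm (c * vec y + d) ^ w)
      {y | c * vec y + d ≠ 0} from Complex.ofRealCLM.contDiff.comp_contDiffOn hreal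
  rcases hV.denom_form with ⟨hc, hd⟩ | ⟨hc, q, hd⟩
  · simp only [hc, zero_mul, zero_add]
    exact contDiffOn_const
  · have h1 : (fun y : Vec m => clNorm (c * vec y + d) ^ w) =
        fun y => (clNorm c * ‖y + q‖) ^ w := by
      ext1 y
      rw [hd, ← mul_add, ← vec_add, hV.prod_c.clNorm_mul (isVecProd_vec _), clNorm_vec]
    rw [h1]
    intro y hy
    have hy' := (denom_ne_zero_iff hc hV hd y).1 hy
    have h2 : ContDiffAt ℝ ∞ (fun y : Vec m => clNorm c * ‖y + q‖) y :=
      contDiffAt_const.mul (((contDiffAt_id.add contDiffAt_const).norm ℝ) hy')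
    have h3 : clNorm c * ‖y + q‖ ≠ 0 :=
      mul_ne_zero (hV.prod_c.clNorm_pos hc).ne' (norm_ne_zero_iff.2 hy')
    refine ContDiffAt.contDiffWithinAt ?_
    cases w with
    | ofNat n => simpa using h2.pow n
    | negSucc n =>
      simp only [zpow_negSucc]
      exact (h2.pow (n + 1)).inv (pow_ne_zero _ h3)

variable {V : Submodule ℂ (Vec m → W)} {ι : Type*} [Fintype ι] (F : Frame V ι)
  (A : SpinAction m W) [FiniteDimensional ℂ W]

theorem contDiffOn_mat (hV : IsVahlen a b c d) (hsm : ∀ g ∈ V, ContDiff ℝ ∞ g)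
    (hA : ∀ x : Vec m, x ≠ 0 → ∀ g ∈ V, A.act (vec x) g ∈ V) (α β : ι) :
    ContDiffOn ℝ ∞ (fun y : Vec m => F.mat A (c * vec y + d) α β) {y | c * vec y + d ≠ 0} := by
  rcases hV.denom_form with ⟨hc, hd⟩ | ⟨hc, q, hd⟩
  · simp only [hc, zero_mul, zero_add]
    exact contDiffOn_const
  · have h1 : ∀ y ∈ {y : Vec m | c * vec y + d ≠ 0}, F.mat A (c * vec y + d) α β =
        ∑ γ, F.mat A (vec (y + q)) α γ * F.mat A c γ β := by
      intro y hy
      have hy' := (denom_ne_zero_iff hc hV hd y).1 hy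
      rw [hd, ← mul_add, ← vec_add]
      exact F.mat_mul A hA hV.prod_c (isVecProd_vec _) hc (fun h => hy' (vec_eq_zero.1 h)) α β
    refine ContDiffOn.congr ?_ h1
    refine ContDiffOn.sum fun γ _ => ContDiffOn.mul ?_ contDiffOn_const
    refine (F.contDiffOn_mat_vec A hsm α γ).comp (contDiffOn_id.add contDiffOn_const) ?_
    intro y hy
    exact (denom_ne_zero_iff hc hV hd y).1 hy

/-- Local inverses of a Möbius transformation. -/
theorem exists_homeomorph (hV : IsVahlen a b c d) {y : Vec m} (hy : c * vec y + d ≠ 0) :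
    ∃ e : OpenPartialHomeomorph (Vec m) (Vec m), y ∈ e.source ∧
      (∀ z ∈ e.source, c * vec z + d ≠ 0) ∧ ⇑e = mobius a b c d := by
  have hd : HasFDerivAt (mobius a b c d) (fderiv ℝ (mobius a b c d) y) y :=
    ((hV.contDiffAt_mobius hy).differentiableAt (by simp)).hasFDerivAt
  have hdet : (fderiv ℝ (mobius a b c d) y).det ≠ 0 := by
    intro h
    have h1 := hV.abs_det_fderiv_mobius hy
    rw [h, abs_zero] at h1
    have := (hV.isVecProd_denom y).clNorm_pos hy
    exact (by positivity : (0 : ℝ) < ((clNorm (c * vec y + d) ^ 2)⁻¹) ^ m).ne h1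
  have hd' : HasFDerivAt (mobius a b c d) (ContinuousLinearMap.toContinuousLinearEquivOfDetNeZero
      (fderiv ℝ (mobius a b c d) y) hdet : Vec m →L[ℝ] Vec m) y := by
    simpa using hd
  let e₀ := (hV.contDiffAt_mobius hy).toOpenPartialHomeomorph (mobius a b c d) hd' (by simp)
  refine ⟨e₀.restrOpen _ hV.isOpen_denom_ne_zero, ?_, ?_, rfl⟩
  · exact ⟨(hV.contDiffAt_mobius hy).mem_toOpenPartialHomeomorph_source hd' (by simp), hy⟩
  · exact fun z hz => hz.2

/-- Because `mat` reverses products, the sum on the left is the matrix of (φ(x) − φ(z)) s_x. By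
`vec_mobius_sub_mul` this is a real multiple of s_z (x − z), whose matrix factors in the order
required on the right. -/
theorem isIntertwiner (hV : IsVahlen a b c d) (hsm : ∀ g ∈ V, ContDiff ℝ ∞ g)
    (hA : ∀ x : Vec m, x ≠ 0 → ∀ g ∈ V, A.act (vec x) g ∈ V) {δ σ : ℝ}
    (hδ : δ = 1 ∨ δ = -1) (hdet : a * rev d - b * rev c = algebraMap ℝ (Cl m) δ)
    (hσ : σ = 1 ∨ σ = -1) (hs : ∀ y : Vec m, (c * vec y + d) * rev (c * vec y + d) =
      algebraMap ℝ (Cl m) (σ * clNorm (c * vec y + d) ^ 2)) (κ : ℂ) (w : ℤ)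
    {e : OpenPartialHomeomorph (Vec m) (Vec m)} (hsrc : ∀ z ∈ e.source, c * vec z + d ≠ 0)
    (he : ⇑e = mobius a b c d) :
    IsIntertwiner (F.kernel A κ w) e
      (fun α β y => ((clNorm (c * vec y + d) ^ w : ℝ) : ℂ) * F.mat A (c * vec y + d) α β)
      (fun α β y => (((δ * σ) ^ A.deg : ℝ) : ℂ) *
        ((clNorm (c * vec y + d) ^ (-2 * (m : ℤ) - 2 * A.deg - w) : ℝ) : ℂ) *
          F.mat A (c * vec y + d) α β) where
  contDiffOn := by
    rw [he]
    exact fun z hz => (hV.contDiffAt_mobius (hsrc z hz)).contDiffWithinAt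
  contDiffOn_left α β := ((hV.contDiffOn_clNorm_zpow w).mul
    (hV.contDiffOn_mat F A hsm hA α β)).mono hsrc
  contDiffOn_right α β := ((contDiffOn_const.mul (hV.contDiffOn_clNorm_zpow _)).mul
    (hV.contDiffOn_mat F A hsm hA α β)).mono hsrc
  eq x hx z hz hxz β γ := by
    have hx0 := hsrc x hx
    have hz0 := hsrc z hz
    have hsx := hV.isVecProd_denom x
    have hsz := hV.isVecProd_denom z
    have hxz0 : vec (x - z) ≠ 0 := fun h => hxz (sub_eq_zero.1 (vec_eq_zero.1 h))
    have hnorm := hV.norm_mobius_sub hx0 hz0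
    have hprod := hV.vec_mobius_sub_mul hδ hdet hx0 hz0 hσ (hs z)
    rw [he, hV.abs_det_fderiv_mobius hz0]
    have hΔ : vec (mobius a b c d x - mobius a b c d z) ≠ 0 := by
      intro h
      exact hxz (hV.injOn_mobius hx0 hz0 (sub_eq_zero.1 (vec_eq_zero.1 h)))
    have hr : δ * σ * (clNorm (c * vec z + d) ^ 2)⁻¹ ≠ 0 := by
      have := (hsz.clNorm_pos hz0).ne'
      rcases hδ with rfl | rfl <;> rcases hσ with rfl | rfl <;> simp [this]
    have hmat : ∑ α, F.mat A (c * vec x + d) β α *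
        F.mat A (vec (mobius a b c d x - mobius a b c d z)) α γ =
        (((δ * σ * (clNorm (c * vec z + d) ^ 2)⁻¹) ^ A.deg : ℝ) : ℂ) *
          ∑ α, F.mat A (vec (x - z)) β α * F.mat A (c * vec z + d) α γ := by
      rw [← F.mat_mul A hA (isVecProd_vec _) hsx hΔ hx0, hprod,
        F.mat_smul A hr (hsz.mul (isVecProd_vec _)),
        F.mat_mul A hA hsz (isVecProd_vec _) hz0 hxz0]
    have hnx := hsx.clNorm_pos hx0
    have hnz := hsz.clNorm_pos hz0
    set X := clNorm (c * vec x + d)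
    set Y := clNorm (c * vec z + d)
    -- Powers of Y: −2m from the Jacobian, −2 `A.deg` from homogeneity of the action, −w from the
    -- distortion formula. The powers of X cancel.
    have hscal : (Y ^ 2)⁻¹ ^ m * (X ^ w * ‖mobius a b c d x - mobius a b c d z‖ ^ w) *
        (δ * σ * (Y ^ 2)⁻¹) ^ A.deg =
        ‖x - z‖ ^ w * ((δ * σ) ^ A.deg * Y ^ (-2 * (m : ℤ) - 2 * A.deg - w)) := by
      rw [hnorm, ← mul_zpow]
      have h1 : X * (X⁻¹ * Y⁻¹ * ‖x - z‖) = Y⁻¹ * ‖x - z‖ := by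
        field_simp
      have h2 : (Y ^ 2)⁻¹ ^ m = Y ^ (-2 * (m : ℤ)) := by
        rw [← zpow_natCast, ← zpow_natCast, ← zpow_neg, ← zpow_mul]
        congr 1
      have h3 : (Y ^ 2)⁻¹ ^ A.deg = Y ^ (-2 * (A.deg : ℤ)) := by
        rw [← zpow_natCast, ← zpow_natCast, ← zpow_neg, ← zpow_mul]
        congr 1
      have h4 : Y ^ (-2 * (m : ℤ) - 2 * A.deg - w) =
          Y ^ (-2 * (m : ℤ)) * Y ^ (-2 * (A.deg : ℤ)) * Y ^ (-w) := by
        rw [← zpow_add₀ hnz.ne', ← zpow_add₀ hnz.ne']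
        congr 1
      rw [h1, mul_zpow, mul_pow, h2, h3, h4, inv_zpow']
      ring
    calc ((((Y ^ 2)⁻¹ ^ m : ℝ)) : ℂ) * ∑ α, ((X ^ w : ℝ) : ℂ) * F.mat A (c * vec x + d) β α *
          F.kernel A κ w α γ (mobius a b c d x - mobius a b c d z)
        = κ * ((((Y ^ 2)⁻¹ ^ m * (X ^ w * ‖mobius a b c d x - mobius a b c d z‖ ^ w) : ℝ)) : ℂ) *
          ∑ α, F.mat A (c * vec x + d) β α *
            F.mat A (vec (mobius a b c d x - mobius a b c d z)) α γ := by
          rw [Finset.mul_sum, Finset.mul_sum]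
          refine Finset.sum_congr rfl fun α _ => ?_
          rw [Frame.kernel]
          push_cast
          ring
      _ = κ * (((Y ^ 2)⁻¹ ^ m * (X ^ w * ‖mobius a b c d x - mobius a b c d z‖ ^ w) *
            (δ * σ * (Y ^ 2)⁻¹) ^ A.deg : ℝ) : ℂ) *
              ∑ α, F.mat A (vec (x - z)) β α * F.mat A (c * vec z + d) α γ := by
          rw [hmat]
          push_cast
          ring
      _ = _ := by
          rw [hscal, Finset.mul_sum]
          refine Finset.sum_congr rfl fun α _ => ?_
          rw [Frame.kernel]
          push_cast
          ring

end IsVahlen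

theorem exists_smooth_eventuallyEq {U : Set (Vec m)} (hU : IsOpen U) {g : Vec m → ℂ}
    (hg : ContDiffOn ℝ ∞ g U) {y : Vec m} (hy : y ∈ U) :
    ∃ h : Smooth m, (h : Vec m → ℂ) =ᶠ[nhds y] g := by
  obtain ⟨χ, K, hχ, hK, hKU, hχ0, hχ1⟩ := exists_cutoff hU hy
  refine ⟨⟨_, contDiff_indicator_of_compact hU hK hKU (hχ.contDiffOn.mul hg) fun x _ hx => by
    rw [hχ0 x hx, zero_mul]⟩, ?_⟩
  filter_upwards [hχ1, hU.mem_nhds hy] with x hx hxU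
  simp [hxU, hx]

/-- Conformal covariance of operators with a conformally covariant fundamental solution. -/
theorem DiffOp.covariance [FiniteDimensional ℂ W] (hm : 1 ≤ m) {a b c d : Cl m}
    (hV : IsVahlen a b c d) (A : SpinAction m W) (V : Submodule ℂ (Vec m → W))
    [FiniteDimensional ℂ V] (hsm : ∀ g ∈ V, ContDiff ℝ ∞ g)
    (hA : ∀ x : Vec m, x ≠ 0 → ∀ g ∈ V, A.act (vec x) g ∈ V) {D : DiffOp m W}
    (hD : ∀ n I, ∀ g ∈ V, D.coeff n I g ∈ V) {κ : ℂ} {w : ℤ} (hw : 1 ≤ w + A.deg + m)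
    {J : Type*} {Z : J → Vec m → W} (hZ : Submodule.span ℂ (Set.range Z) = V)
    (hΔ : ∀ i, D.EqDelta (fun x u => κ • ((‖x‖ ^ w : ℝ) : ℂ) • A.act (vec x) (Z i) u) (Z i))
    {f : Vec m → Vec m → W} (hf : ∀ u, ContDiff ℝ ∞ fun x => f x u) (hfV : ∀ x, f x ∈ V)
    {y : Vec m} (hy : c * vec y + d ≠ 0) (u : Vec m) :
    ∃ δ σ : ℝ, (δ = 1 ∨ δ = -1) ∧ (σ = 1 ∨ σ = -1) ∧
      a * rev d - b * rev c = algebraMap ℝ (Cl m) δ ∧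
      (c * vec y + d) * rev (c * vec y + d) =
        algebraMap ℝ (Cl m) (σ * clNorm (c * vec y + d) ^ 2) ∧
      ((((δ * σ) ^ A.deg : ℝ) : ℂ) *
        ((clNorm (c * vec y + d) ^ (-2 * (m : ℤ) - 2 * A.deg - w) : ℝ) : ℂ)) •
          A.val (c * vec y + d) (D.app f (mobius a b c d y) (rot (c * vec y + d) u)) =
      D.app (fun y₁ u₁ => ((clNorm (c * vec y₁ + d) ^ w : ℝ) : ℂ) •
        A.val (c * vec y₁ + d) (f (mobius a b c d y₁) (rot (c * vec y₁ + d) u₁))) y u := by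
  obtain ⟨δ, hδ, hdet⟩ := hV.exists_det
  obtain ⟨σ, hσ, hs⟩ := hV.exists_sign_denom
  refine ⟨δ, σ, hδ, hσ, hdet, hs y, ?_⟩
  obtain ⟨F⟩ := exists_frame V
  obtain ⟨e, hye, hsrc, he⟩ := hV.exists_homeomorph hy
  have hI := hV.isIntertwiner F A hsm hA hδ hdet hσ hs κ w hsrc he
  have hE := F.isFundamental A hm hsm hA hw hZ hΔ
  have hcoord : ∀ α, ContDiff ℝ ∞ fun x => F.coord α (f x) := fun α => by
    have := pointFunctional_contDiffOn (F.coord_mem α) (F := f) (U := Set.univ)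
      fun u => (hf u).contDiffOn
    rwa [contDiffOn_univ] at this
  let fc : Fin (Module.finrank ℂ V) → Smooth m := fun α => ⟨fun x => F.coord α (f x), hcoord α⟩
  have hG : ∀ β, ContDiffOn ℝ ∞ (fun x => ∑ α, ((clNorm (c * vec x + d) ^ w : ℝ) : ℂ) *
      F.mat A (c * vec x + d) β α * (fc α : Vec m → ℂ) (e x)) e.source := fun β =>
    ContDiffOn.sum fun α _ => (hI.contDiffOn_left β α).mul
      ((smooth_contDiff (fc α)).comp_contDiffOn hI.contDiffOn)
  -- The transformed coordinates are smooth only where the denominator is nonzero; globally smooth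
  -- functions with the same germs at y replace them.
  choose g hg using fun β => exists_smooth_eventuallyEq e.open_source (hG β) hye
  have hcov := hE.covariance hm hI hye fc g hg
  have happ1 := DiffOp.app_eq F hD (f := f) (x := mobius a b c d y) (g := fc)
    (Filter.Eventually.of_forall fun x => F.sum_coord (hfV x))
  have hev : ∀ᶠ x in nhds y, (fun u₁ => ((clNorm (c * vec x + d) ^ w : ℝ) : ℂ) •
      A.val (c * vec x + d) (f (mobius a b c d x) (rot (c * vec x + d) u₁))) =
        ∑ α, (g α : Vec m → ℂ) x • (F.basis α : Vec m → W) := by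
    filter_upwards [Filter.eventually_all.2 hg, e.open_source.mem_nhds hye] with x hx hxs
    have h1 := F.coord_act A (F.act_basis A hA (hV.isVecProd_denom x) (hsrc x hxs))
      (hfV (mobius a b c d x))
    change ((clNorm (c * vec x + d) ^ w : ℝ) : ℂ) • A.act (c * vec x + d) (f (mobius a b c d x)) = _
    rw [h1, Finset.smul_sum]
    refine Finset.sum_congr rfl fun α _ => ?_
    rw [hx α, smul_smul, Finset.mul_sum, he]
    congr 1
    exact Finset.sum_congr rfl fun β _ => (mul_assoc _ _ _).symm
  rw [DiffOp.app_eq F hD hev u]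
  have h2 := F.coord_act A (F.act_basis A hA (hV.isVecProd_denom y) hy)
    (g := D.app f (mobius a b c d y)) (by
      rw [funext happ1]
      have : (fun u => ∑ β, (∑ α, (diffPoly (D.symbol F β α) (fc α) : Vec m → ℂ)
          (mobius a b c d y)) • (F.basis β : Vec m → W) u) =
          ∑ β, (∑ α, (diffPoly (D.symbol F β α) (fc α) : Vec m → ℂ)
          (mobius a b c d y)) • (F.basis β : Vec m → W) := by
        ext1 u
        simp
      rw [this]
      exact Submodule.sum_mem _ fun β _ => Submodule.smul_mem _ _ (F.basis β).2)
  have h3 : ∀ γ, F.coord γ (D.app f (mobius a b c d y)) =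
      ∑ α, (diffPoly (D.symbol F γ α) (fc α) : Vec m → ℂ) (mobius a b c d y) := by
    intro γ
    have : D.app f (mobius a b c d y) =
          ∑ β, (∑ α, (diffPoly (D.symbol F β α) (fc α) : Vec m → ℂ)
          (mobius a b c d y)) • (F.basis β : Vec m → W) := by
      ext1 u
      rw [happ1]
      simp
    rw [this, map_sum]
    simp only [map_smul, F.coord_basis, smul_eq_mul]
    simp
  change _ • A.act (c * vec y + d) (D.app f (mobius a b c d y)) u = _
  rw [h2, Finset.sum_apply, Finset.smul_sum]
  refine Finset.sum_congr rfl fun β _ => ?_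
  rw [Pi.smul_apply, smul_smul, Finset.mul_sum, ← hcov β]
  congr 1
  refine Finset.sum_congr rfl fun γ _ => ?_
  rw [h3, he]
  ring

end HigherSpin

namespace HigherSpin

/-! ### The bosonic case. -/

section Even

variable {m : ℕ}

instance harmonicSpace_finiteDimensional (m k : ℕ) : FiniteDimensional ℂ (harmonicSpace m k) :=
  Submodule.finiteDimensional_of_le (S₂ := homPoly m k ℂ) fun _ hf => hf.1

/-- The trivial action. -/
def trivialAction (m : ℕ) : SpinAction m ℂ where
  val _ := LinearMap.id
  deg := 0
  val_one _ := rfl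
  val_mul _ _ _ := rfl
  val_smul r s w := by simp
  val_contDiff _ := contDiff_const

theorem trivialAction_act_mem {k : ℕ} {x : Vec m} (hx : x ≠ 0) {g : Vec m → ℂ}
    (hg : g ∈ harmonicSpace m k) : (trivialAction m).act (vec x) g ∈ harmonicSpace m k := by
  obtain ⟨L, hL, -⟩ := (isVecProd_vec x).exists_rot_eq (fun h => hx (vec_eq_zero.1 h))
  have : (trivialAction m).act (vec x) g = fun u => g (L u) := by
    ext1 u
    exact congrArg g (hL u)
  rw [this]
  exact isHarmonicPoly_comp_isometry hg L

/-- The pairing with Z(·, v) is evaluation at v, so a function orthogonal to all kernels vanishes.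
-/
theorem span_range_harmonicKernel {k : ℕ} {Z : Vec m → Vec m → ℂ} (hZ : IsHarmonicKernel k Z) :
    Submodule.span ℂ (Set.range fun v u => Z u v) = harmonicSpace m k := by
  refine span_range_eq_of_separating
    (LinearMap.mk₂'ₛₗ (starRingEnd ℂ) (RingHom.id ℂ) (fun w w' => starRingEnd ℂ w * w')
      (fun x y z => by rw [map_add, add_mul]) (fun r x y => by simp [mul_assoc])
      (fun x y z => mul_add _ _ _) (fun r x y => by simp; ring))
    (harmonicSpace m k) (fun f hf => (homPoly_contDiff hf.1).continuous) (fun v u => Z u v)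
    hZ.1 fun f hf h => ?_
  ext v
  rw [hZ.2 f hf v]
  exact h v

theorem IsBosonicOp.covariance (hm : 1 ≤ m) {a b c d : Cl m} (hV : IsVahlen a b c d) {k j : ℕ}
    (hj : 1 ≤ j) {D : DiffOp m ℂ} (hD : IsBosonicOp k j D) {f : Vec m → Vec m → ℂ}
    (hf : IsSmoothInto (IsHarmonicPoly k) f) {y : Vec m} (hy : c * vec y + d ≠ 0) (u : Vec m) :
    D.app f (mobius a b c d y) (rot (c * vec y + d) u) =
      (coweightEven j (c * vec y + d))⁻¹ •
        D.app (fun y₁ u₁ => weightEven j (c * vec y₁ + d) •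
          f (mobius a b c d y₁) (rot (c * vec y₁ + d) u₁)) y u := by
  obtain ⟨hact, Z, hZ, κ, -, hΔ⟩ := hD
  -- The action has degree 0 and w = 2j − m. Local integrability requires 2j ≥ 1, and the coweight
  -- exponent −2m − w is −m − 2j.
  obtain ⟨δ, σ, -, -, -, -, h⟩ := DiffOp.covariance (w := 2 * (j : ℤ) - m) (κ := κ) (f := f) hm hV
    (trivialAction m) (harmonicSpace m k) (fun g hg => homPoly_contDiff hg.1)
    (fun x hx g hg => trivialAction_act_mem hx hg) hact
    (by simp only [trivialAction]; push_cast; omega) (span_range_harmonicKernel hZ) hΔ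
    (fun u => hf.1.comp (contDiff_id.prodMk contDiff_const)) hf.2 hy u
  have hn := ((hV.isVecProd_denom y).clNorm_pos hy).ne'
  have hR : (fun y₁ u₁ => weightEven j (c * vec y₁ + d) •
      f (mobius a b c d y₁) (rot (c * vec y₁ + d) u₁)) = fun y₁ u₁ =>
      ((clNorm (c * vec y₁ + d) ^ (2 * (j : ℤ) - m) : ℝ) : ℂ) •
        (trivialAction m).val (c * vec y₁ + d)
          (f (mobius a b c d y₁) (rot (c * vec y₁ + d) u₁)) := by
    ext y₁ u₁
    exact (Complex.coe_smul _ _).symm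
  have hexp : -2 * (m : ℤ) - 2 * ((trivialAction m).deg : ℕ) - (2 * (j : ℤ) - m) =
      -(m : ℤ) - 2 * (j : ℤ) := by
    simp only [trivialAction]
    push_cast
    ring
  rw [hR, ← h, hexp]
  change _ = _ • (((((δ * σ) ^ 0 : ℝ) : ℂ)) * _) • D.app f _ _
  rw [pow_zero, Complex.ofReal_one, one_mul, Complex.coe_smul, smul_smul, coweightEven,
    inv_mul_cancel₀ (zpow_ne_zero _ hn), one_smul]

end Even

/-! ### The fermionic case. -/

section Odd

variable {m : ℕ} {W : Type*} [NormedAddCommGroup W] [NormedSpace ℂ W]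
  (ρ : Cl m →ₐ[ℝ] Module.End ℂ W)

theorem rho_smul (r : ℝ) (s : Cl m) (w : W) : ρ (r • s) w = (r : ℂ) • ρ s w := by
  rw [map_smul, Complex.coe_smul]
  rfl

theorem rho_mul (s t : Cl m) (w : W) : ρ (s * t) w = ρ s (ρ t w) := by
  rw [map_mul]
  rfl

variable [FiniteDimensional ℂ W]

instance monogenicSpace_finiteDimensional (k : ℕ) : FiniteDimensional ℂ (monogenicSpace ρ k) :=
  Submodule.finiteDimensional_of_le (S₂ := homPoly m k W) fun _ hf => hf.1

/-- The action `s ↦ s̃` on a Clifford module. -/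
def reverseAction : SpinAction m W where
  val s := ρ (rev s)
  deg := 1
  val_one w := by rw [rev_one, map_one]; rfl
  val_mul s t w := by rw [rev_mul, rho_mul]
  val_smul r s w := by rw [rev_smul, rho_smul, pow_one]
  val_contDiff w := by
    let T : Vec m →ₗ[ℝ] W :=
      { toFun := fun x => ρ (rev (vec x)) w
        map_add' := fun x y => by rw [rev_vec, vec_add, map_add, rev_vec, rev_vec]; rfl
        map_smul' := fun r x => by
          rw [rev_vec, vec_smul, rho_smul, rev_vec, Complex.coe_smul]; rfl }
    exact (LinearMap.toContinuousLinearMap T).contDiff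

/-- If f is orthogonal to all Z(·, v) w, take w = f(v). Conjugation is the adjoint for the invariant
form, so the reproducing property gives B(f(v), f(v)) = 0. -/
theorem span_range_monogenicKernel {k : ℕ} {Z : Vec m → Vec m → Cl m}
    (hZ : IsMonogenicKernel ρ k Z) :
    Submodule.span ℂ (Set.range fun (p : Vec m × W) u => ρ (Z u p.1) p.2) =
      monogenicSpace ρ k := by
  obtain ⟨B, hpos, hB⟩ := exists_invariant_form ρ
  refine span_range_eq_of_separating B
    (monogenicSpace ρ k) (fun f hf => (homPoly_contDiff hf.1).continuous)
    (fun (p : Vec m × W) u => ρ (Z u p.1) p.2) (fun p => hZ.1 p.1 p.2) fun f hf h => ?_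
  ext v
  have hv := hZ.2 f hf v
  by_contra hne
  -- A non-integrable function has integral 0 by convention, in which case the reproducing formula
  -- already gives f(v) = 0.
  have hint : Integrable (fun u : Metric.sphere (0 : Vec m) 1 => ρ (conj (Z (u : Vec m) v))
      (f (u : Vec m))) (sphereMeasure m) := by
    by_contra hni
    exact hne (hv.trans (integral_undef hni))
  have h1 := ContinuousLinearMap.integral_comp_comm
    (LinearMap.toContinuousLinearMap (B (f v))) hint
  have h2 := h (v, f v)
  simp only [hB] at h2
  rw [← hv] at h1
  have h3 : B (f v) (f v) = 0 := h1.symm.trans h2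
  have := hpos (f v) hne
  rw [h3] at this
  exact lt_irrefl _ this

theorem IsFermionicOp.covariance (hm : 1 ≤ m) {a b c d : Cl m} (hV : IsVahlen a b c d) {k j : ℕ}
    (hj : 1 ≤ j) {D : DiffOp m W} (hD : IsFermionicOp ρ k j D) {f : Vec m → Vec m → W}
    (hf : IsSmoothInto (IsMonogenicPoly ρ k) f) {y : Vec m} (hy : c * vec y + d ≠ 0)
    (u : Vec m) :
    D.app f (mobius a b c d y) (rot (c * vec y + d) u) =
      ρ (Ring.inverse (coweightOdd j a b c d (c * vec y + d)))
        (D.app (fun y₁ u₁ => ρ (weightOdd j (c * vec y₁ + d))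
          (f (mobius a b c d y₁) (rot (c * vec y₁ + d) u₁))) y u) := by
  obtain ⟨hact, Z, hZ, κ, -, hΔ⟩ := hD
  have hzpow : ∀ r : ℝ, (r ^ ((m : ℤ) - 2 * (j : ℤ) + 2))⁻¹ = r ^ (2 * (j : ℤ) - m - 2) := by
    intro r
    rw [← zpow_neg]
    congr 1
    ring
  -- The factor x contributes degree 1, so w = 2j − m − 2. Integrability requires 2j − 1 ≥ 1, and
  -- −2m − 2 − w is again −m − 2j.
  obtain ⟨δ, σ, hδ, hσ, hdet, hs, h⟩ := DiffOp.covariance (w := 2 * (j : ℤ) - m - 2) (κ := κ) (f := f) hm hV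
    (reverseAction ρ) (monogenicSpace ρ k) (fun g hg => homPoly_contDiff hg.1)
    (fun x hx g hg => by
      have : (reverseAction ρ).act (vec x) g = fun u => ρ (vec x) (g (rot (vec x) u)) := by
        ext1 u
        simp only [SpinAction.act, reverseAction, rev_vec]
      rw [this]
      exact isMonogenicPoly_act ρ hg hx) hact
    (by simp only [reverseAction]; push_cast; omega) (span_range_monogenicKernel ρ hZ)
    (fun p => by
      convert hΔ p.1 p.2 using 2 with x
      ext1 u
      rw [kernelOdd, hzpow, rho_smul, rho_mul, SpinAction.act]
      simp only [reverseAction, rev_vec])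
    (fun u => hf.1.comp (contDiff_id.prodMk contDiff_const)) hf.2 hy u
  have hsP := hV.isVecProd_denom y
  have hn := hsP.clNorm_pos hy
  have hR : (fun y₁ u₁ => ρ (weightOdd j (c * vec y₁ + d))
      (f (mobius a b c d y₁) (rot (c * vec y₁ + d) u₁))) = fun y₁ u₁ =>
      ((clNorm (c * vec y₁ + d) ^ (2 * (j : ℤ) - m - 2) : ℝ) : ℂ) •
        (reverseAction ρ).val (c * vec y₁ + d)
          (f (mobius a b c d y₁) (rot (c * vec y₁ + d) u₁)) := by
    ext y₁ u₁
    rw [weightOdd, hzpow, rho_smul]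
    rfl
  set s := c * vec y + d with hs_def
  have hδσ : δ * σ ≠ 0 := by rcases hδ with rfl | rfl <;> rcases hσ with rfl | rfl <;> norm_num
  -- Here s s̃ = σ‖s‖², so the sign ε is exactly the factor δσ that an action of degree 1 leaves in
  -- the intertwining relation.
  have hcow : coweightOdd j a b c d s =
      (δ * σ * clNorm s ^ (-2 * (m : ℤ) - 2 * ((reverseAction ρ).deg : ℕ) -
        (2 * (j : ℤ) - m - 2))) • rev s := by
    rw [coweightOdd, vahlenSign, hdet, hs, ← map_mul, smul_mul_assoc, ← Algebra.smul_def,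
      smul_smul, smul_smul, ← zpow_neg]
    congr 1
    have : -2 * (m : ℤ) - 2 * ((reverseAction ρ).deg : ℕ) - (2 * (j : ℤ) - m - 2) =
        -((m : ℤ) + 2 * j) := by
      simp only [reverseAction]
      push_cast
      ring
    rw [this]
    field_simp
  have hu : IsUnit (coweightOdd j a b c d s) := by
    rw [hcow, Algebra.smul_def]
    refine IsUnit.mul ?_ (hsP.rev.isUnit (IsVecProd.rev_ne_zero hy))
    exact (IsUnit.mk0 _ (mul_ne_zero hδσ (zpow_ne_zero _ hn.ne'))).map (algebraMap ℝ (Cl m))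
  have key : ρ (coweightOdd j a b c d s) (D.app f (mobius a b c d y) (rot s u)) =
      D.app (fun y₁ u₁ => ρ (weightOdd j (c * vec y₁ + d))
        (f (mobius a b c d y₁) (rot (c * vec y₁ + d) u₁))) y u := by
    rw [hR, ← h, hcow, rho_smul, Complex.ofReal_mul]
    simp only [reverseAction, pow_one]
  rw [← key, ← rho_mul, Ring.inverse_mul_cancel _ hu, map_one]
  rfl

end Odd

end HigherSpin

end

theorem mainTheorem9 (m : ℕ) (hm : 1 ≤ m) (a b c d : HigherSpin.Cl m)
    (hV : HigherSpin.IsVahlen a b c d) (k j : ℕ) (hj : 1 ≤ j) :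
    (∀ D : HigherSpin.DiffOp m ℂ, HigherSpin.IsBosonicOp k j D →
      ∀ f : HigherSpin.Vec m → HigherSpin.Vec m → ℂ,
        HigherSpin.IsSmoothInto (HigherSpin.IsHarmonicPoly k) f →
      ∀ y u : HigherSpin.Vec m, c * HigherSpin.vec y + d ≠ 0 →
        D.app f (HigherSpin.mobius a b c d y) (HigherSpin.rot (c * HigherSpin.vec y + d) u) =
          (HigherSpin.coweightEven j (c * HigherSpin.vec y + d))⁻¹ •
            D.app (fun y₁ u₁ => HigherSpin.weightEven j (c * HigherSpin.vec y₁ + d) •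
              f (HigherSpin.mobius a b c d y₁)
                (HigherSpin.rot (c * HigherSpin.vec y₁ + d) u₁)) y u) ∧
    (∀ (W : Type*) [NormedAddCommGroup W] [NormedSpace ℂ W] [FiniteDimensional ℂ W]
      (ρ : HigherSpin.Cl m →ₐ[ℝ] Module.End ℂ W),
      ∀ D : HigherSpin.DiffOp m W, HigherSpin.IsFermionicOp ρ k j D →
      ∀ f : HigherSpin.Vec m → HigherSpin.Vec m → W,
        HigherSpin.IsSmoothInto (HigherSpin.IsMonogenicPoly ρ k) f →
      ∀ y u : HigherSpin.Vec m, c * HigherSpin.vec y + d ≠ 0 →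
        D.app f (HigherSpin.mobius a b c d y) (HigherSpin.rot (c * HigherSpin.vec y + d) u) =
          ρ (Ring.inverse (HigherSpin.coweightOdd j a b c d (c * HigherSpin.vec y + d)))
            (D.app (fun y₁ u₁ => ρ (HigherSpin.weightOdd j (c * HigherSpin.vec y₁ + d))
              (f (HigherSpin.mobius a b c d y₁)
                (HigherSpin.rot (c * HigherSpin.vec y₁ + d) u₁))) y u)) := by
  exact ⟨fun _ hD _ hf _ u hy => hD.covariance hm hV hj hf hy u,
    fun _ _ _ _ ρ _ hD _ hf _ u hy => HigherSpin.IsFermionicOp.covariance ρ hm hV hj hD hf hy u⟩
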